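/- Let $(P,\eta,\Lambda)$ be a Delzant labelled polytope: $P=\{L_1>0,\dots,L_d>0\}$ is a nonempty bounded open convex polytope in $\mathfrak t^*\cong\mathbb R^n$ with facets $F_1,\dots,F_d$, which is simple, $L_k$ is affine-linear with $dL_k=\eta_k\in\mathfrak t$ the chosen inward normal of $F_k$, and $\Lambda\subset\mathfrak t$ is a lattice such that at each vertex $p$ of $\overline P$ the normals $\eta_k$ of the facets through $p$ form a $\mathbb Z$-basis of $\Lambda$. Let $T=\mathfrak t/2\pi\Lambda$, and let $(M,\omega,T)$ with moment map $x:M\to\mathfrak t^*$ be the associated compact symplectic toric manifold: $M=(\overline P\times T)/\!\sim$, where over the relative interior of a face $F$ one divides by the subtorus generated by the $\eta_k$ with $F\subset F_k$, with the smooth structure and the symplectic form for which, at each vertex $p$ with normals $\eta_{k_1},\dots,\eta_{k_n}$ and dual basis $\eta_{k_i}^*$, the map $z\mapsto\big[p+\tfrac12\sum_i|z_i|^2\eta_{k_i}^*,\ \sum_i\arg(z_i)\,\eta_{k_i}\big]$ is a symplectic parametrization by an open subset of $\mathbb C^n$ with its standard symplectic form. Let $\nu=\{\nu_1,\dots,\nu_d\}$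 be any other set of inward normals to the facets of $P$, with defining functions $L_k^\nu$ ($dL_k^\nu=\nu_k$, $L_k^\nu=0$ on $F_k$). Let $u\in\mathcal S(P,\nu)$ be a symplectic potential: $u$ is continuous on $\overline P$; its restriction to $P$, and to the relative interior of each face of positive dimension, is smooth with positive definite Hessian; and $u-\tfrac12\sum_kL_k^\nu\log L_k^\nu$ is the restriction to $\overline P$ of a smooth function on an open neighbourhood of $\overline P$. Then: 1. The set $\mathring M$ of points of $M$ with trivial stabilizer in $T$ equals $x^{-1}(P)$ and is open and dense. On $\mathring M$, with action-angle coordinates $(x,\theta)$ from $\mathring M=P\times T$, one has $\omega=\sum_i dx_i\wedge d\theta_i$, and $$g_u=\sum_{i,j}G_{ij}\,dx_i\otimes dx_j+H_{ij}\,d\theta_i\otimes d\theta_j,\qquad G=\mathrm{Hess}\,u,\quad H=G^{-1},$$ is a smooth $T$-invariant Kähler metric compatible with $\omega$. 2. For each $k$ there is a unique real number $a_k$ with $a_k\nu_k=\eta_k$, and $a_k>0$. Let $D_k=x^{-1}(\mathring F_k)$ be the preimage of the relative interior of $F_k$. Say that $g_u$ has angle $\beta$ along $D_k$ if near each point of $D_k$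 there are a smooth submersion $w=re^{\sqrt{-1}\varphi}$ to $\mathbb C$ with $D_k=\{w=0\}$, a constant $c>0$ and a smooth symmetric 2-tensor $B$ such that off $D_k$ $$g_u=c\Big(dr\otimes dr+\big(\tfrac{\beta}{2\pi}\big)^2r^2\,d\varphi\otimes d\varphi\Big)+B,$$ and such that at the points of $D_k$ the tensor $B$ is positive definite on $TD_k$ with radical complementary to $TD_k$. Then: - if $a_k<1$, $g_u$ has a singularity of conical type along $D_k$, with angle $2\pi a_k<2\pi$; - if $a_k=1$, $g_u$ extends to a smooth Riemannian metric on $\mathring M\cup D_k$; - if $a_k>1$, $g_u$ has a singularity of large angle along $D_k$, with angle $2\pi a_k>2\pi$. If $a_k\ne1$, then $g_u$ does not extend to a smooth tensor on a neighbourhood of any point of $D_k$. The behaviour along $D_k$ depends only on $a_k$: if $\nu'$ is another set of inward normals with $a_k\nu'_k=\eta_k$ and $u'\in\mathcal S(P,\nu')$, then $g_u-g_{u'}$ extends to a smooth tensor on $\mathring M\cup D_k$. -/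

import Mathlib

open scoped Matrix Manifold ContDiff

noncomputable section

namespace Toric

/-- A labelled polytope in `𝔱* = ℝⁿ` with `d` facets: the normals `ν₁, …, ν_d` in `𝔱 = ℝⁿ` and the
constant terms of the defining functions `L_k(x) = ⟨x, ν_k⟩ + c_k`. The open polytope
`{L_k > 0 for all k}` is nonempty, its closure is compact, each `{L_k = 0}` cuts out a facet with
nonempty relative interior (so that no two facets coincide), and the polytope is simple. -/
structure LabelledPolytope (n d : ℕ) where
  normal : Fin d → Fin n → ℝ
  const : Fin d → ℝ
  nonempty' : ∃ x : Fin n → ℝ, ∀ k, 0 < x ⬝ᵥ normal k + const k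
  bounded' : Bornology.IsBounded {x : Fin n → ℝ | ∀ k, 0 ≤ x ⬝ᵥ normal k + const k}
  facet' : ∀ k, ∃ x : Fin n → ℝ,
    x ⬝ᵥ normal k + const k = 0 ∧ ∀ j, j ≠ k → 0 < x ⬝ᵥ normal j + const j
  simple' : ∀ x : Fin n → ℝ, (∀ k, 0 ≤ x ⬝ᵥ normal k + const k) →
    LinearIndependent ℝ (fun k : {k : Fin d // x ⬝ᵥ normal k + const k = 0} => normal k)

namespace LabelledPolytope

variable {n d : ℕ} (P : LabelledPolytope n d)

/-- The defining function `L_k`. -/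
def L (k : Fin d) (x : Fin n → ℝ) : ℝ := x ⬝ᵥ P.normal k + P.const k

/-- The open polytope `P`. -/
def openSet : Set (Fin n → ℝ) := {x | ∀ k, 0 < P.L k x}

/-- The compact polytope `P̄`. -/
def closedSet : Set (Fin n → ℝ) := {x | ∀ k, 0 ≤ P.L k x}

/-- The closed facet `F_k`. -/
def facet (k : Fin d) : Set (Fin n → ℝ) := {x | x ∈ P.closedSet ∧ P.L k x = 0}

/-- The relative interior of the facet `F_k`. -/
def facetInterior (k : Fin d) : Set (Fin n → ℝ) := {x | P.L k x = 0 ∧ ∀ j, j ≠ k → 0 < P.L j x}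

/-- The indices of the facets that contain `x`; for `x` in the relative interior of a face `F`
this is the set `I_F`. -/
def active (x : Fin n → ℝ) : Finset (Fin d) := {k | P.L k x = 0}

/-- The relative interior of the face `⋂_{k ∈ I} F_k`. -/
def faceInterior (I : Finset (Fin d)) : Set (Fin n → ℝ) :=
  {x | x ∈ P.closedSet ∧ P.active x = I}

/-- The vertices of `P̄`: the points that lie on `n` facets. -/
def IsVertex (p : Fin n → ℝ) : Prop := p ∈ P.closedSet ∧ (P.active p).card = n

/-- `(P, η, Λ)` is Delzant: the normals lie in `Λ`, and at each vertex the normals of the facets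
through it generate `Λ` (as they are linearly independent, they form a `ℤ`-basis of `Λ`, and `Λ` is
a lattice). -/
structure IsDelzant (Λ : Submodule ℤ (Fin n → ℝ)) : Prop where
  rational : ∀ k, P.normal k ∈ Λ
  unimodular : ∀ p, P.IsVertex p → Submodule.span ℤ (P.normal '' {k | k ∈ P.active p}) = Λ

/-- Two labelled polytopes with the same underlying polytope and the same numbering of its facets:
they differ only in the choice of the inward normals. -/
structure SamePolytope (P Q : LabelledPolytope n d) : Prop where
  openSet_eq : Q.openSet = P.openSet
  facet_eq : ∀ k, Q.facet k = P.facet k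

/-- The Guillemin potential `½ ∑ L_k log L_k`. -/
def guillemin (x : Fin n → ℝ) : ℝ := 1 / 2 * ∑ k, P.L k x * Real.log (P.L k x)

/-- The set `𝒮(P, ν)` of symplectic potentials. Only the values on `P̄` matter. Strict convexity of
the restriction to the interior of a face means that its Hessian, on the tangent space of the face,
is positive definite. -/
structure IsSymplecticPotential (u : (Fin n → ℝ) → ℝ) : Prop where
  continuousOn : ContinuousOn u P.closedSet
  smooth_face : ∀ I : Finset (Fin d), ContDiffOn ℝ ∞ u (P.faceInterior I)
  convex_face : ∀ (I : Finset (Fin d)), ∀ x ∈ P.faceInterior I, ∀ v : Fin n → ℝ, v ≠ 0 →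
    (∀ k ∈ I, v ⬝ᵥ P.normal k = 0) → 0 < iteratedDeriv 2 (fun t : ℝ => u (x + t • v)) 0
  boundary : ∃ (U : Set (Fin n → ℝ)) (f : (Fin n → ℝ) → ℝ), IsOpen U ∧ P.closedSet ⊆ U ∧
    ContDiffOn ℝ ∞ f U ∧ ∀ x ∈ P.closedSet, u x - P.guillemin x = f x

/-! ### Vertices and the linear algebra at a vertex -/

variable {P}

lemma mem_active {x : Fin n → ℝ} {k : Fin d} : k ∈ P.active x ↔ P.L k x = 0 := by
  simp [active]

lemma L_add (k : Fin d) (x v : Fin n → ℝ) : P.L k (x + v) = P.L k x + v ⬝ᵥ P.normal k := by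
  simp only [L, add_dotProduct]; ring

lemma continuous_L (k : Fin d) : Continuous (P.L k) := by
  unfold L dotProduct; fun_prop

lemma linearIndependent_active {x : Fin n → ℝ} (hx : x ∈ P.closedSet) :
    LinearIndependent ℝ (fun k : P.active x => P.normal k) := by
  have h := P.simple' x hx
  let e : P.active x → {k : Fin d // x ⬝ᵥ P.normal k + P.const k = 0} :=
    fun k => ⟨k.1, mem_active.1 k.2⟩
  have he : Function.Injective e := by
    intro a b hab
    have := congrArg Subtype.val hab
    exact Subtype.ext this
  exact h.comp e he

lemma isCompact_closedSet : IsCompact P.closedSet := by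
  refine Metric.isCompact_of_isClosed_isBounded ?_ P.bounded'
  have : P.closedSet = ⋂ k, {x | 0 ≤ P.L k x} := by
    ext x; simp [closedSet]
  rw [this]
  exact isClosed_iInter fun k => isClosed_le continuous_const (continuous_L k)

/-- Each point of `P̄` lies on a face that contains a vertex. -/
lemma exists_vertex {x : Fin n → ℝ} (hx : x ∈ P.closedSet) :
    ∃ p, P.IsVertex p ∧ P.active x ⊆ P.active p := by
  classical
  let F : Set (Fin n → ℝ) := {y | y ∈ P.closedSet ∧ ∀ k ∈ P.active x, P.L k y = 0}
  have hFc : IsCompact F := by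
    refine isCompact_closedSet.inter_right (t := {y | ∀ k ∈ P.active x, P.L k y = 0}) ?_
    have : {y | ∀ k ∈ P.active x, P.L k y = 0} = ⋂ k ∈ P.active x, {y | P.L k y = 0} := by
      ext y; simp
    rw [this]
    exact isClosed_biInter fun k _ => isClosed_eq (continuous_L k) continuous_const
  obtain ⟨p, hp⟩ := hFc.extremePoints_nonempty ⟨x, hx, fun k hk => mem_active.1 hk⟩
  have hpF : p ∈ F := hp.1
  refine ⟨p, ⟨hpF.1, ?_⟩, fun k hk => mem_active.2 (hpF.2 k hk)⟩
  have hli := linearIndependent_active hpF.1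
  by_contra hcard
  have hle : (P.active p).card ≤ n := by
    have := hli.fintype_card_le_finrank
    simpa using this
  -- a direction orthogonal to all active normals
  have hker : ∃ v : Fin n → ℝ, v ≠ 0 ∧ ∀ k ∈ P.active p, v ⬝ᵥ P.normal k = 0 := by
    let f : (Fin n → ℝ) →ₗ[ℝ] (P.active p → ℝ) :=
      (Matrix.of fun k : P.active p => P.normal k).mulVecLin
    have : ¬ Function.Injective f := by
      intro hf
      have := LinearMap.finrank_le_finrank_of_injective hf
      simp at this
      omega
    have hk : LinearMap.ker f ≠ ⊥ := fun h => this (LinearMap.ker_eq_bot.1 h)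
    obtain ⟨v, hv, hv0⟩ := Submodule.exists_mem_ne_zero_of_ne_bot hk
    refine ⟨v, hv0, fun k hk => ?_⟩
    have := congrFun (LinearMap.mem_ker.1 hv) ⟨k, hk⟩
    simpa [f, Matrix.mulVec, dotProduct_comm] using this
  obtain ⟨v, hv0, hv⟩ := hker
  -- both `p + ε v` and `p - ε v` lie in `F` for small `ε`
  have hev : ∀ᶠ t : ℝ in nhds 0, p + t • v ∈ F := by
    have h1 : ∀ k, ∀ᶠ t : ℝ in nhds 0, 0 ≤ P.L k (p + t • v) := by
      intro k
      by_cases hk : k ∈ P.active p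
      · refine Filter.Eventually.of_forall fun t => ?_
        rw [L_add, mem_active.1 hk, smul_dotProduct, hv k hk]; simp
      · have hpos : 0 < P.L k p := lt_of_le_of_ne (hpF.1 k) (fun h => hk (mem_active.2 h.symm))
        have hc : Continuous fun t : ℝ => P.L k (p + t • v) :=
          (continuous_L k).comp (by fun_prop)
        have : ∀ᶠ t : ℝ in nhds 0, 0 < P.L k (p + t • v) :=
          hc.continuousAt.eventually (lt_mem_nhds (by simpa using hpos))
        exact this.mono fun t ht => ht.le
    filter_upwards [Filter.eventually_all.2 h1] with t ht
    refine ⟨ht, fun k hk => ?_⟩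
    have hk' : k ∈ P.active p := mem_active.2 (hpF.2 k hk)
    rw [L_add, mem_active.1 hk', smul_dotProduct, hv k hk']; simp
  obtain ⟨ε, hε, hball⟩ := Metric.eventually_nhds_iff.1 hev
  have h1 : p + (ε / 2) • v ∈ F := hball (by simp [abs_of_pos hε]; linarith)
  have h2 : p + (-(ε / 2)) • v ∈ F := hball (by simp [abs_of_pos hε]; linarith)
  have hmem : p ∈ openSegment ℝ (p + (ε / 2) • v) (p + (-(ε / 2)) • v) := by
    refine ⟨1 / 2, 1 / 2, by norm_num, by norm_num, by norm_num, ?_⟩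
    module
  have := hp.2 h1 h2 hmem
  have h3 : (ε / 2) • v = 0 := by simpa using this
  rcases smul_eq_zero.1 h3 with h | h
  · linarith
  · exact hv0 h

/-- The facets through the vertex `p`, in increasing order. -/
def vertexIdx {p : Fin n → ℝ} (hp : P.IsVertex p) : Fin n ↪o Fin d :=
  (P.active p).orderEmbOfFin hp.2

/-- The matrix whose rows are the normals at the vertex `p`; the columns of its inverse are the dual
basis. -/
def vertexMat {p : Fin n → ℝ} (hp : P.IsVertex p) : Matrix (Fin n) (Fin n) ℝ :=
  Matrix.of fun i => P.normal (vertexIdx hp i)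

lemma mem_active_vertex {p : Fin n → ℝ} (hp : P.IsVertex p) {k : Fin d} :
    k ∈ P.active p ↔ ∃ i, vertexIdx hp i = k := by
  have := (P.active p).range_orderEmbOfFin hp.2
  rw [← Finset.mem_coe, ← this]; rfl

lemma isUnit_det_vertexMat {p : Fin n → ℝ} (hp : P.IsVertex p) :
    IsUnit (vertexMat hp).det := by
  rw [← Matrix.isUnit_iff_isUnit_det, ← Matrix.linearIndependent_rows_iff_isUnit]
  have h := linearIndependent_active hp.1
  have hm : ∀ i, vertexIdx hp i ∈ P.active p := fun i => (mem_active_vertex hp).2 ⟨i, rfl⟩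
  exact h.comp (fun i => ⟨vertexIdx hp i, hm i⟩) (fun a b hab => by
    simpa using hab)


lemma vertexMat_inv_mul {p : Fin n → ℝ} (hp : P.IsVertex p) :
    (vertexMat hp)⁻¹ * vertexMat hp = 1 := Matrix.nonsing_inv_mul _ (isUnit_det_vertexMat hp)

lemma vertexMat_mul_inv {p : Fin n → ℝ} (hp : P.IsVertex p) :
    vertexMat hp * (vertexMat hp)⁻¹ = 1 := Matrix.mul_nonsing_inv _ (isUnit_det_vertexMat hp)

lemma normal_vecMul_inv {p : Fin n → ℝ} (hp : P.IsVertex p) (i : Fin n) :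
    P.normal (vertexIdx hp i) ᵥ* (vertexMat hp)⁻¹ = Pi.single i 1 := by
  have h := vertexMat_mul_inv hp
  have : P.normal (vertexIdx hp i) = Pi.single i 1 ᵥ* vertexMat hp := by
    ext j; simp [vertexMat]
  rw [this, Matrix.vecMul_vecMul, h, Matrix.vecMul_one]

/-! ### The toric manifold as a set -/

variable (P) (Λ : Submodule ℤ (Fin n → ℝ))

/-- The preimage in `𝔱` of the isotropy group in `T = 𝔱 / 2πΛ` of the points over `x`: it is generated
by `2πΛ` and by the normals of the facets through `x`. -/
def isotropy (x : Fin n → ℝ) : AddSubgroup (Fin n → ℝ) :=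
  (Λ.toAddSubgroup.map (DistribSMul.toAddMonoidHom (Fin n → ℝ) (2 * Real.pi))) ⊔
    (Submodule.span ℝ (P.normal '' {k | k ∈ P.active x})).toAddSubgroup

/-- `(x, θ) ∼ (x', θ')` if `x = x'` and `θ`, `θ'` have the same class in `T / T_F`, where `F` is the
face whose relative interior contains `x`. -/
def toricSetoid : Setoid (P.closedSet × (Fin n → ℝ)) where
  r a b := a.1 = b.1 ∧ a.2 - b.2 ∈ P.isotropy Λ a.1
  iseqv :=
    { refl := fun a => ⟨rfl, by simp [zero_mem]⟩
      symm := by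
        rintro a b ⟨h1, h2⟩
        refine ⟨h1.symm, ?_⟩
        rw [← h1, ← neg_sub]
        exact neg_mem h2
      trans := by
        rintro a b c ⟨h1, h2⟩ ⟨h3, h4⟩
        refine ⟨h1.trans h3, ?_⟩
        rw [← h1] at h4
        have := add_mem h2 h4
        simpa using this }

/-- The toric manifold `M` of the Delzant polytope `(P, η, Λ)`: the compactification
`(P̄ × T) / ∼` of `P × T`, where `T = 𝔱 / 2πΛ`. -/
def ToricManifold (_hP : P.IsDelzant Λ) : Type := Quotient (P.toricSetoid Λ)

lemma mem_isotropy {x t : Fin n → ℝ} : t ∈ P.isotropy Λ x ↔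
    ∃ l ∈ Λ, ∃ s ∈ Submodule.span ℝ (P.normal '' {k | k ∈ P.active x}),
      (2 * Real.pi) • l + s = t := by
  simp [isotropy, AddSubgroup.mem_sup]

lemma two_pi_smul_mem_isotropy {x l : Fin n → ℝ} (hl : l ∈ Λ) :
    (2 * Real.pi) • l ∈ P.isotropy Λ x :=
  (P.mem_isotropy Λ).2 ⟨l, hl, 0, zero_mem _, by simp⟩

variable {P Λ} {hP : P.IsDelzant Λ}

lemma closedSet_of_openSet {x : Fin n → ℝ} (hx : x ∈ P.openSet) : x ∈ P.closedSet :=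
  fun k => (hx k).le

variable (P) in
/-- A point of the open polytope. -/
def basePoint : P.closedSet :=
  ⟨P.nonempty'.choose, fun k => (P.nonempty'.choose_spec k).le⟩

namespace ToricManifold

variable (hP) in
/-- The class of `(x, θ)`, for `x ∈ P̄`. -/
def mk (a : P.closedSet × (Fin n → ℝ)) : ToricManifold P Λ hP := Quotient.mk (P.toricSetoid Λ) a

open Classical in
variable (hP) in
/-- The point `[x, θ]` of `M` for `x ∈ P̄` (for `x ∉ P̄` the value is irrelevant). Its restriction to
`P × 𝔱` gives the action-angle coordinates. -/
def pt (a : (Fin n → ℝ) × (Fin n → ℝ)) : ToricManifold P Λ hP :=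
  if h : a.1 ∈ P.closedSet then mk hP (⟨a.1, h⟩, a.2) else mk hP (P.basePoint, a.2)

lemma pt_of_mem {x θ : Fin n → ℝ} (hx : x ∈ P.closedSet) : pt hP (x, θ) = mk hP (⟨x, hx⟩, θ) :=
  dif_pos hx

/-- The moment map `x : M → 𝔱*`. -/
def moment (m : ToricManifold P Λ hP) : Fin n → ℝ :=
  Quotient.lift (s := P.toricSetoid Λ) (fun a => (a.1 : Fin n → ℝ))
    (fun _ _ h => congrArg Subtype.val h.1) m

lemma moment_mem (m : ToricManifold P Λ hP) : moment m ∈ P.closedSet := by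
  induction m using Quotient.inductionOn with
  | h a => exact a.1.2

lemma exists_pt (m : ToricManifold P Λ hP) : ∃ θ, m = pt hP (moment m, θ) := by
  induction m using Quotient.inductionOn with
  | h a =>
    exact ⟨a.2, (pt_of_mem a.1.2).symm⟩

lemma moment_pt {x θ : Fin n → ℝ} (hx : x ∈ P.closedSet) : moment (pt hP (x, θ)) = x := by
  rw [pt_of_mem hx]; rfl

lemma pt_eq_pt {x θ θ' : Fin n → ℝ} (hx : x ∈ P.closedSet) :
    pt hP (x, θ) = pt hP (x, θ') ↔ θ - θ' ∈ P.isotropy Λ x := by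
  rw [pt_of_mem hx, pt_of_mem hx]
  refine Quotient.eq (r := P.toricSetoid Λ) |>.trans ?_
  change (_ ∧ _) ↔ _
  simp

/-- The torus `T = 𝔱 / 2πΛ`. -/
abbrev _root_.Toric.Torus (Λ : Submodule ℤ (Fin n → ℝ)) : Type :=
  (Fin n → ℝ) ⧸ (Λ.toAddSubgroup.map (DistribSMul.toAddMonoidHom (Fin n → ℝ) (2 * Real.pi)))

/-- The action of `T` on `M` by translation of the angles. -/
instance : VAdd (Torus Λ) (ToricManifold P Λ hP) where
  vadd t m := Quotient.map₂ (sa := QuotientAddGroup.leftRel _) (sb := P.toricSetoid Λ)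
    (sc := P.toricSetoid Λ) (fun s a => (a.1, s + a.2)) (by
      rintro s s' hs a a' ⟨h1, h2⟩
      refine ⟨h1, ?_⟩
      have h3 : -s + s' ∈ P.isotropy Λ a.1 :=
        (le_sup_left : _ ≤ P.isotropy Λ a.1) (QuotientAddGroup.leftRel_apply.1 hs)
      have := add_mem (neg_mem h3) h2
      have e : s + a.2 - (s' + a'.2) = -(-s + s') + (a.2 - a'.2) := by abel
      simpa only [e] using this) t m

lemma mk_vadd_pt (s x θ : Fin n → ℝ) :
    (QuotientAddGroup.mk s : Torus Λ) +ᵥ pt hP (x, θ) = pt hP (x, s + θ) := by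
  by_cases hx : x ∈ P.closedSet
  · rw [pt_of_mem hx, pt_of_mem hx]; rfl
  · rw [pt, pt, dif_neg hx, dif_neg hx]; rfl

instance : AddAction (Torus Λ) (ToricManifold P Λ hP) where
  zero_vadd m := by
    obtain ⟨θ, h⟩ := exists_pt m
    rw [h, ← QuotientAddGroup.mk_zero, mk_vadd_pt, zero_add]
  add_vadd s t m := by
    obtain ⟨θ, h⟩ := exists_pt m
    induction s using QuotientAddGroup.induction_on with
    | H s =>
      induction t using QuotientAddGroup.induction_on with
      | H t => rw [h, ← QuotientAddGroup.mk_add, mk_vadd_pt, mk_vadd_pt, mk_vadd_pt, add_assoc]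

/-! ### The charts at the vertices -/

/-- The point `p + ½ ∑ |z_i|² η_i^*` of `𝔱*`. -/
def chartMoment {p : Fin n → ℝ} (hp : P.IsVertex p) (z : Fin n → ℂ) : Fin n → ℝ :=
  p + (vertexMat hp)⁻¹ *ᵥ (fun i => 1 / 2 * ‖z i‖ ^ 2)

/-- The angle `∑ arg(z_i) η_i` in `𝔱`. -/
def chartAngle {p : Fin n → ℝ} (hp : P.IsVertex p) (z : Fin n → ℂ) : Fin n → ℝ :=
  (fun i => Complex.arg (z i)) ᵥ* vertexMat hp

/-- The coordinates `z_i = √(2 L_i(x)) exp(√-1 θ_i)` at a vertex, where `θ = ∑ θ_i η_i`. -/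
def coord {p : Fin n → ℝ} (hp : P.IsVertex p) (x θ : Fin n → ℝ) (i : Fin n) : ℂ :=
  (Real.sqrt (2 * P.L (vertexIdx hp i) x) : ℂ) *
    Complex.exp (((θ ᵥ* (vertexMat hp)⁻¹) i : ℝ) * Complex.I)

lemma L_chartMoment {p : Fin n → ℝ} (hp : P.IsVertex p) (z : Fin n → ℂ) (i : Fin n) :
    P.L (vertexIdx hp i) (chartMoment hp z) = 1 / 2 * ‖z i‖ ^ 2 := by
  have h0 : P.L (vertexIdx hp i) p = 0 := mem_active.1 ((mem_active_vertex hp).2 ⟨i, rfl⟩)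
  rw [chartMoment, L_add, h0, zero_add, dotProduct_comm]
  have : P.normal (vertexIdx hp i) ⬝ᵥ (vertexMat hp)⁻¹ *ᵥ (fun i => 1 / 2 * ‖z i‖ ^ 2) =
      (vertexMat hp *ᵥ ((vertexMat hp)⁻¹ *ᵥ (fun i => 1 / 2 * ‖z i‖ ^ 2))) i := rfl
  rw [this, Matrix.mulVec_mulVec, vertexMat_mul_inv, Matrix.one_mulVec]

lemma norm_coord {p : Fin n → ℝ} (hp : P.IsVertex p) (x θ : Fin n → ℝ) (i : Fin n) :
    ‖coord hp x θ i‖ = Real.sqrt (2 * P.L (vertexIdx hp i) x) := by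
  rw [coord, norm_mul, Complex.norm_exp_ofReal_mul_I, mul_one, Complex.norm_real,
    Real.norm_of_nonneg (Real.sqrt_nonneg _)]

lemma chartMoment_coord {p : Fin n → ℝ} (hp : P.IsVertex p) {x : Fin n → ℝ}
    (hx : x ∈ P.closedSet) (θ : Fin n → ℝ) : chartMoment hp (coord hp x θ) = x := by
  have h1 : (fun i => 1 / 2 * ‖coord hp x θ i‖ ^ 2) = vertexMat hp *ᵥ (x - p) := by
    ext i
    rw [norm_coord, Real.sq_sqrt (by have := hx (vertexIdx hp i); positivity)]
    have h0 : P.L (vertexIdx hp i) p = 0 := mem_active.1 ((mem_active_vertex hp).2 ⟨i, rfl⟩)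
    have h2 : x = p + (x - p) := by abel
    have h3 : (vertexMat hp *ᵥ (x - p)) i = (x - p) ⬝ᵥ P.normal (vertexIdx hp i) := by
      rw [dotProduct_comm]; rfl
    rw [h3]
    conv_lhs => rw [h2, L_add, h0]
    ring
  rw [chartMoment, h1, Matrix.mulVec_mulVec, vertexMat_inv_mul, Matrix.one_mulVec]
  abel

lemma int_of_mem {p : Fin n → ℝ} (hP : P.IsDelzant Λ) (hp : P.IsVertex p) {l : Fin n → ℝ}
    (hl : l ∈ Λ) (i : Fin n) : ∃ N : ℤ, (l ᵥ* (vertexMat hp)⁻¹) i = N := by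
  rw [← hP.unimodular p hp] at hl
  induction hl using Submodule.span_induction with
  | mem y hy =>
    obtain ⟨k, hk, rfl⟩ := hy
    obtain ⟨j, rfl⟩ := (mem_active_vertex hp).1 hk
    rw [normal_vecMul_inv]
    by_cases h : i = j
    · subst h; exact ⟨1, by simp⟩
    · exact ⟨0, by simp [h]⟩
  | zero => exact ⟨0, by simp⟩
  | add y z _ _ h1 h2 =>
    obtain ⟨a, ha⟩ := h1
    obtain ⟨b, hb⟩ := h2
    exact ⟨a + b, by rw [Matrix.add_vecMul, Pi.add_apply, ha, hb]; push_cast; ring⟩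
  | smul c y _ h =>
    obtain ⟨a, ha⟩ := h
    refine ⟨c * a, ?_⟩
    rw [← Int.cast_smul_eq_zsmul ℝ c y, Matrix.smul_vecMul, Pi.smul_apply, ha]
    push_cast; rfl

lemma span_vecMul_inv {p : Fin n → ℝ} (hp : P.IsVertex p) {x : Fin n → ℝ}
    (hxp : P.active x ⊆ P.active p) {s : Fin n → ℝ}
    (hs : s ∈ Submodule.span ℝ (P.normal '' {k | k ∈ P.active x})) {i : Fin n}
    (hi : vertexIdx hp i ∉ P.active x) : (s ᵥ* (vertexMat hp)⁻¹) i = 0 := by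
  induction hs using Submodule.span_induction with
  | mem y hy =>
    obtain ⟨k, hk, rfl⟩ := hy
    obtain ⟨j, rfl⟩ := (mem_active_vertex hp).1 (hxp hk)
    rw [normal_vecMul_inv]
    have : i ≠ j := by rintro rfl; exact hi hk
    simp [this]
  | zero => simp
  | add y z _ _ h1 h2 => rw [Matrix.add_vecMul, Pi.add_apply, h1, h2, add_zero]
  | smul c y _ h => rw [Matrix.smul_vecMul, Pi.smul_apply, h, smul_zero]

lemma coord_eq {p : Fin n → ℝ} (hP : P.IsDelzant Λ) (hp : P.IsVertex p) {x θ θ' : Fin n → ℝ}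
    (hxp : P.active x ⊆ P.active p) (h : θ - θ' ∈ P.isotropy Λ x) :
    coord hp x θ = coord hp x θ' := by
  ext i
  by_cases hi : vertexIdx hp i ∈ P.active x
  · simp [coord, mem_active.1 hi]
  · obtain ⟨l, hl, s, hs, e⟩ := (P.mem_isotropy Λ).1 h
    obtain ⟨N, hN⟩ := int_of_mem hP hp hl i
    have h1 : θ = θ' + ((2 * Real.pi) • l + s) := by rw [e]; abel
    have h2 : (θ ᵥ* (vertexMat hp)⁻¹) i = (θ' ᵥ* (vertexMat hp)⁻¹) i + 2 * Real.pi * N := by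
      rw [h1, Matrix.add_vecMul, Matrix.add_vecMul, Matrix.smul_vecMul, Pi.add_apply, Pi.add_apply,
        Pi.smul_apply, hN, span_vecMul_inv hp hxp hs hi]
      simp
    unfold coord
    rw [h2]
    congr 1
    rw [Complex.exp_eq_exp_iff_exists_int]
    exact ⟨N, by push_cast; ring⟩

/-- The points of `M` over the faces that contain the vertex `p`. -/
def chartSource (hP : P.IsDelzant Λ) (p : Fin n → ℝ) : Set (ToricManifold P Λ hP) :=
  {m | P.active (moment m) ⊆ P.active p}

/-- The domain `U_p ⊆ ℂⁿ` of the parametrization at the vertex `p`. -/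
def chartTarget {p : Fin n → ℝ} (hp : P.IsVertex p) : Set (Fin n → ℂ) :=
  {z | ∀ k, k ∉ P.active p → 0 < P.L k (chartMoment hp z)}

lemma chartMoment_mem {p : Fin n → ℝ} (hp : P.IsVertex p) {z : Fin n → ℂ}
    (hz : z ∈ chartTarget hp) : chartMoment hp z ∈ P.closedSet := by
  intro k
  by_cases hk : k ∈ P.active p
  · obtain ⟨i, rfl⟩ := (mem_active_vertex hp).1 hk
    rw [L_chartMoment]; positivity
  · exact (hz k hk).le

open Classical in
/-- The coordinates on `M` at the vertex `p`, set to `0` off the domain. -/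
def chartFun {p : Fin n → ℝ} (hP : P.IsDelzant Λ) (hp : P.IsVertex p) (m : ToricManifold P Λ hP) :
    Fin n → ℂ :=
  Quotient.lift (s := P.toricSetoid Λ)
    (fun a => if P.active a.1 ⊆ P.active p then coord hp a.1 a.2 else 0)
    (by
      rintro a b ⟨h1, h2⟩
      simp only [← h1]
      split_ifs with h
      · exact coord_eq hP hp h h2
      · rfl) m

lemma chartFun_pt {p : Fin n → ℝ} (hp : P.IsVertex p) {x θ : Fin n → ℝ}
    (hx : x ∈ P.closedSet) (hxp : P.active x ⊆ P.active p) :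
    chartFun hP hp (pt hP (x, θ)) = coord hp x θ := by
  rw [pt_of_mem hx]
  exact if_pos hxp

lemma active_chartMoment {p : Fin n → ℝ} (hp : P.IsVertex p) {z : Fin n → ℂ}
    (hz : z ∈ chartTarget hp) : P.active (chartMoment hp z) ⊆ P.active p := by
  intro k hk
  by_contra h
  exact (hz k h).ne' (mem_active.1 hk)

/-- The chart at the vertex `p`; its inverse is
`z ↦ [p + ½ ∑ |z_i|² η_i^*, ∑ arg(z_i) η_i]`. -/
def chart {p : Fin n → ℝ} (hP : P.IsDelzant Λ) (hp : P.IsVertex p) :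
    PartialEquiv (ToricManifold P Λ hP) (Fin n → ℂ) where
  toFun := chartFun hP hp
  invFun z := pt hP (chartMoment hp z, chartAngle hp z)
  source := chartSource hP p
  target := chartTarget hp
  map_source' := by
    intro m hm k hk
    obtain ⟨θ, h⟩ := exists_pt m
    have hx := moment_mem m
    rw [h, chartFun_pt hp hx hm, chartMoment_coord hp hx]
    exact lt_of_le_of_ne (hx k) (fun e => hk (hm (mem_active.2 e.symm)))
  map_target' := by
    intro z hz
    change P.active _ ⊆ _
    rw [moment_pt (chartMoment_mem hp hz)]
    exact active_chartMoment hp hz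
  left_inv' := by
    intro m hm
    obtain ⟨θ, h⟩ := exists_pt m
    have hx := moment_mem m
    have hm' : P.active (moment m) ⊆ P.active p := hm
    generalize moment m = x at *
    subst h
    rw [chartFun_pt hp hx hm', chartMoment_coord hp hx, pt_eq_pt hx, mem_isotropy]
    -- the integers comparing the two angles away from the active facets
    have hint : ∀ i, ∃ N : ℤ, vertexIdx hp i ∉ P.active x →
        Complex.arg (coord hp x θ i) - (θ ᵥ* (vertexMat hp)⁻¹) i = 2 * Real.pi * N := by
      intro i
      by_cases hi : vertexIdx hp i ∈ P.active x
      · exact ⟨0, fun h => absurd hi h⟩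
      · have hpos : 0 < P.L (vertexIdx hp i) x :=
          lt_of_le_of_ne (hx _) (fun e => hi (mem_active.2 e.symm))
        have hr : 0 < Real.sqrt (2 * P.L (vertexIdx hp i) x) := Real.sqrt_pos.2 (by positivity)
        have h1 := Complex.norm_mul_exp_arg_mul_I (coord hp x θ i)
        rw [norm_coord] at h1
        have h2 : Complex.exp ((Complex.arg (coord hp x θ i) : ℝ) * Complex.I) =
            Complex.exp (((θ ᵥ* (vertexMat hp)⁻¹) i : ℝ) * Complex.I) := by
          have : (Real.sqrt (2 * P.L (vertexIdx hp i) x) : ℂ) ≠ 0 := by exact_mod_cast hr.ne'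
          exact mul_left_cancel₀ this h1
        obtain ⟨N, hN⟩ := Complex.exp_eq_exp_iff_exists_int.1 h2
        refine ⟨N, fun _ => ?_⟩
        have h3 : ((Complex.arg (coord hp x θ i) : ℂ) -
            (((θ ᵥ* (vertexMat hp)⁻¹) i : ℝ) : ℂ) - 2 * Real.pi * N) * Complex.I = 0 := by
          linear_combination hN
        have h4 := (mul_eq_zero.1 h3).resolve_right Complex.I_ne_zero
        have h5 : Complex.arg (coord hp x θ i) - (θ ᵥ* (vertexMat hp)⁻¹) i - 2 * Real.pi * N = 0 := by
          exact_mod_cast h4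
        linarith
    choose N hN using hint
    let c : Fin n → ℝ := fun i => Complex.arg (coord hp x θ i) - (θ ᵥ* (vertexMat hp)⁻¹) i
    have hsum : chartAngle hp (coord hp x θ) - θ = ∑ i, c i • P.normal (vertexIdx hp i) := by
      have h1 : θ = (θ ᵥ* (vertexMat hp)⁻¹) ᵥ* vertexMat hp := by
        rw [Matrix.vecMul_vecMul, vertexMat_inv_mul, Matrix.vecMul_one]
      conv_lhs => rw [h1]
      rw [chartAngle, ← Matrix.sub_vecMul, ← h1, Matrix.vecMul_eq_sum]
      rfl
    refine ⟨∑ i, N i • P.normal (vertexIdx hp i),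
      Submodule.sum_mem _ fun i _ => Λ.smul_mem _ (hP.rational _),
      ∑ i, (c i - 2 * Real.pi * N i) • P.normal (vertexIdx hp i), ?_, ?_⟩
    · refine Submodule.sum_mem _ fun i _ => ?_
      by_cases hi : vertexIdx hp i ∈ P.active x
      · exact Submodule.smul_mem _ _ (Submodule.subset_span ⟨_, hi, rfl⟩)
      · have : c i - 2 * Real.pi * N i = 0 := by rw [← hN i hi]; simp [c]
        rw [this, zero_smul]; exact zero_mem _
    · rw [hsum, Finset.smul_sum, ← Finset.sum_add_distrib]
      refine Finset.sum_congr rfl fun i _ => ?_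
      rw [← Int.cast_smul_eq_zsmul ℝ, smul_smul, ← add_smul]
      congr 1; ring
  right_inv' := by
    intro z hz
    have hx := chartMoment_mem hp hz
    rw [chartFun_pt hp hx (active_chartMoment hp hz)]
    ext i
    rw [coord, L_chartMoment, chartAngle, Matrix.vecMul_vecMul, vertexMat_mul_inv,
      Matrix.vecMul_one]
    have : 2 * (1 / 2 * ‖z i‖ ^ 2) = ‖z i‖ ^ 2 := by ring
    rw [this, Real.sqrt_sq (norm_nonneg _)]
    exact Complex.norm_mul_exp_arg_mul_I _

/-! ### The smooth structure -/

lemma contDiff_chartMoment {p : Fin n → ℝ} (hp : P.IsVertex p) :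
    ContDiff ℝ ∞ (chartMoment hp) := by
  have h : ContDiff ℝ ∞ (fun z : Fin n → ℂ => fun i => 1 / 2 * ‖z i‖ ^ 2) :=
    contDiff_pi.2 fun i => contDiff_const.mul ((contDiff_apply ℝ ℂ i).norm_sq ℝ)
  have h2 : ContDiff ℝ ∞ (fun y : Fin n → ℝ => (vertexMat hp)⁻¹ *ᵥ y) :=
    (LinearMap.toContinuousLinearMap (Matrix.mulVecLin (vertexMat hp)⁻¹)).contDiff
  exact contDiff_const.add (h2.comp h)

lemma contDiff_L (k : Fin d) : ContDiff ℝ ∞ (P.L k) := by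
  unfold L dotProduct; fun_prop

/-- The part of `U_p` that the chart at `p` maps to the domain of the chart at `q`. -/
def overlap {p : Fin n → ℝ} (hp : P.IsVertex p) (q : Fin n → ℝ) : Set (Fin n → ℂ) :=
  {z | ∀ k, (k ∉ P.active p ∨ k ∉ P.active q) → 0 < P.L k (chartMoment hp z)}

lemma isOpen_overlap {p : Fin n → ℝ} (hp : P.IsVertex p) (q : Fin n → ℝ) :
    IsOpen (overlap hp q) := by
  have : overlap hp q = ⋂ k, {z | (k ∉ P.active p ∨ k ∉ P.active q) →
      0 < P.L k (chartMoment hp z)} := by ext z; simp [overlap]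
  rw [this]
  refine isOpen_iInter_of_finite fun k => ?_
  by_cases h : k ∉ P.active p ∨ k ∉ P.active q
  · simp only [h, forall_const]
    exact isOpen_lt continuous_const
      ((continuous_L k).comp (contDiff_chartMoment hp).continuous)
  · simp [h]

lemma trans_source {p q : Fin n → ℝ} (hp : P.IsVertex p) (hq : P.IsVertex q) :
    ((chart hP hp).symm.trans (chart hP hq)).source = overlap hp q := by
  ext z
  rw [PartialEquiv.trans_source]
  change (z ∈ chartTarget hp ∧ P.active (moment (pt hP _)) ⊆ P.active q) ↔ _
  constructor
  · rintro ⟨h1, h2⟩ k hk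
    have hx := chartMoment_mem hp h1
    rw [moment_pt hx] at h2
    refine lt_of_le_of_ne (hx k) fun e => ?_
    rcases hk with hk | hk
    · exact (h1 k hk).ne e
    · exact hk (h2 (mem_active.2 e.symm))
  · intro h
    have h1 : z ∈ chartTarget hp := fun k hk => h k (Or.inl hk)
    refine ⟨h1, ?_⟩
    rw [moment_pt (chartMoment_mem hp h1)]
    intro k hk
    by_contra hkq
    exact (h k (Or.inr hkq)).ne' (mem_active.1 hk)

lemma trans_eqOn {p q : Fin n → ℝ} (hp : P.IsVertex p) (hq : P.IsVertex q) :
    Set.EqOn ((chart hP hp).symm.trans (chart hP hq))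
      (fun z => coord hq (chartMoment hp z) (chartAngle hp z)) (overlap hp q) := by
  intro z hz
  rw [← trans_source (hP := hP) hp hq, PartialEquiv.trans_source] at hz
  have h1 : z ∈ chartTarget hp := hz.1
  have hx := chartMoment_mem hp h1
  have h2 : P.active (moment (pt hP (chartMoment hp z, chartAngle hp z))) ⊆ P.active q := hz.2
  rw [moment_pt hx] at h2
  exact chartFun_pt hq hx h2

lemma contDiffAt_unit (N : ℤ) (i : Fin n) {z : Fin n → ℂ} (hz : z i ≠ 0) :
    ContDiffAt ℝ ∞ (fun z : Fin n → ℂ => (z i * ((‖z i‖ : ℝ) : ℂ)⁻¹) ^ N) z := by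
  have h0 : ContDiffAt ℝ ∞ (fun z : Fin n → ℂ => z i) z := contDiffAt_pi.1 contDiffAt_id i
  have hn : ContDiffAt ℝ ∞ (fun z : Fin n → ℂ => ((‖z i‖ : ℝ) : ℂ)) z :=
    Complex.ofRealCLM.contDiff.contDiffAt.comp z (h0.norm ℝ hz)
  have hne : ((‖z i‖ : ℝ) : ℂ) ≠ 0 := by exact_mod_cast norm_ne_zero_iff.2 hz
  have h1 := h0.mul (hn.inv hne)
  cases N with
  | ofNat N => simpa using h1.pow N
  | negSucc N =>
    simp only [zpow_negSucc]
    exact (h1.pow (N + 1)).inv (pow_ne_zero _ (mul_ne_zero hz (inv_ne_zero hne)))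

lemma contDiffOn_trans {p q : Fin n → ℝ} (hP : P.IsDelzant Λ) (hp : P.IsVertex p)
    (hq : P.IsVertex q) :
    ContDiffOn ℝ ∞ (fun z => coord hq (chartMoment hp z) (chartAngle hp z)) (overlap hp q) := by
  classical
  rw [contDiffOn_pi]
  intro j
  choose N hN using fun i => int_of_mem hP hq (hP.rational (vertexIdx hp i)) j
  let S : Finset (Fin n) := Finset.univ.filter fun i => vertexIdx hp i ∉ P.active q
  let U : (Fin n → ℂ) → ℂ := fun z => ∏ i ∈ S, (z i * ((‖z i‖ : ℝ) : ℂ)⁻¹) ^ N i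
  have hne : ∀ z ∈ overlap hp q, ∀ i ∈ S, z i ≠ 0 := by
    intro z hz i hi h0
    have h1 := hz (vertexIdx hp i) (Or.inr (Finset.mem_filter.1 hi).2)
    rw [L_chartMoment, h0] at h1
    simp at h1
  have hU : ContDiffOn ℝ ∞ U (overlap hp q) := by
    intro z hz
    refine ContDiffWithinAt.congr_of_mem (f := U) ?_ (fun _ _ => rfl) hz
    exact (contDiffAt_prod fun i hi => contDiffAt_unit (N i) i (hne z hz i hi)).contDiffWithinAt
  -- the phase factor
  have hang : ∀ z : Fin n → ℂ, (chartAngle hp z ᵥ* (vertexMat hq)⁻¹) j =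
      ∑ i, Complex.arg (z i) * N i := by
    intro z
    rw [chartAngle, Matrix.vecMul_vecMul]
    simp only [Matrix.vecMul, dotProduct]
    refine Finset.sum_congr rfl fun i _ => ?_
    rw [← hN i]; rfl
  have hexp : ∀ z ∈ overlap hp q,
      Complex.exp (((chartAngle hp z ᵥ* (vertexMat hq)⁻¹) j : ℝ) * Complex.I) =
      U z * ∏ i ∈ Finset.univ.filter (fun i => ¬ vertexIdx hp i ∉ P.active q),
        Complex.exp ((Complex.arg (z i) : ℝ) * Complex.I) ^ N i := by
    intro z hz
    have h1 : Complex.exp (((chartAngle hp z ᵥ* (vertexMat hq)⁻¹) j : ℝ) * Complex.I) =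
        ∏ i, Complex.exp ((Complex.arg (z i) : ℝ) * Complex.I) ^ N i := by
      rw [hang]
      push_cast
      rw [Finset.sum_mul, Complex.exp_sum]
      refine Finset.prod_congr rfl fun i _ => ?_
      rw [← Complex.exp_int_mul]
      congr 1; ring
    rw [h1, ← Finset.prod_filter_mul_prod_filter_not Finset.univ
      (fun i => vertexIdx hp i ∉ P.active q)]
    congr 1
    refine Finset.prod_congr rfl fun i hi => ?_
    congr 1
    have hz0 : ((‖z i‖ : ℝ) : ℂ) ≠ 0 := by exact_mod_cast norm_ne_zero_iff.2 (hne z hz i hi)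
    rw [eq_mul_inv_iff_mul_eq₀ hz0, mul_comm]
    exact Complex.norm_mul_exp_arg_mul_I _
  have hdelta : ∀ i i', vertexIdx hq i' = vertexIdx hp i → N i = if j = i' then 1 else 0 := by
    intro i i' h
    have := hN i
    rw [← h, normal_vecMul_inv, Pi.single_apply] at this
    split_ifs at this ⊢ <;> exact_mod_cast this.symm
  by_cases hj : vertexIdx hq j ∈ P.active p
  · obtain ⟨i0, hi0⟩ := (mem_active_vertex hp).1 hj
    refine ContDiffOn.congr (f := fun z => U z * z i0)
      (hU.mul (contDiff_apply ℝ ℂ i0).contDiffOn) fun z hz => ?_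
    have hprod : ∏ i ∈ Finset.univ.filter (fun i => ¬ vertexIdx hp i ∉ P.active q),
        Complex.exp ((Complex.arg (z i) : ℝ) * Complex.I) ^ N i =
        Complex.exp ((Complex.arg (z i0) : ℝ) * Complex.I) := by
      rw [Finset.prod_eq_single i0]
      · rw [hdelta i0 j hi0.symm]; simp
      · intro i hi hii
        have hiq : vertexIdx hp i ∈ P.active q := by simpa using hi
        obtain ⟨i', hi'⟩ := (mem_active_vertex hq).1 hiq
        rw [hdelta i i' hi', if_neg, zpow_zero]
        rintro rfl
        exact hii ((vertexIdx hp).injective (hi'.symm.trans hi0.symm))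
      · intro h
        refine absurd ?_ h
        have : vertexIdx hp i0 ∈ P.active q := by
          rw [hi0]; exact (mem_active_vertex hq).2 ⟨j, rfl⟩
        simpa using this
    rw [coord, hexp z hz, hprod, ← hi0, L_chartMoment]
    have : 2 * (1 / 2 * ‖z i0‖ ^ 2) = ‖z i0‖ ^ 2 := by ring
    rw [this, Real.sqrt_sq (norm_nonneg _)]
    have := Complex.norm_mul_exp_arg_mul_I (z i0)
    linear_combination U z * this
  · have hs : ContDiffOn ℝ ∞
        (fun z => ((Real.sqrt (2 * P.L (vertexIdx hq j) (chartMoment hp z)) : ℝ) : ℂ))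
        (overlap hp q) := by
      intro z hz
      have hpos := hz _ (Or.inl hj)
      have h1 : ContDiffAt ℝ ∞ (fun z => 2 * P.L (vertexIdx hq j) (chartMoment hp z)) z :=
        (contDiff_const.mul ((contDiff_L _).comp (contDiff_chartMoment hp))).contDiffAt
      have h2 := h1.sqrt (by positivity)
      exact (Complex.ofRealCLM.contDiff.contDiffAt.comp z h2).contDiffWithinAt
    refine ContDiffOn.congr (hs.mul hU) fun z hz => ?_
    have hprod : ∏ i ∈ Finset.univ.filter (fun i => ¬ vertexIdx hp i ∉ P.active q),
        Complex.exp ((Complex.arg (z i) : ℝ) * Complex.I) ^ N i = 1 := by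
      refine Finset.prod_eq_one fun i hi => ?_
      have hiq : vertexIdx hp i ∈ P.active q := by simpa using hi
      obtain ⟨i', hi'⟩ := (mem_active_vertex hq).1 hiq
      rw [hdelta i i' hi', if_neg, zpow_zero]
      rintro rfl
      exact hj (by rw [hi']; exact (mem_active_vertex hp).2 ⟨i, rfl⟩)
    rw [coord, hexp z hz, hprod, mul_one]

variable (hP) in
/-- A vertex on the smallest face that contains `moment m`. -/
def vertexAt (m : ToricManifold P Λ hP) : Fin n → ℝ := (exists_vertex (moment_mem m)).choose

lemma isVertex_vertexAt (m : ToricManifold P Λ hP) : P.IsVertex (vertexAt hP m) :=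
  (exists_vertex (moment_mem m)).choose_spec.1

variable (P Λ hP) in
/-- The atlas of `M`: the charts at the vertices. -/
def core : ChartedSpaceCore (Fin n → ℂ) (ToricManifold P Λ hP) where
  atlas := {e | ∃ (p : Fin n → ℝ) (hp : P.IsVertex p), e = chart hP hp}
  chartAt m := chart hP (isVertex_vertexAt m)
  mem_chart_source m := (exists_vertex (moment_mem m)).choose_spec.2
  chart_mem_atlas m := ⟨_, isVertex_vertexAt m, rfl⟩
  open_source := by
    rintro _ _ ⟨p, hp, rfl⟩ ⟨q, hq, rfl⟩
    rw [trans_source]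
    exact isOpen_overlap hp q
  continuousOn_toFun := by
    rintro _ _ ⟨p, hp, rfl⟩ ⟨q, hq, rfl⟩
    rw [trans_source]
    exact (contDiffOn_trans hP hp hq).continuousOn.congr (trans_eqOn hp hq)

instance : TopologicalSpace (ToricManifold P Λ hP) := (core P Λ hP).toTopologicalSpace

instance : ChartedSpace (Fin n → ℂ) (ToricManifold P Λ hP) := (core P Λ hP).toChartedSpace

instance : IsManifold 𝓘(ℝ, Fin n → ℂ) ∞ (ToricManifold P Λ hP) := by
  refine isManifold_of_contDiffOn _ _ _ ?_
  rintro e e' he he'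
  have key : ∀ f : OpenPartialHomeomorph (ToricManifold P Λ hP) (Fin n → ℂ),
      f ∈ atlas (Fin n → ℂ) (ToricManifold P Λ hP) →
      ∃ (p : Fin n → ℝ) (hp : P.IsVertex p), f.toPartialEquiv = chart hP hp := by
    intro f hf
    change f ∈ ⋃ (e : PartialEquiv _ _) (he : e ∈ (core P Λ hP).atlas),
      {(core P Λ hP).openPartialHomeomorph e he} at hf
    simp only [Set.mem_iUnion, Set.mem_singleton_iff] at hf
    obtain ⟨e, ⟨p, hp, rfl⟩, rfl⟩ := hf
    exact ⟨p, hp, rfl⟩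
  obtain ⟨p, hp, h1⟩ := key e he
  obtain ⟨q, hq, h2⟩ := key e' he'
  have hs : (e.symm.trans e').source = overlap hp q := by
    rw [← trans_source (hP := hP) hp hq, ← h1, ← h2]; rfl
  have hf : ∀ z, (e.symm.trans e') z = ((chart hP hp).symm.trans (chart hP hq)) z := by
    intro z; rw [← h1, ← h2]; rfl
  simp only [modelWithCornersSelf_coe, modelWithCornersSelf_coe_symm, Set.range_id, Set.inter_univ,
    Set.preimage_id, Function.id_comp, Function.comp_id, hs]
  refine (contDiffOn_trans hP hp hq).congr fun z hz => ?_
  exact (hf z).trans (trans_eqOn hp hq hz)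

/-! ### `M` is a compact Hausdorff space -/

/-- The chart at the vertex `p`, as a homeomorphism. -/
def chartHomeo (hP : P.IsDelzant Λ) {p : Fin n → ℝ} (hp : P.IsVertex p) :
    OpenPartialHomeomorph (ToricManifold P Λ hP) (Fin n → ℂ) :=
  (core P Λ hP).openPartialHomeomorph (chart hP hp) ⟨p, hp, rfl⟩

lemma continuous_moment : Continuous (moment : ToricManifold P Λ hP → Fin n → ℝ) := by
  rw [continuous_iff_continuousAt]
  intro m
  obtain ⟨p, hp, hm⟩ := exists_vertex (moment_mem m)
  let e := chartHomeo hP hp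
  have hme : m ∈ e.source := hm
  have h1 : ContinuousAt (fun m' => chartMoment hp (e m')) m :=
    (contDiff_chartMoment hp).continuous.continuousAt.comp (e.continuousAt hme)
  refine h1.congr ?_
  filter_upwards [e.open_source.mem_nhds hme] with m' hm'
  obtain ⟨θ, h⟩ := exists_pt m'
  have hx := moment_mem m'
  have h2 : e m' = coord hp (moment m') θ := by
    conv_lhs => rw [h]
    exact chartFun_pt hp hx hm'
  change chartMoment hp (e m') = moment m'
  rw [h2, chartMoment_coord hp hx]

instance : T2Space (ToricManifold P Λ hP) := by
  refine ⟨fun m m' hne => ?_⟩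
  by_cases hx : moment m = moment m'
  · obtain ⟨p, hp, hm⟩ := exists_vertex (moment_mem m)
    let e := chartHomeo hP hp
    have hme : m ∈ e.source := hm
    have hme' : m' ∈ e.source := by
      change P.active (moment m') ⊆ P.active p
      rw [← hx]; exact hm
    obtain ⟨u, v, hu, hv, hmu, hmv, huv⟩ := t2_separation (e.injOn.ne hme hme' hne)
    refine ⟨e.source ∩ e ⁻¹' u, e.source ∩ e ⁻¹' v, e.isOpen_inter_preimage hu,
      e.isOpen_inter_preimage hv, ⟨hme, hmu⟩, ⟨hme', hmv⟩, ?_⟩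
    exact (huv.preimage e).mono Set.inter_subset_right Set.inter_subset_right
  · obtain ⟨u, v, hu, hv, hmu, hmv, huv⟩ := t2_separation hx
    exact ⟨moment ⁻¹' u, moment ⁻¹' v, hu.preimage continuous_moment,
      hv.preimage continuous_moment, hmu, hmv, huv.preimage _⟩

lemma continuous_coord {p : Fin n → ℝ} (hp : P.IsVertex p) :
    Continuous fun a : P.closedSet × (Fin n → ℝ) => coord hp a.1 a.2 := by
  refine continuous_pi fun i => ?_
  have h1 : Continuous fun a : P.closedSet × (Fin n → ℝ) => P.L (vertexIdx hp i) a.1 :=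
    (continuous_L _).comp (continuous_subtype_val.comp continuous_fst)
  have h2 : Continuous fun a : P.closedSet × (Fin n → ℝ) => (a.2 ᵥ* (vertexMat hp)⁻¹) i := by
    simp only [Matrix.vecMul, dotProduct]; fun_prop
  unfold coord
  fun_prop

lemma continuous_mk : Continuous (mk hP) := by
  refine continuous_generateFrom_iff.2 fun s hs => ?_
  simp only [Set.mem_iUnion, Set.mem_singleton_iff] at hs
  obtain ⟨e, ⟨p, hp, rfl⟩, s, hs, rfl⟩ := hs
  have h : mk hP ⁻¹' ((chart hP hp) ⁻¹' s ∩ (chart hP hp).source) =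
      (fun a : P.closedSet × (Fin n → ℝ) => coord hp a.1 a.2) ⁻¹' s ∩
        ⋂ k, {a | k ∉ P.active p → 0 < P.L k a.1} := by
    ext a
    have hsrc : mk hP a ∈ (chart hP hp).source ↔ ∀ k, k ∉ P.active p → 0 < P.L k a.1 := by
      change P.active a.1 ⊆ P.active p ↔ _
      constructor
      · intro h k hk
        exact lt_of_le_of_ne (a.1.2 k) fun e => hk (h (mem_active.2 e.symm))
      · intro h k hk
        by_contra hkp
        exact (h k hkp).ne' (mem_active.1 hk)
    simp only [Set.mem_preimage, Set.mem_inter_iff, Set.mem_iInter, Set.mem_ofPred_eq, hsrc]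
    refine and_congr_left fun h => ?_
    have : (chart hP hp) (mk hP a) = coord hp a.1 a.2 := if_pos (hsrc.2 h)
    rw [this]
  rw [h]
  refine (hs.preimage (continuous_coord hp)).inter (isOpen_iInter_of_finite fun k => ?_)
  by_cases hk : k ∈ P.active p
  · simp [hk]
  · simp only [hk, not_false_eq_true, forall_const]
    exact isOpen_lt continuous_const
      ((continuous_L k).comp (continuous_subtype_val.comp continuous_fst))

instance : CompactSpace (ToricManifold P Λ hP) := by
  obtain ⟨p, hp, -⟩ := exists_vertex P.basePoint.2
  let K : Set (Fin n → ℝ) := (fun φ => φ ᵥ* vertexMat hp) '' Set.Icc 0 (fun _ => 2 * Real.pi)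
  have hK : IsCompact K := by
    refine isCompact_Icc.image ?_
    refine continuous_pi fun i => ?_
    simp only [Matrix.vecMul, dotProduct]; fun_prop
  have : CompactSpace P.closedSet := isCompact_iff_compactSpace.1 isCompact_closedSet
  have hc : IsCompact (mk hP '' (Set.univ ×ˢ K)) := (isCompact_univ.prod hK).image continuous_mk
  refine ⟨?_⟩
  convert hc
  refine (Set.eq_univ_of_forall fun m => ?_).symm
  obtain ⟨θ, h⟩ := exists_pt m
  have hx := moment_mem m
  let φ := θ ᵥ* (vertexMat hp)⁻¹
  let N : Fin n → ℤ := fun i => ⌊φ i / (2 * Real.pi)⌋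
  let ψ : Fin n → ℝ := fun i => φ i - 2 * Real.pi * N i
  have hpi : 0 < 2 * Real.pi := by positivity
  refine ⟨(⟨moment m, hx⟩, ψ ᵥ* vertexMat hp), ⟨Set.mem_univ _, ψ, ⟨?_, ?_⟩, rfl⟩, ?_⟩
  · intro i
    have := Int.floor_le (φ i / (2 * Real.pi))
    rw [le_div_iff₀ hpi] at this
    simp only [Pi.zero_apply, ψ, N]; linarith
  · intro i
    have := (Int.lt_floor_add_one (φ i / (2 * Real.pi))).le
    rw [div_le_iff₀ hpi] at this
    simp only [ψ, N]; linarith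
  · rw [← pt_of_mem hx]
    conv_rhs => rw [h]
    rw [pt_eq_pt hx]
    have h1 : θ = φ ᵥ* vertexMat hp := by
      rw [Matrix.vecMul_vecMul, vertexMat_inv_mul, Matrix.vecMul_one]
    have h2 : ψ ᵥ* vertexMat hp - θ =
        (2 * Real.pi) • ∑ i, (-N i) • P.normal (vertexIdx hp i) := by
      rw [h1, ← Matrix.sub_vecMul, Matrix.vecMul_eq_sum, Finset.smul_sum]
      refine Finset.sum_congr rfl fun i _ => ?_
      rw [← Int.cast_smul_eq_zsmul ℝ, smul_smul]
      simp only [ψ, Pi.sub_apply]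
      push_cast
      congr 1; ring
    rw [h2]
    exact P.two_pi_smul_mem_isotropy Λ
      (Submodule.sum_mem _ fun i _ => Λ.smul_mem _ (hP.rational _))

end ToricManifold

end LabelledPolytope

/-! ### Tensor fields, Kähler metrics and cone angles

In this section `M` is a manifold of real dimension `2n`, with charts in `ℂⁿ = ℝ²ⁿ`. -/

section Tensor

variable {n : ℕ} {M : Type*} [TopologicalSpace M] [ChartedSpace (Fin n → ℂ) M]

variable (n M) in
/-- Covariant tensor fields of degree two. -/
abbrev Tensor2 : Type _ :=
  ∀ m : M, TangentSpace 𝓘(ℝ, Fin n → ℂ) m →L[ℝ] TangentSpace 𝓘(ℝ, Fin n → ℂ) m →L[ℝ] ℝ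

/-- The tensor field is smooth on `S`. -/
def SmoothOn [IsManifold 𝓘(ℝ, Fin n → ℂ) ∞ M] (g : Tensor2 n M) (S : Set M) : Prop :=
  ContMDiffOn 𝓘(ℝ, Fin n → ℂ)
    (𝓘(ℝ, Fin n → ℂ).prod 𝓘(ℝ, (Fin n → ℂ) →L[ℝ] (Fin n → ℂ) →L[ℝ] ℝ)) ∞
    (fun m => Bundle.TotalSpace.mk' ((Fin n → ℂ) →L[ℝ] (Fin n → ℂ) →L[ℝ] ℝ) m (g m)) S

/-- The tensor field is a smooth Riemannian metric on `S`. -/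
structure IsMetricOn [IsManifold 𝓘(ℝ, Fin n → ℂ) ∞ M] (g : Tensor2 n M) (S : Set M) : Prop where
  smooth : SmoothOn g S
  symm : ∀ m ∈ S, ∀ v w, g m v w = g m w v
  pos : ∀ m ∈ S, ∀ v, v ≠ 0 → 0 < g m v v

variable (n) in
/-- The differential of a function with values in a vector space. -/
def diff {W : Type*} [NormedAddCommGroup W] [NormedSpace ℝ W] (f : M → W) (m : M) :
    TangentSpace 𝓘(ℝ, Fin n → ℂ) m →L[ℝ] W :=
  mfderiv 𝓘(ℝ, Fin n → ℂ) 𝓘(ℝ, W) f m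

/-- The expression of a tensor field in the preferred chart at `m₀`. -/
def inChart (σ : Tensor2 n M) (m₀ : M) (y v w : Fin n → ℂ) : ℝ :=
  σ ((extChartAt 𝓘(ℝ, Fin n → ℂ) m₀).symm y)
    (mfderiv 𝓘(ℝ, Fin n → ℂ) 𝓘(ℝ, Fin n → ℂ) (extChartAt 𝓘(ℝ, Fin n → ℂ) m₀).symm y v)
    (mfderiv 𝓘(ℝ, Fin n → ℂ) 𝓘(ℝ, Fin n → ℂ) (extChartAt 𝓘(ℝ, Fin n → ℂ) m₀).symm y w)

/-- The exterior derivative of the two-form `σ` vanishes on `S`: in the chart at each `m ∈ S`, the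
cyclic sum of the directional derivatives of the coefficients is zero at `m`. -/
def IsClosedFormOn (σ : Tensor2 n M) (S : Set M) : Prop :=
  ∀ m ∈ S, ∀ a b c : Fin n → ℂ,
    fderiv ℝ (fun y => inChart σ m y b c) (extChartAt 𝓘(ℝ, Fin n → ℂ) m m) a +
    fderiv ℝ (fun y => inChart σ m y c a) (extChartAt 𝓘(ℝ, Fin n → ℂ) m m) b +
    fderiv ℝ (fun y => inChart σ m y a b) (extChartAt 𝓘(ℝ, Fin n → ℂ) m m) c = 0

/-- `g` is a Kähler metric on `S` compatible with the symplectic form `σ`: the endomorphism `J` with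
`σ = g(J ·, ·)` is an almost complex structure, it is integrable (there are local holomorphic
coordinates), and `σ` is a smooth closed two-form. -/
structure IsKahlerOn [IsManifold 𝓘(ℝ, Fin n → ℂ) ∞ M] (g σ : Tensor2 n M) (S : Set M) :
    Prop where
  metric : IsMetricOn g S
  smooth_form : SmoothOn σ S
  alternating : ∀ m ∈ S, ∀ v, σ m v v = 0
  closed : IsClosedFormOn σ S
  complex : ∃ J : ∀ m : M, TangentSpace 𝓘(ℝ, Fin n → ℂ) m →L[ℝ] TangentSpace 𝓘(ℝ, Fin n → ℂ) m,
    (∀ m ∈ S, ∀ v, J m (J m v) = -v) ∧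
    (∀ m ∈ S, ∀ v w, σ m v w = g m (J m v) w) ∧
    ∀ m₀ ∈ S, ∃ (U : Set M) (F : M → Fin n → ℂ), IsOpen U ∧ m₀ ∈ U ∧ U ⊆ S ∧
      ContMDiffOn 𝓘(ℝ, Fin n → ℂ) 𝓘(ℝ, Fin n → ℂ) ∞ F U ∧
      ∀ m ∈ U, Function.Bijective (diff n F m) ∧
        ∀ v, diff n F m (J m v) = Complex.I • diff n F m v

/-- The flat metric `dr² + a² r² dφ²` of a cone of total angle `2πa`, in polar coordinates
`z = r exp(√-1 φ)` on `ℂ ∖ {0}`, at the point `z` on the tangent vectors `ζ`, `ζ'`: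
`dr + √-1 r dφ = (z̄ / |z|) dz`. -/
def flatCone (a : ℝ) (z ζ ζ' : ℂ) : ℝ :=
  ((starRingEnd ℂ z * ζ).re * (starRingEnd ℂ z * ζ').re +
    a ^ 2 * ((starRingEnd ℂ z * ζ).im * (starRingEnd ℂ z * ζ').im)) / ‖z‖ ^ 2

/-- The metric `g`, given on `S`, has total angle `β` around the submanifold `D` of codimension two:
near each point of `D` there is a smooth submersion `w = r exp(√-1 φ)` to `ℂ` with `D = {w = 0}`,
and up to a factor `c > 0` the metric `g` off `D` is `dr² + (β/2π)² r² dφ²` plus a symmetric tensor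
`B` that is smooth across `D`; along `D`, the tensor `B` reduces to a Riemannian metric on `D`, in
the sense that it is positive definite on the tangent spaces of `D` and that its radical is
complementary to them. -/
def HasAngleAlong [IsManifold 𝓘(ℝ, Fin n → ℂ) ∞ M] (g : Tensor2 n M) (S D : Set M) (β : ℝ) : Prop :=
  ∀ q ∈ D, ∃ (U : Set M) (w : M → ℂ) (c : ℝ) (B : Tensor2 n M),
    IsOpen U ∧ q ∈ U ∧ U ⊆ S ∪ D ∧ 0 < c ∧
    ContMDiffOn 𝓘(ℝ, Fin n → ℂ) 𝓘(ℝ, ℂ) ∞ w U ∧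
    (∀ m ∈ U, Function.Surjective (diff n w m)) ∧
    (∀ m ∈ U, w m = 0 ↔ m ∈ D) ∧
    SmoothOn B U ∧
    (∀ m ∈ U, ∀ v v', B m v v' = B m v' v) ∧
    (∀ m ∈ U, m ∉ D → ∀ v v',
      g m v v' = c * flatCone (β / (2 * Real.pi)) (w m) (diff n w m v) (diff n w m v') + B m v v') ∧
    (∀ m ∈ U, m ∈ D →
      (∀ v, diff n w m v = 0 → v ≠ 0 → 0 < B m v v) ∧
      (∀ v, ∃ v', diff n w m v' = 0 ∧ ∀ v'', B m (v - v') v'' = 0))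

/-- `g` has a singularity of conical type and angle `β < 2π` along `D`. -/
def IsConicalAlong [IsManifold 𝓘(ℝ, Fin n → ℂ) ∞ M] (g : Tensor2 n M) (S D : Set M) (β : ℝ) :
    Prop :=
  0 < β ∧ β < 2 * Real.pi ∧ HasAngleAlong g S D β

/-- `g` has a singularity characterized by a large angle `β > 2π` along `D`. -/
def IsLargeAngleAlong [IsManifold 𝓘(ℝ, Fin n → ℂ) ∞ M] (g : Tensor2 n M) (S D : Set M) (β : ℝ) :
    Prop :=
  2 * Real.pi < β ∧ HasAngleAlong g S D β

/-- The metric `g`, given on `S`, extends to a smooth metric on `S ∪ D`. -/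
def IsSmoothAlong [IsManifold 𝓘(ℝ, Fin n → ℂ) ∞ M] (g : Tensor2 n M) (S D : Set M) : Prop :=
  ∃ g' : Tensor2 n M, IsMetricOn g' (S ∪ D) ∧ ∀ m ∈ S, g' m = g m

end Tensor

/-! ### The symplectic form and the metrics of symplectic potentials -/

section Metrics

open LabelledPolytope LabelledPolytope.ToricManifold

variable {n d : ℕ} {P : LabelledPolytope n d} {Λ : Submodule ℤ (Fin n → ℝ)} (hP : P.IsDelzant Λ)

/-- The symplectic form of `M`: the standard form `∑ d(Re z_j) ∧ d(Im z_j)` in the charts at the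
vertices (the tangent space at `m` is identified with `ℂⁿ` by the preferred chart at `m`). -/
def symplecticForm : Tensor2 n (ToricManifold P Λ hP) := fun m =>
  let re : Fin n → (TangentSpace 𝓘(ℝ, Fin n → ℂ) m →L[ℝ] ℝ) := fun j =>
    Complex.reCLM.comp (ContinuousLinearMap.proj (R := ℝ) (φ := fun _ : Fin n => ℂ) j)
  let im : Fin n → (TangentSpace 𝓘(ℝ, Fin n → ℂ) m →L[ℝ] ℝ) := fun j =>
    Complex.imCLM.comp (ContinuousLinearMap.proj (R := ℝ) (φ := fun _ : Fin n => ℂ) j)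
  ∑ j, ((re j).smulRight (im j) - (im j).smulRight (re j))

/-- The set of points with trivial stabilizer in `T`. -/
def freeLocus : Set (ToricManifold P Λ hP) := {m | ∀ t : Torus Λ, t +ᵥ m = m → t = 0}

/-- The preimage under the moment map of the interior of the facet `F_k`. -/
def divisor (k : Fin d) : Set (ToricManifold P Λ hP) := {m | moment m ∈ P.facetInterior k}

/-- The differential of the action-angle parametrization `P × 𝔱 → M` at `(x, θ)`. -/
def dpt (x θ : Fin n → ℝ) :
    (Fin n → ℝ) × (Fin n → ℝ) →L[ℝ] TangentSpace 𝓘(ℝ, Fin n → ℂ) (pt hP (x, θ)) :=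
  mfderiv 𝓘(ℝ, (Fin n → ℝ) × (Fin n → ℝ)) 𝓘(ℝ, Fin n → ℂ) (pt hP) (x, θ)

/-- The coframe `(dx, dθ)` of the action-angle coordinates at `m`: the inverse of the differential of
the action-angle parametrization. -/
def coframe (m : ToricManifold P Λ hP) :
    TangentSpace 𝓘(ℝ, Fin n → ℂ) m →L[ℝ] (Fin n → ℝ) × (Fin n → ℝ) :=
  ContinuousLinearMap.inverse (M := (Fin n → ℝ) × (Fin n → ℝ))
    (M₂ := TangentSpace 𝓘(ℝ, Fin n → ℂ) m) (dpt hP (moment m) (exists_pt m).choose)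

/-- The one-form `dx_i`. -/
def dx (m : ToricManifold P Λ hP) (i : Fin n) : TangentSpace 𝓘(ℝ, Fin n → ℂ) m →L[ℝ] ℝ :=
  (ContinuousLinearMap.proj (R := ℝ) (φ := fun _ : Fin n => ℝ) i).comp
    ((ContinuousLinearMap.fst ℝ (Fin n → ℝ) (Fin n → ℝ)).comp (coframe hP m))

/-- The one-form `dθ_i`. -/
def dtheta (m : ToricManifold P Λ hP) (i : Fin n) : TangentSpace 𝓘(ℝ, Fin n → ℂ) m →L[ℝ] ℝ :=
  (ContinuousLinearMap.proj (R := ℝ) (φ := fun _ : Fin n => ℝ) i).comp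
    ((ContinuousLinearMap.snd ℝ (Fin n → ℝ) (Fin n → ℝ)).comp (coframe hP m))

/-- The Hessian matrix of `u` at `x`. -/
def hess (u : (Fin n → ℝ) → ℝ) (x : Fin n → ℝ) : Matrix (Fin n) (Fin n) ℝ :=
  Matrix.of fun i j =>
    fderiv ℝ (fun y => fderiv ℝ u y (Pi.single j 1)) x (Pi.single i 1)

/-- The metric `g_u = ∑ G_ij dx_i ⊗ dx_j + H_ij dθ_i ⊗ dθ_j` on the part of `M` over the open
polytope, where `G = Hess u` and `H = G⁻¹`. -/
def metric (u : (Fin n → ℝ) → ℝ) : Tensor2 n (ToricManifold P Λ hP) := fun m =>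
  ∑ i, ∑ j, (hess u (moment m) i j • (dx hP m i).smulRight (dx hP m j) +
    (hess u (moment m))⁻¹ i j • (dtheta hP m i).smulRight (dtheta hP m j))

/-- `g` is invariant under the action of `T` at the points of `S`. -/
def IsInvariantOn (g : Tensor2 n (ToricManifold P Λ hP)) (S : Set (ToricManifold P Λ hP)) : Prop :=
  ∀ t : Torus Λ, ∀ m ∈ S, ∀ v w,
    g (t +ᵥ m)
      (mfderiv 𝓘(ℝ, Fin n → ℂ) 𝓘(ℝ, Fin n → ℂ) (fun m' : ToricManifold P Λ hP => t +ᵥ m') m v)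
      (mfderiv 𝓘(ℝ, Fin n → ℂ) 𝓘(ℝ, Fin n → ℂ) (fun m' : ToricManifold P Λ hP => t +ᵥ m') m w) =
    g m v w

end Metrics

end Toric

end

noncomputable section

namespace Toric

/-! ### Smooth tensor fields of degree two -/

section TensorCalculus

open Bundle Topology

variable {n : ℕ} {M : Type*} [TopologicalSpace M] [ChartedSpace (Fin n → ℂ) M]

/-! All computations take place in the complex coordinates z_j at a vertex (`chartFun`). Since
|z_j|² = 2 L_j, one has conj(z_j) dz_j = dL_j + √-1 · 2 L_j dθ_j, where L_j and θ_j are taken with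
respect to the normals at the vertex. Hence dx is a linear image of the real parts, and dθ of the
imaginary parts divided by |z_j|² (`coframe_eq`). Three facts follow at once. The form ∑ dx_i ∧ dθ_i
has constant coefficients in every vertex chart, so it is smooth and closed. The torus acts by
phases, which preserve conj(z_j) dz_j, so the metric is invariant. In matrix form, g_u is the
Hessian of u in the coordinates L_j applied to the real parts, plus its inverse applied to the
rescaled imaginary parts (`metric_eq_polar`).

Over the open polytope G = Hess u is positive definite, so J(dx, dθ) = (-G⁻¹ dθ, G dx) is an almost
complex structure with σ = g(J·,·). It is integrable because G dx is the differential of grad u: the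
functions exp(∂u/∂L_j + √-1 θ_j) are holomorphic coordinates (`diff_holomorphicCoord`,
`isKahlerOn_metric`).

Near the interior of F_k write u = ½ L^ν_k log L^ν_k + f with f smooth (`exists_regular_part`). If a
ν_k = η_k, then L^ν_k = a⁻¹ L_k, and in the coordinates of a vertex of F_k the Hessian is t⁻¹ e_i
e_iᵀ + K with t = 2 a L_k = a |z_i|² and K smooth. Its inverse is t e_i e_iᵀ + D R D, where D
multiplies the i-th coordinate by t and R is smooth up to t = 0 (`inv_eq_regularInverse`). The
matrix R exists at t = 0 because K is positive definite on ξ_i = 0, which is strict convexity of u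
on the facet. The two singular entries t⁻¹ and t add up to a⁻¹ (dr² + a² r² dφ²) for z_i = r exp(√-1
φ). All the rest is smooth, because D turns the singular factor 1/(2 L_k) of the i-th angular form
into the constant a. This is `exists_cone_form`.

The statements about D_k are consequences. For a = 1 the cone term is the flat metric of ℂ. For a ≠
1 its value on a fixed vector depends on the direction of approach to z_i = 0, so no continuous
extension exists (`not_extends`). Two potentials with the same a have the same cone term, which
cancels in the difference (`exists_sub`). -/

lemma contMDiffAt_of_clm_apply {E F : Type*} [NormedAddCommGroup E] [NormedSpace ℝ E]
    [FiniteDimensional ℝ E] [NormedAddCommGroup F] [NormedSpace ℝ F] {f : M → E →L[ℝ] F} {m₀ : M}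
    (hf : ∀ v, ContMDiffAt 𝓘(ℝ, Fin n → ℂ) 𝓘(ℝ, F) ∞ (fun m => f m v) m₀) :
    ContMDiffAt 𝓘(ℝ, Fin n → ℂ) 𝓘(ℝ, E →L[ℝ] F) ∞ f m₀ := by
  let b := Module.finBasis ℝ E
  have h : f = fun m => ∑ i, ContinuousLinearMap.smulRightL ℝ E F
      (LinearMap.toContinuousLinearMap (b.coord i)) (f m (b i)) := by
    ext m v
    conv_lhs => rw [← b.sum_repr v, map_sum]
    simp only [map_smul]
    simp
  rw [h]
  exact contMDiffAt_finsetSum fun i _ =>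
    (ContinuousLinearMap.contMDiff _).contMDiffAt.comp m₀ (hf (b i))

variable [IsManifold 𝓘(ℝ, Fin n → ℂ) ∞ M]

variable (n) in
/-- The local trivialization of the tangent bundle at `m₀`, as a map from the model space to the
tangent space at `m`. -/
def frame (m₀ m : M) : (Fin n → ℂ) →L[ℝ] TangentSpace 𝓘(ℝ, Fin n → ℂ) m :=
  (trivializationAt (Fin n → ℂ) (TangentSpace 𝓘(ℝ, Fin n → ℂ)) m₀).symmL ℝ m

/-- Needed to evaluate limits at the base point: a constant model vector transported by `frame`
takes its own value there. -/
lemma frame_self (m : M) : frame n m m = ContinuousLinearMap.id ℝ _ := by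
  have : IsManifold 𝓘(ℝ, Fin n → ℂ) 1 M := .of_le (n := ∞) (by simp)
  rw [frame, TangentBundle.symmL_trivializationAt (by simp), mfderivWithin_range_extChartAt_symm]
  rfl

/-- Holding the model vector fixed turns the differential into an ordinary function with values in
the fixed space W, to which the calculus of smooth functions applies. -/
lemma contMDiffAt_diff_frame {W : Type*} [NormedAddCommGroup W] [NormedSpace ℝ W] {f : M → W}
    {m₀ : M} (hf : ContMDiffAt 𝓘(ℝ, Fin n → ℂ) 𝓘(ℝ, W) ∞ f m₀) (v : Fin n → ℂ) :
    ContMDiffAt 𝓘(ℝ, Fin n → ℂ) 𝓘(ℝ, W) ∞ (fun m => diff n f m (frame n m₀ m v)) m₀ := by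
  have : IsManifold 𝓘(ℝ, Fin n → ℂ) 1 M := .of_le (n := ∞) (by simp)
  refine ((hf.mfderiv_const (m := ∞) (by simp)).clm_apply
    (contMDiffAt_const (c := v))).congr_of_eventuallyEq ?_
  filter_upwards [(chartAt (Fin n → ℂ) m₀).open_source.mem_nhds (mem_chart_source _ m₀)] with m hm
  have hid : mfderiv 𝓘(ℝ, W) 𝓘(ℝ, W) (extChartAt 𝓘(ℝ, W) (f m₀)) (f m) =
      ContinuousLinearMap.id ℝ W := by
    rw [extChartAt_model_space_eq_id]; exact mfderiv_id
  have h := inTangentCoordinates_eq_mfderiv_comp (I := 𝓘(ℝ, Fin n → ℂ)) (I' := 𝓘(ℝ, W))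
    (f := id) (g := f) (ϕ := diff n f) (x₀ := m₀) (x := m) hm
    (by rw [chartAt_self_eq]; exact Set.mem_univ _)
  rw [hid] at h
  have h2 := DFunLike.congr_fun h v
  refine Eq.trans ?_ h2.symm
  rw [frame, TangentBundle.symmL_trivializationAt hm]
  rfl

/-- Smoothness of a section of the bundle of bilinear forms is reduced to that of scalar
coefficients in a single trivialization. Pullbacks, sums and differences of tensors are all handled
through this criterion. -/
lemma tensor_contMDiffAt_iff {g : Tensor2 n M} {m₀ : M} :
    ContMDiffAt 𝓘(ℝ, Fin n → ℂ)
      (𝓘(ℝ, Fin n → ℂ).prod 𝓘(ℝ, (Fin n → ℂ) →L[ℝ] (Fin n → ℂ) →L[ℝ] ℝ)) ∞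
      (fun m => Bundle.TotalSpace.mk' ((Fin n → ℂ) →L[ℝ] (Fin n → ℂ) →L[ℝ] ℝ) m (g m)) m₀ ↔
    ∀ v w, ContMDiffAt 𝓘(ℝ, Fin n → ℂ) 𝓘(ℝ, ℝ) ∞
      (fun m => g m (frame n m₀ m v) (frame n m₀ m w)) m₀ := by
  have key : ∀ v w, (fun m => ContinuousLinearMap.inCoordinates (Fin n → ℂ)
      (TangentSpace 𝓘(ℝ, Fin n → ℂ)) ((Fin n → ℂ) →L[ℝ] ℝ)
      (fun m : M => TangentSpace 𝓘(ℝ, Fin n → ℂ) m →L[ℝ] ℝ) m₀ m m₀ m (g m) v w) =ᶠ[𝓝 m₀]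
      fun m => g m (frame n m₀ m v) (frame n m₀ m w) := by
    intro v w
    filter_upwards [(chartAt (Fin n → ℂ) m₀).open_source.mem_nhds (mem_chart_source _ m₀)]
      with m hm
    have hm' : m ∈ (trivializationAt (Fin n → ℂ)
      (TangentSpace 𝓘(ℝ, Fin n → ℂ)) m₀).baseSet := by simpa using hm
    rw [inCoordinates_apply_eq₂ hm' hm' (by simp)]
    simp only [frame, Bundle.Trivialization.symmL_apply _ hm']
    simp
  rw [contMDiffAt_hom_bundle]
  constructor
  · rintro ⟨-, h⟩ v w
    exact ((h.clm_apply contMDiffAt_const).clm_apply contMDiffAt_const).congr_of_eventuallyEq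
      (key v w).symm
  · intro h
    refine ⟨contMDiffAt_id, contMDiffAt_of_clm_apply fun v => contMDiffAt_of_clm_apply fun w => ?_⟩
    exact (h v w).congr_of_eventuallyEq (key v w)

/-- The pullback of a smooth family of bilinear forms by a smooth map is a smooth tensor field. -/
lemma smoothOn_of_pullback {W : Type*} [NormedAddCommGroup W] [NormedSpace ℝ W] {f : M → W}
    {U : Set M} (hU : IsOpen U) (hf : ContMDiffOn 𝓘(ℝ, Fin n → ℂ) 𝓘(ℝ, W) ∞ f U)
    {β : M → W →L[ℝ] W →L[ℝ] ℝ}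
    (hβ : ContMDiffOn 𝓘(ℝ, Fin n → ℂ) 𝓘(ℝ, W →L[ℝ] W →L[ℝ] ℝ) ∞ β U) {g : Tensor2 n M}
    (hg : ∀ m ∈ U, ∀ v w, g m v w = β m (diff n f m v) (diff n f m w)) : SmoothOn g U := by
  intro m₀ hm₀
  have hn := hU.mem_nhds hm₀
  refine ContMDiffAt.contMDiffWithinAt (tensor_contMDiffAt_iff.2 fun v w => ?_)
  have h1 := contMDiffAt_diff_frame (hf.contMDiffAt hn)
  refine (((hβ.contMDiffAt hn).clm_apply (h1 v)).clm_apply (h1 w)).congr_of_eventuallyEq ?_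
  filter_upwards [hn] with m hm using hg m hm _ _

lemma SmoothOn.continuousAt_frame {g : Tensor2 n M} {U : Set M} (hg : SmoothOn g U)
    (hU : IsOpen U) {q : M} (hq : q ∈ U) (v w : Fin n → ℂ) :
    ContinuousAt (fun m => g m (frame n q m v) (frame n q m w)) q :=
  (tensor_contMDiffAt_iff.1 (ContMDiffOn.contMDiffAt hg (hU.mem_nhds hq)) v w).continuousAt

end TensorCalculus

open LabelledPolytope LabelledPolytope.ToricManifold Topology

/-! ### The charts at the vertices -/

section Charts

variable {n d : ℕ} {P : LabelledPolytope n d} {Λ : Submodule ℤ (Fin n → ℝ)} {hP : P.IsDelzant Λ}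
  {p : Fin n → ℝ} (hp : P.IsVertex p)

lemma isOpen_chartSource {p : Fin n → ℝ} (hp : P.IsVertex p) : IsOpen (chartSource hP p) :=
  (chartHomeo hP hp).open_source

lemma chartHomeo_mem_atlas :
    chartHomeo hP hp ∈ atlas (Fin n → ℂ) (ToricManifold P Λ hP) := by
  change _ ∈ ⋃ (e : PartialEquiv _ _) (he : e ∈ (core P Λ hP).atlas),
    {(core P Λ hP).openPartialHomeomorph e he}
  simp only [Set.mem_iUnion, Set.mem_singleton_iff]
  exact ⟨chart hP hp, ⟨p, hp, rfl⟩, rfl⟩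

lemma contMDiffOn_chartFun : ContMDiffOn 𝓘(ℝ, Fin n → ℂ) 𝓘(ℝ, Fin n → ℂ) ∞ (chartFun hP hp)
    (chartSource hP p) :=
  contMDiffOn_of_mem_maximalAtlas
    (IsManifold.subset_maximalAtlas (chartHomeo_mem_atlas (hP := hP) hp))

lemma contMDiffAt_chartFun {m : ToricManifold P Λ hP} (hm : m ∈ chartSource hP p) :
    ContMDiffAt 𝓘(ℝ, Fin n → ℂ) 𝓘(ℝ, Fin n → ℂ) ∞ (chartFun hP hp) m :=
  (contMDiffOn_chartFun hp).contMDiffAt ((isOpen_chartSource hp).mem_nhds hm)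

lemma mdifferentiable_chartHomeo : (chartHomeo hP hp).MDifferentiable 𝓘(ℝ, Fin n → ℂ)
    𝓘(ℝ, Fin n → ℂ) := by
  have : IsManifold 𝓘(ℝ, Fin n → ℂ) 1 (ToricManifold P Λ hP) := .of_le (n := ∞) (by simp)
  exact mdifferentiable_of_mem_atlas (chartHomeo_mem_atlas hp)

lemma diff_chartFun_bijective {m : ToricManifold P Λ hP} (hm : m ∈ chartSource hP p) :
    Function.Bijective (diff n (chartFun hP hp) m) :=
  (mdifferentiable_chartHomeo (hP := hP) hp).mfderiv_bijective hm

/-- `symplecticForm` reads tangent vectors at m directly as elements of ℂⁿ. That identification is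
the preferred chart, the one at `vertexAt m`, whose differential at its own base point is the
identity. -/
lemma diff_chartFun_vertexAt (m : ToricManifold P Λ hP) (v : TangentSpace 𝓘(ℝ, Fin n → ℂ) m) :
    diff n (chartFun hP (isVertex_vertexAt m)) m v = v := by
  have : IsManifold 𝓘(ℝ, Fin n → ℂ) 1 (ToricManifold P Λ hP) := .of_le (n := ∞) (by simp)
  have h := mfderiv_extChartAt_self (I := 𝓘(ℝ, Fin n → ℂ)) (x := m)
  exact DFunLike.congr_fun h v

lemma mem_chartSource_vertexAt (m : ToricManifold P Λ hP) : m ∈ chartSource hP (vertexAt hP m) :=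
  (exists_vertex (moment_mem m)).choose_spec.2

lemma chartMoment_chartFun {m : ToricManifold P Λ hP} (hm : m ∈ chartSource hP p) :
    chartMoment hp (chartFun hP hp m) = moment m := by
  obtain ⟨θ, h⟩ := exists_pt m
  have hx := moment_mem m
  conv_lhs => rw [h]
  rw [chartFun_pt hp hx hm, chartMoment_coord hp hx]

lemma L_moment_eq {m : ToricManifold P Λ hP} (hm : m ∈ chartSource hP p) (i : Fin n) :
    P.L (vertexIdx hp i) (moment m) = 1 / 2 * ‖chartFun hP hp m i‖ ^ 2 := by
  rw [← chartMoment_chartFun hp hm, L_chartMoment]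

lemma contMDiff_moment :
    ContMDiff 𝓘(ℝ, Fin n → ℂ) 𝓘(ℝ, Fin n → ℝ) ∞ (moment : ToricManifold P Λ hP → _) := by
  intro m
  have hm := mem_chartSource_vertexAt m
  refine ((contDiff_chartMoment (isVertex_vertexAt m)).contMDiff.contMDiffAt.comp m
    (contMDiffAt_chartFun (isVertex_vertexAt m) hm)).congr_of_eventuallyEq ?_
  filter_upwards [(isOpen_chartSource (isVertex_vertexAt m)).mem_nhds hm] with m' hm'
  exact (chartMoment_chartFun _ hm').symm

lemma active_eq_empty {x : Fin n → ℝ} (hx : x ∈ P.openSet) : P.active x = ∅ := by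
  ext k; simp [mem_active, (hx k).ne']

lemma isOpen_openSet : IsOpen P.openSet := by
  have : P.openSet = ⋂ k, {x | 0 < P.L k x} := by ext x; simp [openSet]
  rw [this]
  exact isOpen_iInter_of_finite fun k => isOpen_lt continuous_const (continuous_L k)

lemma mem_chartSource_of_openSet {m : ToricManifold P Λ hP} (hm : moment m ∈ P.openSet) :
    m ∈ chartSource hP p := by
  change P.active _ ⊆ _
  rw [active_eq_empty hm]; simp

lemma pt_mem_chartSource {x : Fin n → ℝ} (hx : x ∈ P.openSet) (θ : Fin n → ℝ) :
    pt hP (x, θ) ∈ chartSource hP p := by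
  apply mem_chartSource_of_openSet
  rwa [moment_pt (closedSet_of_openSet hx)]

/-- The action-angle coframe at the point with complex coordinates `z`: the pair of
`dx = ∑ Re(z̄_i dz_i) η_i^*` and `dθ = ∑ Im(z̄_i dz_i) / |z_i|² η_i`. -/
def polarCoframe (z ζ : Fin n → ℂ) : (Fin n → ℝ) × (Fin n → ℝ) :=
  ((vertexMat hp)⁻¹ *ᵥ (fun i => (starRingEnd ℂ (z i) * ζ i).re),
    (fun i => (starRingEnd ℂ (z i) * ζ i).im / ‖z i‖ ^ 2) ᵥ* vertexMat hp)

lemma differentiableAt_coord {x : Fin n → ℝ} (hx : x ∈ P.openSet) (θ : Fin n → ℝ) :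
    DifferentiableAt ℝ (fun b : (Fin n → ℝ) × (Fin n → ℝ) => coord hp b.1 b.2) (x, θ) := by
  refine differentiableAt_pi.2 fun i => ?_
  have h1 : DifferentiableAt ℝ (fun b : (Fin n → ℝ) × (Fin n → ℝ) =>
      Real.sqrt (2 * P.L (vertexIdx hp i) b.1)) (x, θ) := by
    refine DifferentiableAt.sqrt ?_ (by have := hx (vertexIdx hp i); positivity)
    unfold L dotProduct; fun_prop
  have h2 : DifferentiableAt ℝ (fun b : (Fin n → ℝ) × (Fin n → ℝ) =>
      (b.2 ᵥ* (vertexMat hp)⁻¹) i) (x, θ) := by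
    simp only [Matrix.vecMul, dotProduct]; fun_prop
  have h3 := Complex.ofRealCLM.differentiableAt.comp (x, θ) h1
  have h4 := Complex.ofRealCLM.differentiableAt.comp (x, θ) h2
  exact h3.mul (h4.mul_const Complex.I).cexp

/-- For z = r exp(√-1 τ) one has conj(z) dz = r dr + √-1 r² dτ: the conjugate removes the phase, and
r² = 2 L gives r dr = dL, without the square root. -/
lemma conj_coord_mul_fderiv {x : Fin n → ℝ} (hx : x ∈ P.openSet) (θ : Fin n → ℝ)
    (a : (Fin n → ℝ) × (Fin n → ℝ)) (i : Fin n) :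
    starRingEnd ℂ (coord hp x θ i) *
      fderiv ℝ (fun b : (Fin n → ℝ) × (Fin n → ℝ) => coord hp b.1 b.2) (x, θ) a i =
    ((a.1 ⬝ᵥ P.normal (vertexIdx hp i) : ℝ) : ℂ) +
      ((2 * P.L (vertexIdx hp i) x * (a.2 ᵥ* (vertexMat hp)⁻¹) i : ℝ) : ℂ) * Complex.I := by
  set l := P.L (vertexIdx hp i) x with hl
  have hl0 : 0 < l := hx _
  set c := a.1 ⬝ᵥ P.normal (vertexIdx hp i)
  set s := (a.2 ᵥ* (vertexMat hp)⁻¹) i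
  set τ := (θ ᵥ* (vertexMat hp)⁻¹) i with hτ
  set r := Real.sqrt (2 * l) with hr
  have hr0 : 0 < r := Real.sqrt_pos.2 (by positivity)
  have hr2 : r * r = 2 * l := Real.mul_self_sqrt (by positivity)
  -- Both sides are compared as derivatives along the line through (x, θ) in direction a, where L
  -- and the angle are affine in t.
  have hline : HasDerivAt (fun t : ℝ => (x, θ) + t • a) a 0 := by
    simpa using ((hasDerivAt_id (0 : ℝ)).smul_const a).const_add (x, θ)
  have hd : HasFDerivAt (fun b : (Fin n → ℝ) × (Fin n → ℝ) => coord hp b.1 b.2)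
      (fderiv ℝ (fun b : (Fin n → ℝ) × (Fin n → ℝ) => coord hp b.1 b.2) (x, θ))
      ((x, θ) + (0 : ℝ) • a) := by
    rw [zero_smul, add_zero]; exact (differentiableAt_coord hp hx θ).hasFDerivAt
  have h1 := (hasDerivAt_pi.1 (hd.comp_hasDerivAt 0 hline)) i
  have h2 : HasDerivAt (fun t : ℝ => (Real.sqrt (2 * (l + t * c)) : ℂ) *
      Complex.exp (((τ + t * s : ℝ) : ℂ) * Complex.I))
      (((c / r : ℝ) : ℂ) * Complex.exp ((τ : ℂ) * Complex.I) +
        (r : ℂ) * (Complex.exp ((τ : ℂ) * Complex.I) * ((s : ℂ) * Complex.I))) 0 := by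
    have e1 : HasDerivAt (fun t : ℝ => Real.sqrt (2 * (l + t * c))) (c / r) 0 := by
      have h : HasDerivAt (fun t : ℝ => 2 * (l + t * c)) (2 * (1 * c)) 0 :=
        (((hasDerivAt_id' (0 : ℝ)).mul_const c).const_add l).const_mul 2
      refine (h.sqrt (by simpa using hl0.ne')).congr_deriv ?_
      rw [zero_mul, add_zero, ← hr, one_mul]
      field_simp
    have e2 : HasDerivAt (fun t : ℝ => τ + t * s) s 0 := by
      simpa using ((hasDerivAt_id (0 : ℝ)).mul_const s).const_add τ
    have e3 := ((e2.ofReal_comp).mul_const Complex.I).cexp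
    refine (e1.ofReal_comp.mul e3).congr_deriv ?_
    simp only [zero_mul, add_zero, ← hr]
  have h3 : (fun t : ℝ => coord hp ((x, θ) + t • a).1 ((x, θ) + t • a).2 i) =
      fun t : ℝ => (Real.sqrt (2 * (l + t * c)) : ℂ) *
      Complex.exp (((τ + t * s : ℝ) : ℂ) * Complex.I) := by
    ext t
    simp only [coord, Prod.fst_add, Prod.snd_add, Prod.smul_fst, Prod.smul_snd, L_add,
      Matrix.add_vecMul, Matrix.smul_vecMul, smul_dotProduct, Pi.add_apply, Pi.smul_apply,
      smul_eq_mul]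
    rfl
  have h4 := h1.unique (h3 ▸ h2)
  rw [h4]
  have hz : coord hp x θ i = (r : ℂ) * Complex.exp ((τ : ℂ) * Complex.I) := rfl
  rw [hz, map_mul, Complex.conj_ofReal, ← Complex.exp_conj, map_mul, Complex.conj_ofReal,
    Complex.conj_I]
  have he : Complex.exp ((τ : ℂ) * -Complex.I) * Complex.exp ((τ : ℂ) * Complex.I) = 1 := by
    rw [← Complex.exp_add]; simp
  have hrc : (r : ℂ) * r = 2 * l := by exact_mod_cast hr2
  have hrn : (r : ℂ) ≠ 0 := by exact_mod_cast hr0.ne'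
  generalize Complex.exp ((τ : ℂ) * -Complex.I) = E₁ at *
  generalize Complex.exp ((τ : ℂ) * Complex.I) = E₂ at *
  push_cast
  rw [← hrc]
  field_simp
  linear_combination ((c : ℂ) + r * r * s * Complex.I) * he

lemma polarCoframe_coord {x : Fin n → ℝ} (hx : x ∈ P.openSet) (θ : Fin n → ℝ)
    (a : (Fin n → ℝ) × (Fin n → ℝ)) :
    polarCoframe hp (coord hp x θ)
      (fderiv ℝ (fun b : (Fin n → ℝ) × (Fin n → ℝ) => coord hp b.1 b.2) (x, θ) a) = a := by
  simp only [polarCoframe, conj_coord_mul_fderiv hp hx, norm_coord]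
  refine Prod.ext ?_ ?_
  · have : (fun i => ((((a.1 ⬝ᵥ P.normal (vertexIdx hp i) : ℝ) : ℂ) +
      ((2 * P.L (vertexIdx hp i) x * (a.2 ᵥ* (vertexMat hp)⁻¹) i : ℝ) : ℂ) * Complex.I)).re) =
      vertexMat hp *ᵥ a.1 := by
      ext i
      simp only [Complex.add_re, Complex.ofReal_re, Complex.re_ofReal_mul, Complex.I_re, mul_zero,
        add_zero, Matrix.mulVec, dotProduct_comm a.1]
      rfl
    simp only [this, Matrix.mulVec_mulVec, vertexMat_inv_mul, Matrix.one_mulVec]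
  · have : (fun i => ((((a.1 ⬝ᵥ P.normal (vertexIdx hp i) : ℝ) : ℂ) +
      ((2 * P.L (vertexIdx hp i) x * (a.2 ᵥ* (vertexMat hp)⁻¹) i : ℝ) : ℂ) * Complex.I)).im /
        Real.sqrt (2 * P.L (vertexIdx hp i) x) ^ 2) = a.2 ᵥ* (vertexMat hp)⁻¹ := by
      ext i
      have h0 := hx (vertexIdx hp i)
      rw [Real.sq_sqrt (by positivity)]
      simp only [Complex.add_im, Complex.ofReal_im, Complex.im_ofReal_mul, Complex.I_im, mul_one,
        zero_add]
      field_simp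
    simp only [this, Matrix.vecMul_vecMul, vertexMat_inv_mul, Matrix.vecMul_one]

/-- The differential of the complex coordinates along the action-angle parametrization. -/
lemma diff_chartFun_dpt {x : Fin n → ℝ} (hx : x ∈ P.openSet) (θ : Fin n → ℝ)
    (a : (Fin n → ℝ) × (Fin n → ℝ)) :
    diff n (chartFun hP hp) (pt hP (x, θ)) (dpt hP x θ a) =
      fderiv ℝ (fun b : (Fin n → ℝ) × (Fin n → ℝ) => coord hp b.1 b.2) (x, θ) a := by
  have hev : ∀ᶠ b : (Fin n → ℝ) × (Fin n → ℝ) in 𝓝 (x, θ), b.1 ∈ P.openSet :=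
    continuous_fst.continuousAt.eventually (isOpen_openSet.mem_nhds hx)
  have hpt : pt hP =ᶠ[𝓝 (x, θ)] fun b => (chartHomeo hP hp).symm (coord hp b.1 b.2) := by
    filter_upwards [hev] with b hb
    have h := (chartHomeo hP hp).left_inv (pt_mem_chartSource (hP := hP) (p := p) hb b.2)
    rw [← h]
    congr 1
    exact chartFun_pt hp (closedSet_of_openSet hb) (by rw [active_eq_empty hb]; simp)
  have hcomp : chartFun hP hp ∘ pt hP =ᶠ[𝓝 (x, θ)] fun b => coord hp b.1 b.2 := by
    filter_upwards [hev] with b hb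
    exact chartFun_pt hp (closedSet_of_openSet hb) (by rw [active_eq_empty hb]; simp)
  have hc := (differentiableAt_coord hp hx θ).mdifferentiableAt
  have htar : coord hp x θ ∈ (chartHomeo hP hp).target := by
    have := (chartHomeo hP hp).map_source (pt_mem_chartSource (hP := hP) (p := p) hx θ)
    have h2 : chartHomeo hP hp (pt hP (x, θ)) = coord hp x θ :=
      chartFun_pt hp (closedSet_of_openSet hx) (by rw [active_eq_empty hx]; simp)
    rwa [h2] at this
  have hd : MDifferentiableAt 𝓘(ℝ, (Fin n → ℝ) × (Fin n → ℝ)) 𝓘(ℝ, Fin n → ℂ) (pt hP) (x, θ) := by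
    refine MDifferentiableAt.congr_of_eventuallyEq ?_ hpt
    exact MDifferentiableAt.comp (x, θ)
      ((mdifferentiable_chartHomeo (hP := hP) hp).mdifferentiableAt_symm htar) hc
  have hchain := mfderiv_comp (x, θ)
    ((contMDiffAt_chartFun hp (pt_mem_chartSource (hP := hP) hx θ)).mdifferentiableAt (by simp)) hd
  rw [hcomp.mfderiv_eq, mfderiv_eq_fderiv] at hchain
  exact (DFunLike.congr_fun hchain a).symm

lemma polarCoframe_dpt {x : Fin n → ℝ} (hx : x ∈ P.openSet) (θ : Fin n → ℝ)
    (a : (Fin n → ℝ) × (Fin n → ℝ)) :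
    polarCoframe hp (chartFun hP hp (pt hP (x, θ)))
      (diff n (chartFun hP hp) (pt hP (x, θ)) (dpt hP x θ a)) = a := by
  rw [diff_chartFun_dpt hp hx, chartFun_pt hp (closedSet_of_openSet hx)
    (by rw [active_eq_empty hx]; simp), polarCoframe_coord hp hx]

end Charts

/-- `ContinuousLinearMap.inverse` takes the default value 0 on maps that are not invertible.
Equality of dimensions excludes that case, so a left inverse is enough to identify it. -/
lemma inverse_apply_of_injective {E F : Type*} [NormedAddCommGroup E] [NormedSpace ℝ E]
    [FiniteDimensional ℝ E] [NormedAddCommGroup F] [NormedSpace ℝ F] [FiniteDimensional ℝ F]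
    (h : Module.finrank ℝ E = Module.finrank ℝ F) {D : E →L[ℝ] F} (hD : Function.Injective D) :
    Function.Surjective D ∧ ∀ a, D.inverse (D a) = a := by
  let e : E ≃L[ℝ] F :=
    (LinearEquiv.ofInjectiveOfFinrankEq D.toLinearMap hD h).toContinuousLinearEquiv
  have he : D = e := by
    ext a; rfl
  refine ⟨?_, fun a => ?_⟩
  · rw [he]; exact e.surjective
  · rw [he, ContinuousLinearMap.inverse_equiv]; exact e.symm_apply_apply a

/-! ### The action-angle coframe and the symplectic form in vertex coordinates -/

section ActionAngle

variable {n d : ℕ} {P : LabelledPolytope n d} {Λ : Submodule ℤ (Fin n → ℝ)} {hP : P.IsDelzant Λ}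
  {p : Fin n → ℝ} (hp : P.IsVertex p)

/-- The equations h and hD separate m from `pt hP (x, θ)`: the definition of `coframe` uses a chosen
angle over m, and the two tangent spaces agree only after substitution. Injectivity of D comes from
the left inverse `polarCoframe`, surjectivity from dimensions. -/
lemma coframe_and_surjective {m : ToricManifold P Λ hP} {x θ : Fin n → ℝ} (hx : x ∈ P.openSet)
    (h : m = pt hP (x, θ)) {D : (Fin n → ℝ) × (Fin n → ℝ) →L[ℝ] (Fin n → ℂ)}
    (hD : D = dpt hP x θ) :
    Function.Surjective D ∧ (∀ a, D.inverse (D a) = a) ∧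
      ∀ a, polarCoframe hp (chartFun hP hp m) (diff n (chartFun hP hp) m (D a)) = a := by
  subst h hD
  have h1 := polarCoframe_dpt (hP := hP) hp hx θ
  have hinj : Function.Injective (dpt hP x θ) := by
    intro a b hab
    rw [← h1 a, hab, h1 b]
  have := inverse_apply_of_injective (E := (Fin n → ℝ) × (Fin n → ℝ)) (F := Fin n → ℂ)
    (by simp [Module.finrank_pi_fintype]; ring) hinj
  exact ⟨this.1, this.2, h1⟩

/-- The action-angle coframe in the complex coordinates at a vertex. -/
lemma coframe_eq {m : ToricManifold P Λ hP} (hm : moment m ∈ P.openSet)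
    (v : TangentSpace 𝓘(ℝ, Fin n → ℂ) m) :
    coframe hP m v = polarCoframe hp (chartFun hP hp m) (diff n (chartFun hP hp) m v) := by
  obtain ⟨h1, h2, h3⟩ := coframe_and_surjective hp hm (exists_pt m).choose_spec rfl
  obtain ⟨a, rfl⟩ := h1 v
  exact (h2 a).trans (h3 a).symm

lemma exists_isVertex (P : LabelledPolytope n d) : ∃ p, P.IsVertex p :=
  (exists_vertex P.basePoint.2).imp fun _ h => h.1

lemma coframe_dpt {x : Fin n → ℝ} (hx : x ∈ P.openSet) (θ : Fin n → ℝ)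
    (a : (Fin n → ℝ) × (Fin n → ℝ)) : coframe hP (pt hP (x, θ)) (dpt hP x θ a) = a := by
  obtain ⟨p, hp⟩ := exists_isVertex P
  rw [coframe_eq hp (by rwa [moment_pt (closedSet_of_openSet hx)]), polarCoframe_dpt hp hx]

lemma coframe_bijective {m : ToricManifold P Λ hP} (hm : moment m ∈ P.openSet) :
    Function.Bijective (coframe hP m) := by
  obtain ⟨p, hp⟩ := exists_isVertex P
  obtain ⟨h1, h2, h3⟩ := coframe_and_surjective hp hm (exists_pt m).choose_spec rfl
  refine ⟨fun v w h => ?_, fun a => ⟨_, h2 a⟩⟩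
  obtain ⟨a, rfl⟩ := h1 v
  obtain ⟨b, rfl⟩ := h1 w
  have e1 := h2 a
  have e2 := h2 b
  have : a = b := e1.symm.trans (h.trans e2)
  rw [this]

lemma chartFun_ne_zero {m : ToricManifold P Λ hP} (hm : m ∈ chartSource hP p) {i : Fin n}
    (hi : 0 < P.L (vertexIdx hp i) (moment m)) : chartFun hP hp m i ≠ 0 := by
  intro h
  rw [L_moment_eq hp hm, h] at hi
  simp at hi

lemma mulVec_inv_dotProduct_vecMul (a b : Fin n → ℝ) :
    ((vertexMat hp)⁻¹ *ᵥ a) ⬝ᵥ (b ᵥ* vertexMat hp) = a ⬝ᵥ b := by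
  rw [dotProduct_comm, ← Matrix.dotProduct_mulVec, Matrix.mulVec_mulVec, vertexMat_mul_inv,
    Matrix.one_mulVec, dotProduct_comm]

/-- In the pairing of dx with dθ the vertex matrix cancels its inverse. What remains in each
coordinate is Im(conj(z̄ζ) z̄ζ') / |z|² = Im(ζ̄ ζ'), so the modulus and phase of z disappear. -/
lemma polarCoframe_symplectic {z : Fin n → ℂ} (hz : ∀ i, z i ≠ 0) (ζ ζ' : Fin n → ℂ) :
    (polarCoframe hp z ζ).1 ⬝ᵥ (polarCoframe hp z ζ').2 -
      (polarCoframe hp z ζ).2 ⬝ᵥ (polarCoframe hp z ζ').1 =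
    ∑ j, ((ζ j).re * (ζ' j).im - (ζ j).im * (ζ' j).re) := by
  simp only [polarCoframe]
  rw [mulVec_inv_dotProduct_vecMul, dotProduct_comm (_ ᵥ* _), mulVec_inv_dotProduct_vecMul,
    dotProduct, dotProduct, ← Finset.sum_sub_distrib]
  refine Finset.sum_congr rfl fun j _ => ?_
  have h : ‖z j‖ ^ 2 = (z j).re ^ 2 + (z j).im ^ 2 := by
    rw [← Complex.normSq_eq_norm_sq, Complex.normSq_apply]; ring
  have h0 : (z j).re ^ 2 + (z j).im ^ 2 ≠ 0 := by
    rw [← h]; exact pow_ne_zero 2 (norm_ne_zero_iff.2 (hz j))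
  rw [h]
  simp only [Complex.mul_re, Complex.mul_im, Complex.conj_re, Complex.conj_im]
  field_simp
  ring

lemma symplecticForm_apply (m : ToricManifold P Λ hP) (v w : TangentSpace 𝓘(ℝ, Fin n → ℂ) m) :
    symplecticForm hP m v w = ∑ j, (((v : Fin n → ℂ) j).re * ((w : Fin n → ℂ) j).im -
      ((v : Fin n → ℂ) j).im * ((w : Fin n → ℂ) j).re) := by
  unfold symplecticForm
  simp only [sum_apply, sub_apply,
    ContinuousLinearMap.smulRight_apply, smul_apply]
  rfl

/-- The preferred chart changes with the point, whereas the coframe does not depend on a vertex.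
This makes it possible to pass to a chart at any fixed vertex. -/
lemma symplecticForm_eq_coframe {m : ToricManifold P Λ hP} (hm : moment m ∈ P.openSet)
    (v w : TangentSpace 𝓘(ℝ, Fin n → ℂ) m) :
    symplecticForm hP m v w = (coframe hP m v).1 ⬝ᵥ (coframe hP m w).2 -
      (coframe hP m v).2 ⬝ᵥ (coframe hP m w).1 := by
  rw [coframe_eq (isVertex_vertexAt m) hm, coframe_eq (isVertex_vertexAt m) hm,
    polarCoframe_symplectic, diff_chartFun_vertexAt, diff_chartFun_vertexAt, symplecticForm_apply]
  exact fun i => chartFun_ne_zero _ (mem_chartSource_of_openSet hm) (hm _)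

/-- The symplectic form is the standard one in the complex coordinates at each vertex. -/
lemma symplecticForm_eq_chart {m : ToricManifold P Λ hP} (hm : moment m ∈ P.openSet)
    (v w : TangentSpace 𝓘(ℝ, Fin n → ℂ) m) :
    symplecticForm hP m v w =
      ∑ j, ((diff n (chartFun hP hp) m v j).re * (diff n (chartFun hP hp) m w j).im -
      (diff n (chartFun hP hp) m v j).im * (diff n (chartFun hP hp) m w j).re) := by
  rw [symplecticForm_eq_coframe hm, coframe_eq hp hm, coframe_eq hp hm, polarCoframe_symplectic]
  exact fun i => chartFun_ne_zero _ (mem_chartSource_of_openSet hm) (hm _)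

lemma metric_apply (u : (Fin n → ℝ) → ℝ) (m : ToricManifold P Λ hP)
    (v w : TangentSpace 𝓘(ℝ, Fin n → ℂ) m) :
    metric hP u m v w =
      (coframe hP m v).1 ⬝ᵥ hess u (moment m) *ᵥ (coframe hP m w).1 +
      (coframe hP m v).2 ⬝ᵥ (hess u (moment m))⁻¹ *ᵥ (coframe hP m w).2 := by
  unfold metric
  simp only [sum_apply, add_apply,
    ContinuousLinearMap.smulRight_apply, smul_apply, dotProduct, Matrix.mulVec,
    Finset.mul_sum, ← Finset.sum_add_distrib, smul_eq_mul]
  refine Finset.sum_congr rfl fun i _ => Finset.sum_congr rfl fun j _ => ?_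
  simp only [dx, dtheta, ContinuousLinearMap.comp_apply, ContinuousLinearMap.proj_apply,
    ContinuousLinearMap.coe_fst', ContinuousLinearMap.coe_snd']
  ring

/-! ### The locus of trivial stabilizers -/

/-- A zero normal would make L_k constant, although it is positive at one point and zero at another.
-/
lemma normal_ne_zero (P : LabelledPolytope n d) (k : Fin d) : P.normal k ≠ 0 := by
  intro h
  obtain ⟨x, hx⟩ := P.nonempty'
  obtain ⟨y, hy, -⟩ := P.facet' k
  have := hx k
  rw [h] at this hy
  simp at this hy
  linarith

/-- Over F_k the class of π η_k fixes the point. It is not trivial: η_k belongs to a ℤ-basis of Λ,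
so ½ η_k is not in Λ. Over P no normal is active and the isotropy group is 2πΛ itself. -/
lemma freeLocus_eq : freeLocus hP = {m | moment m ∈ P.openSet} := by
  ext m
  obtain ⟨θ, hθ⟩ := exists_pt m
  have hx := moment_mem m
  change (∀ t : Torus Λ, t +ᵥ m = m → t = 0) ↔ moment m ∈ P.openSet
  constructor
  · intro h k
    refine lt_of_le_of_ne (hx k) fun hk => ?_
    have hact : k ∈ P.active (moment m) := mem_active.2 hk.symm
    obtain ⟨p, hp, hpx⟩ := exists_vertex hx
    obtain ⟨i, hi⟩ := (mem_active_vertex hp).1 (hpx hact)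
    have h1 : (QuotientAddGroup.mk (Real.pi • P.normal k) : Torus Λ) +ᵥ m = m := by
      rw [hθ, mk_vadd_pt]
      rw [pt_eq_pt hx, add_sub_cancel_right]
      refine (P.mem_isotropy Λ).2 ⟨0, zero_mem _, Real.pi • P.normal k, ?_, by simp⟩
      exact Submodule.smul_mem _ _ (Submodule.subset_span ⟨k, hact, rfl⟩)
    have h2 := h _ h1
    rw [QuotientAddGroup.eq_zero_iff] at h2
    obtain ⟨l, hl, hl2⟩ := h2
    have hl3 : (2 * Real.pi) • l = Real.pi • P.normal k := hl2
    obtain ⟨N, hN⟩ := int_of_mem hP hp hl i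
    have h4 := congrFun (congrArg (fun y => y ᵥ* (vertexMat hp)⁻¹) hl3) i
    simp only [Matrix.smul_vecMul, Pi.smul_apply, hN, ← hi, normal_vecMul_inv, Pi.single_eq_same,
      smul_eq_mul] at h4
    have h5 : (2 : ℝ) * N = 1 := by
      have := Real.pi_pos
      have h6 : Real.pi * (2 * N - 1) = 0 := by linarith
      rcases mul_eq_zero.1 h6 with h7 | h7 <;> linarith
    have h8 : (2 : ℤ) * N = 1 := by exact_mod_cast h5
    omega
  · intro hm t ht
    induction t using QuotientAddGroup.induction_on with
    | H s =>
      rw [hθ, mk_vadd_pt] at ht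
      rw [pt_eq_pt hx, add_sub_cancel_right, isotropy, active_eq_empty hm] at ht
      rw [QuotientAddGroup.eq_zero_iff]
      simpa using ht

lemma isOpen_freeLocus : IsOpen (freeLocus hP) := by
  rw [freeLocus_eq]
  exact isOpen_openSet.preimage continuous_moment

/-- With the angle fixed, the segment from the moment of m to an interior point of the polytope
lifts to a path in M that starts at m and enters the free locus immediately. -/
lemma dense_freeLocus : Dense (freeLocus hP) := by
  intro m
  obtain ⟨θ, hθ⟩ := exists_pt m
  have hx := moment_mem m
  obtain ⟨x₀, hx₀⟩ := P.nonempty'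
  have hL : ∀ k (t : ℝ), P.L k (moment m + t • (x₀ - moment m)) =
      (1 - t) * P.L k (moment m) + t * P.L k x₀ := by
    intro k t
    have : P.L k x₀ = P.L k (moment m) + (x₀ - moment m) ⬝ᵥ P.normal k := by
      rw [← L_add]; congr 1; abel
    rw [L_add, this, smul_dotProduct, smul_eq_mul]; ring
  have hpos : ∀ k (t : ℝ), 0 < t → t ≤ 1 → 0 < P.L k (moment m + t • (x₀ - moment m)) := by
    intro k t h0 h1
    rw [hL]
    have e1 := hx k
    have e2 : 0 < P.L k x₀ := hx₀ k
    have := mul_nonneg (sub_nonneg.2 h1) e1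
    have := mul_pos h0 e2
    linarith
  have hmem : ∀ t : Set.Icc (0 : ℝ) 1, moment m + t.1 • (x₀ - moment m) ∈ P.closedSet := by
    rintro ⟨t, h0, h1⟩ k
    rcases h0.eq_or_lt with h | h
    · simp [← h, hx k]
    · exact (hpos k t h h1).le
  let γ : Set.Icc (0 : ℝ) 1 → ToricManifold P Λ hP := fun t =>
    mk hP (⟨moment m + t.1 • (x₀ - moment m), hmem t⟩, θ)
  have hγ : Continuous γ := by
    refine continuous_mk.comp (Continuous.prodMk (Continuous.subtype_mk ?_ _) continuous_const)
    fun_prop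
  have h0 : γ ⟨0, Set.left_mem_Icc.2 zero_le_one⟩ = m := by
    conv_rhs => rw [hθ, pt_of_mem hx]
    simp [γ]
  have hd : Dense {t : Set.Icc (0 : ℝ) 1 | (0 : ℝ) < t.1} := by
    intro t
    rw [mem_closure_iff_seq_limit]
    -- The maximum keeps the sequence positive and in [0, 1]; it tends to max t 0 = t.
    refine ⟨fun j => ⟨max t.1 (1 / (j + 1)), ⟨t.2.1.trans (le_max_left _ _), max_le t.2.2 ?_⟩⟩,
      fun j => ?_, ?_⟩
    · rw [div_le_one (by positivity)]
      have : (0 : ℝ) ≤ j := by positivity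
      linarith
    · have hj : (0 : ℝ) < 1 / (j + 1) := by positivity
      exact lt_max_of_lt_right hj
    · rw [tendsto_subtype_rng]
      have := (tendsto_const_nhds (x := t.1)).max (tendsto_one_div_add_atTop_nhds_zero_nat (𝕜 := ℝ))
      rwa [max_eq_left t.2.1] at this
  have h1 := hγ.range_subset_closure_image_dense hd
  rw [← h0]
  refine closure_mono ?_ (h1 ⟨_, rfl⟩)
  rintro _ ⟨t, ht, rfl⟩
  rw [freeLocus_eq]
  exact fun k => hpos k t.1 ht t.2.2

/-! ### Invariance -/

lemma moment_vadd (t : Torus Λ) (m : ToricManifold P Λ hP) : moment (t +ᵥ m) = moment m := by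
  obtain ⟨θ, hθ⟩ := exists_pt m
  have hx := moment_mem m
  induction t using QuotientAddGroup.induction_on with
  | H s =>
    conv_lhs => rw [hθ, mk_vadd_pt]
    rw [moment_pt hx]

lemma chartFun_vadd (s : Fin n → ℝ) {m : ToricManifold P Λ hP} (hm : m ∈ chartSource hP p) :
    chartFun hP hp ((QuotientAddGroup.mk s : Torus Λ) +ᵥ m) = fun i =>
      Complex.exp (((s ᵥ* (vertexMat hp)⁻¹) i : ℝ) * Complex.I) * chartFun hP hp m i := by
  obtain ⟨θ, hθ⟩ := exists_pt m
  have hx := moment_mem m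
  have h1 : chartFun hP hp ((QuotientAddGroup.mk s : Torus Λ) +ᵥ m) =
      coord hp (moment m) (s + θ) := by
    conv_lhs => rw [hθ, mk_vadd_pt]
    rw [chartFun_pt hp hx hm]
  have h2 : chartFun hP hp m = coord hp (moment m) θ := by
    conv_lhs => rw [hθ]
    rw [chartFun_pt hp hx hm]
  rw [h1, h2]
  ext i
  simp only [coord, Matrix.add_vecMul, Pi.add_apply]
  push_cast
  rw [add_mul, Complex.exp_add]
  ring

lemma vadd_mem_chartSource (t : Torus Λ) {m : ToricManifold P Λ hP} (hm : m ∈ chartSource hP p) :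
    t +ᵥ m ∈ chartSource hP p := by
  change P.active _ ⊆ _
  rw [moment_vadd]; exact hm

/-- The differential of a translation multiplies the complex coordinates by phases. -/
lemma diff_chartFun_vadd (s : Fin n → ℝ) {m : ToricManifold P Λ hP} (hm : m ∈ chartSource hP p)
    (v : TangentSpace 𝓘(ℝ, Fin n → ℂ) m) :
    diff n (chartFun hP hp) ((QuotientAddGroup.mk s : Torus Λ) +ᵥ m)
      (mfderiv 𝓘(ℝ, Fin n → ℂ) 𝓘(ℝ, Fin n → ℂ)
        (fun m' : ToricManifold P Λ hP => (QuotientAddGroup.mk s : Torus Λ) +ᵥ m') m v) = fun i =>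
      Complex.exp (((s ᵥ* (vertexMat hp)⁻¹) i : ℝ) * Complex.I) *
        diff n (chartFun hP hp) m v i := by
  set t : Torus Λ := QuotientAddGroup.mk s with ht
  let T : (Fin n → ℂ) →L[ℝ] (Fin n → ℂ) := ContinuousLinearMap.pi fun i =>
    (ContinuousLinearMap.mul ℝ ℂ (Complex.exp (((s ᵥ* (vertexMat hp)⁻¹) i : ℝ) * Complex.I))).comp
      (ContinuousLinearMap.proj i)
  have hmn := (isOpen_chartSource (hP := hP) hp).mem_nhds hm
  have hc := (contMDiffAt_chartFun hp hm).mdifferentiableAt (by simp)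
  have hTc : MDifferentiableAt 𝓘(ℝ, Fin n → ℂ) 𝓘(ℝ, Fin n → ℂ) (T ∘ chartFun hP hp) m :=
    MDifferentiableAt.comp m T.differentiableAt.mdifferentiableAt hc
  have htar : T (chartFun hP hp m) ∈ (chartHomeo hP hp).target := by
    have := (chartHomeo hP hp).map_source (vadd_mem_chartSource t hm)
    have h2 : chartHomeo hP hp (t +ᵥ m) = T (chartFun hP hp m) := chartFun_vadd hp s hm
    rwa [h2] at this
  have hpt : (fun m' => t +ᵥ m') =ᶠ[𝓝 m]
      fun m' => (chartHomeo hP hp).symm ((T ∘ chartFun hP hp) m') := by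
    filter_upwards [hmn] with m' hm'
    have h := (chartHomeo hP hp).left_inv (vadd_mem_chartSource t hm')
    rw [← h]
    congr 1
    exact chartFun_vadd hp s hm'
  have hcomp : chartFun hP hp ∘ (fun m' => t +ᵥ m') =ᶠ[𝓝 m] T ∘ chartFun hP hp := by
    filter_upwards [hmn] with m' hm'
    exact chartFun_vadd hp s hm'
  have hd : MDifferentiableAt 𝓘(ℝ, Fin n → ℂ) 𝓘(ℝ, Fin n → ℂ)
      (fun m' : ToricManifold P Λ hP => t +ᵥ m') m := by
    refine MDifferentiableAt.congr_of_eventuallyEq ?_ hpt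
    exact MDifferentiableAt.comp m
      ((mdifferentiable_chartHomeo (hP := hP) hp).mdifferentiableAt_symm htar) hTc
  have hchain := mfderiv_comp m
    ((contMDiffAt_chartFun hp (vadd_mem_chartSource t hm)).mdifferentiableAt (by simp)) hd
  rw [hcomp.mfderiv_eq, mfderiv_comp m T.differentiableAt.mdifferentiableAt hc,
    mfderiv_eq_fderiv, T.fderiv] at hchain
  exact (DFunLike.congr_fun hchain v).symm

/-- A phase multiplies z_i and dz_i by the same unit complex number, so conj(z_i) dz_i and |z_i|,
the only ingredients of the coframe, do not change. -/
lemma coframe_vadd (t : Torus Λ) {m : ToricManifold P Λ hP} (hm : moment m ∈ P.openSet)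
    (v : TangentSpace 𝓘(ℝ, Fin n → ℂ) m) :
    coframe hP (t +ᵥ m) (mfderiv 𝓘(ℝ, Fin n → ℂ) 𝓘(ℝ, Fin n → ℂ)
        (fun m' : ToricManifold P Λ hP => t +ᵥ m') m v) = coframe hP m v := by
  obtain ⟨p, hp⟩ := exists_isVertex P
  have hms := mem_chartSource_of_openSet (p := p) hm
  induction t using QuotientAddGroup.induction_on with
  | H s =>
    rw [coframe_eq hp (by rwa [moment_vadd]), coframe_eq hp hm, diff_chartFun_vadd hp s hms,
      chartFun_vadd hp s hms]
    simp only [polarCoframe]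
    have h : ∀ (τ : ℝ) (a b : ℂ), starRingEnd ℂ (Complex.exp ((τ : ℂ) * Complex.I) * a) *
        (Complex.exp ((τ : ℂ) * Complex.I) * b) = starRingEnd ℂ a * b := by
      intro τ a b
      have he : starRingEnd ℂ (Complex.exp ((τ : ℂ) * Complex.I)) *
          Complex.exp ((τ : ℂ) * Complex.I) = 1 := by
        rw [← Complex.exp_conj, map_mul, Complex.conj_ofReal, Complex.conj_I, ← Complex.exp_add]
        simp
      rw [map_mul]
      linear_combination (starRingEnd ℂ a * b) * he
    simp only [h, norm_mul, Complex.norm_exp_ofReal_mul_I, one_mul]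

lemma metric_invariant (u : (Fin n → ℝ) → ℝ) : IsInvariantOn hP (metric hP u) (freeLocus hP) := by
  intro t m hm v w
  rw [freeLocus_eq] at hm
  rw [metric_apply, metric_apply, coframe_vadd t hm, coframe_vadd t hm, moment_vadd]

/-! ### The symplectic form is smooth and closed -/

lemma smoothOn_symplecticForm : SmoothOn (symplecticForm hP) (freeLocus hP) := by
  obtain ⟨p, hp⟩ := exists_isVertex P
  let re : Fin n → ((Fin n → ℂ) →L[ℝ] ℝ) := fun j =>
    Complex.reCLM.comp (ContinuousLinearMap.proj (R := ℝ) (φ := fun _ : Fin n => ℂ) j)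
  let im : Fin n → ((Fin n → ℂ) →L[ℝ] ℝ) := fun j =>
    Complex.imCLM.comp (ContinuousLinearMap.proj (R := ℝ) (φ := fun _ : Fin n => ℂ) j)
  refine smoothOn_of_pullback isOpen_freeLocus (f := chartFun hP hp)
    (β := fun _ => ∑ j, ((re j).smulRight (im j) - (im j).smulRight (re j)))
    ((contMDiffOn_chartFun hp).mono ?_) contMDiffOn_const ?_
  · intro m hm
    rw [freeLocus_eq] at hm
    exact mem_chartSource_of_openSet hm
  · intro m hm v w
    rw [freeLocus_eq] at hm
    rw [symplecticForm_eq_chart hp hm]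
    simp only [sum_apply, sub_apply, ContinuousLinearMap.smulRight_apply, smul_apply]
    rfl

lemma isClosedFormOn_symplecticForm : IsClosedFormOn (symplecticForm hP) (freeLocus hP) := by
  have hman : IsManifold 𝓘(ℝ, Fin n → ℂ) 1 (ToricManifold P Λ hP) := .of_le (n := ∞) (by simp)
  intro m hm a b c
  -- The preferred chart at m is kept fixed while the point moves. In it the form has the constant
  -- standard coefficients, so each of the three terms of the exterior derivative vanishes by
  -- itself.
  have key : ∀ v w : Fin n → ℂ, fderiv ℝ (fun y => inChart (symplecticForm hP) m y v w)
      (extChartAt 𝓘(ℝ, Fin n → ℂ) m m) = 0 := by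
    intro v w
    have hev : (fun y => inChart (symplecticForm hP) m y v w) =ᶠ[𝓝 (extChartAt 𝓘(ℝ, Fin n → ℂ) m m)]
        fun _ => ∑ j, ((v j).re * (w j).im - (v j).im * (w j).re) := by
      have h1 : ∀ᶠ y in 𝓝 (extChartAt 𝓘(ℝ, Fin n → ℂ) m m),
          (extChartAt 𝓘(ℝ, Fin n → ℂ) m).symm y ∈ freeLocus hP := by
        refine (continuousAt_extChartAt_symm m).eventually ?_
        rw [extChartAt_to_inv]
        exact isOpen_freeLocus.mem_nhds hm
      filter_upwards [h1, extChartAt_target_mem_nhds m] with y hy hyt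
      rw [freeLocus_eq] at hy
      have h2 := mfderiv_extChartAt_comp_mfderivWithin_extChartAt_symm hyt
      rw [modelWithCornersSelf_coe, Set.range_id, mfderivWithin_univ] at h2
      have h3 : ∀ v : Fin n → ℂ, diff n (chartFun hP (isVertex_vertexAt m))
          ((extChartAt 𝓘(ℝ, Fin n → ℂ) m).symm y)
          (mfderiv 𝓘(ℝ, Fin n → ℂ) 𝓘(ℝ, Fin n → ℂ) (extChartAt 𝓘(ℝ, Fin n → ℂ) m).symm y v) = v :=
        fun v => DFunLike.congr_fun h2 v
      rw [inChart, symplecticForm_eq_chart (isVertex_vertexAt m) hy, h3, h3]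
    rw [hev.fderiv_eq]
    simp
  rw [key, key, key]
  simp

end ActionAngle

/-! ### Hessians -/

section Hessian

variable {n : ℕ} {f : (Fin n → ℝ) → ℝ} {x : Fin n → ℝ}

lemma hess_apply (hf : ContDiffAt ℝ ∞ f x) (i j : Fin n) :
    hess f x i j = fderiv ℝ (fderiv ℝ f) x (Pi.single i 1) (Pi.single j 1) := by
  have h : DifferentiableAt ℝ (fderiv ℝ f) x :=
    (hf.fderiv_right (m := 1) (by norm_cast)).differentiableAt (by norm_num)
  have h2 := h.hasFDerivAt.clm_apply (hasFDerivAt_const (Pi.single j (1 : ℝ)) x)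
  simp only [hess, Matrix.of_apply]
  rw [h2.fderiv]
  simp

lemma hess_isSymm (hf : ContDiffAt ℝ ∞ f x) : (hess f x).IsSymm := by
  ext i j
  rw [Matrix.transpose_apply, hess_apply hf, hess_apply hf]
  exact (hf.isSymmSndFDerivAt (by
    simpa using WithTop.coe_le_coe.2 (le_top : (2 : ℕ∞) ≤ ⊤))).eq _ _

lemma dotProduct_hess_mulVec (hf : ContDiffAt ℝ ∞ f x) (v w : Fin n → ℝ) :
    v ⬝ᵥ hess f x *ᵥ w = fderiv ℝ (fderiv ℝ f) x v w := by
  conv_rhs => rw [pi_eq_sum_univ' v, pi_eq_sum_univ' w]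
  simp only [map_sum, map_smul, sum_apply, smul_apply, ← hess_apply hf, dotProduct, Matrix.mulVec,
    smul_eq_mul, Finset.mul_sum]
  rw [Finset.sum_comm]
  refine (Finset.sum_congr rfl fun i _ => Finset.sum_congr rfl fun j _ => ?_)
  ring

/-- Convexity of a potential is given as a condition on second derivatives along lines; this turns
it into a condition on the Hessian matrix. -/
lemma iteratedDeriv_two_line (hf : ContDiffAt ℝ ∞ f x) (v : Fin n → ℝ) :
    iteratedDeriv 2 (fun t : ℝ => f (x + t • v)) 0 = v ⬝ᵥ hess f x *ᵥ v := by
  have hline : ∀ t : ℝ, HasDerivAt (fun t : ℝ => x + t • v) v t := fun t => by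
    simpa using ((hasDerivAt_id t).smul_const v).const_add x
  have hx0 : x + (0 : ℝ) • v = x := by simp
  have hev : ∀ᶠ t : ℝ in 𝓝 0, ContDiffAt ℝ 1 f (x + t • v) := by
    have h1 : ∀ᶠ y in 𝓝 (x + (0 : ℝ) • v), ContDiffAt ℝ 1 f y := by
      rw [hx0]
      exact (hf.of_le (m := 1) (by norm_cast)).eventually (by simp)
    exact (hline 0).continuousAt.eventually h1
  have h1 : deriv (fun t : ℝ => f (x + t • v)) =ᶠ[𝓝 0] fun t => fderiv ℝ f (x + t • v) v := by
    filter_upwards [hev] with t ht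
    exact ((ht.differentiableAt (by norm_num)).hasFDerivAt.comp_hasDerivAt t (hline t)).deriv
  rw [iteratedDeriv_succ, iteratedDeriv_one, h1.deriv_eq, dotProduct_hess_mulVec hf]
  have h : DifferentiableAt ℝ (fderiv ℝ f) (x + (0 : ℝ) • v) := by
    rw [hx0]
    exact (hf.fderiv_right (m := 1) (by norm_cast)).differentiableAt (by norm_num)
  have h2 : HasDerivAt (fun t : ℝ => fderiv ℝ f (x + t • v))
      (fderiv ℝ (fderiv ℝ f) (x + (0 : ℝ) • v) v)
      0 := h.hasFDerivAt.comp_hasDerivAt 0 (hline 0)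
  have h3 : HasDerivAt (fun t : ℝ => fderiv ℝ f (x + t • v) v)
      (fderiv ℝ (fderiv ℝ f) (x + (0 : ℝ) • v) v v) 0 :=
    (ContinuousLinearMap.apply ℝ ℝ v).hasFDerivAt.comp_hasDerivAt 0 h2
  rw [h3.deriv, hx0]

lemma hess_add {g : (Fin n → ℝ) → ℝ} (hf : ContDiffAt ℝ ∞ f x) (hg : ContDiffAt ℝ ∞ g x) :
    hess (fun y => f y + g y) x = hess f x + hess g x := by
  ext i j
  have hf' : DifferentiableAt ℝ (fderiv ℝ f) x :=
    (hf.fderiv_right (m := 1) (by norm_cast)).differentiableAt (by norm_num)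
  have hg' : DifferentiableAt ℝ (fderiv ℝ g) x :=
    (hg.fderiv_right (m := 1) (by norm_cast)).differentiableAt (by norm_num)
  have hev : fderiv ℝ (fun y => f y + g y) =ᶠ[𝓝 x] fun y => fderiv ℝ f y + fderiv ℝ g y := by
    filter_upwards [(hf.of_le (m := 1) (by norm_cast)).eventually (by simp),
      (hg.of_le (m := 1) (by norm_cast)).eventually (by simp)] with y h1 h2
    exact fderiv_fun_add (h1.differentiableAt (by norm_num)) (h2.differentiableAt (by norm_num))
  rw [Matrix.add_apply, hess_apply (hf.add hg), hess_apply hf, hess_apply hg, hev.fderiv_eq,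
    fderiv_fun_add hf' hg']
  rfl

lemma hess_congr {g : (Fin n → ℝ) → ℝ} (h : f =ᶠ[𝓝 x] g) : hess f x = hess g x := by
  ext i j
  have h1 : (fun y => fderiv ℝ f y (Pi.single j 1)) =ᶠ[𝓝 x]
      fun y => fderiv ℝ g y (Pi.single j 1) := by
    filter_upwards [h.fderiv (𝕜 := ℝ)] with y hy
    rw [hy]
  simp only [hess, Matrix.of_apply, h1.fderiv_eq]

lemma contDiffOn_fderiv_apply {W : Set (Fin n → ℝ)} (hW : IsOpen W) (hf : ContDiffOn ℝ ∞ f W)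
    (v : Fin n → ℝ) : ContDiffOn ℝ ∞ (fun y => fderiv ℝ f y v) W :=
  (hf.fderiv_of_isOpen hW (by simp)).clm_apply contDiffOn_const

lemma contDiffOn_hess {W : Set (Fin n → ℝ)} (hW : IsOpen W) (hf : ContDiffOn ℝ ∞ f W)
    (i j : Fin n) : ContDiffOn ℝ ∞ (fun y => hess f y i j) W :=
  contDiffOn_fderiv_apply hW (contDiffOn_fderiv_apply hW hf _) _

end Hessian

/-! ### Symplectic potentials over the interior and near a facet -/

section Potential

variable {n d : ℕ} {P Q : LabelledPolytope n d}

lemma contDiffAt_mul_log (k : Fin d) {x : Fin n → ℝ} (hx : 0 < P.L k x) :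
    ContDiffAt ℝ ∞ (fun y => 1 / 2 * (P.L k y * Real.log (P.L k y))) x :=
  contDiffAt_const.mul ((contDiff_L k).contDiffAt.mul ((contDiff_L k).contDiffAt.log hx.ne'))

/-- The gradient of ½ L log L is ½ (log L + 1) times the normal, and differentiating the logarithm
once more gives the factor 1/(2L). -/
lemma hess_mul_log (k : Fin d) {x : Fin n → ℝ} (hx : 0 < P.L k x) :
    hess (fun y => 1 / 2 * (P.L k y * Real.log (P.L k y))) x =
      (1 / (2 * P.L k x)) • Matrix.vecMulVec (P.normal k) (P.normal k) := by
  have hL : ∀ y w, HasDerivAt (fun t : ℝ => P.L k (y + t • w)) (w ⬝ᵥ P.normal k) 0 := by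
    intro y w
    have : (fun t : ℝ => P.L k (y + t • w)) = fun t => P.L k y + t * (w ⬝ᵥ P.normal k) := by
      ext t; rw [L_add, smul_dotProduct, smul_eq_mul]
    rw [this]
    simpa using ((hasDerivAt_id (0 : ℝ)).mul_const (w ⬝ᵥ P.normal k)).const_add (P.L k y)
  have hdir : ∀ {g : (Fin n → ℝ) → ℝ} {y w : Fin n → ℝ} {c : ℝ}, DifferentiableAt ℝ g y →
      HasDerivAt (fun t : ℝ => g (y + t • w)) c 0 → fderiv ℝ g y w = c := by
    intro g y w c hg hc
    rw [← hg.lineDeriv_eq_fderiv]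
    exact hc.deriv
  have hev : ∀ᶠ y in 𝓝 x, 0 < P.L k y := (continuous_L k).continuousAt.eventually (lt_mem_nhds hx)
  have h1 : ∀ w, ∀ᶠ y in 𝓝 x, fderiv ℝ (fun y => 1 / 2 * (P.L k y * Real.log (P.L k y))) y w =
      1 / 2 * (Real.log (P.L k y) + 1) * (w ⬝ᵥ P.normal k) := by
    intro w
    filter_upwards [hev] with y hy
    refine hdir ((contDiffAt_mul_log k hy).differentiableAt (by simp)) ?_
    refine (((hL y w).mul ((hL y w).log (by simpa using hy.ne'))).const_mul (1 / 2)).congr_deriv ?_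
    simp only [zero_smul, add_zero]
    field_simp
  ext i j
  simp only [hess, Matrix.of_apply]
  have h2 := Filter.EventuallyEq.fderiv_eq (𝕜 := ℝ) (h1 (Pi.single j 1))
  rw [h2]
  refine hdir ?_ ?_
  · have : DifferentiableAt ℝ (fun y => Real.log (P.L k y)) x :=
      ((contDiff_L k).contDiffAt.log hx.ne').differentiableAt (n := ∞) (by simp)
    fun_prop
  · refine (((((hL x (Pi.single i 1)).log (by simpa using hx.ne')).add_const 1).const_mul
      (1 / 2)).mul_const _).congr_deriv ?_
    simp only [zero_smul, add_zero, Matrix.smul_apply, Matrix.vecMulVec_apply, smul_eq_mul,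
      single_dotProduct, one_mul]
    field_simp

/-- The labels of a polytope are determined up to positive factors. -/
lemma LabelledPolytope.SamePolytope.exists_scale (h : P.SamePolytope Q) (k : Fin d) :
    ∃ c : ℝ, 0 < c ∧ Q.normal k = c • P.normal k ∧ ∀ x, Q.L k x = c * P.L k x := by
  obtain ⟨x₀, h0, hpos⟩ := P.facet' k
  obtain ⟨x₁, hx₁⟩ := P.nonempty'
  have h0' : P.L k x₀ = 0 := h0
  have hmem : ∀ y, P.L k y = 0 → (∀ j, j ≠ k → 0 < P.L j y) → Q.L k y = 0 := by
    intro y h1 h2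
    have : y ∈ P.facet k := by
      refine ⟨fun j => ?_, h1⟩
      by_cases hj : j = k
      · rw [hj, h1]
      · exact (h2 j hj).le
    rw [← h.facet_eq] at this
    exact this.2
  have hQ0 : Q.L k x₀ = 0 := hmem x₀ h0 hpos
  -- A small step from x₀ in a direction tangent to F_k stays in the relative interior of F_k, where
  -- the defining function of Q vanishes too.
  have hQ : ∀ v, v ⬝ᵥ P.normal k = 0 → v ⬝ᵥ Q.normal k = 0 := by
    intro v hv
    have hev : ∀ᶠ t : ℝ in 𝓝 0, ∀ j, j ≠ k → 0 < P.L j (x₀ + t • v) := by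
      rw [Filter.eventually_all]
      intro j
      by_cases hj : j = k
      · simp [hj]
      · have hc : Continuous fun t : ℝ => P.L j (x₀ + t • v) := (continuous_L j).comp (by fun_prop)
        have : ∀ᶠ t : ℝ in 𝓝 0, 0 < P.L j (x₀ + t • v) :=
          hc.continuousAt.eventually (lt_mem_nhds (by simpa [L] using hpos j hj))
        exact this.mono fun t ht _ => ht
    obtain ⟨ε, hε, hball⟩ := Metric.eventually_nhds_iff.1 hev
    have h1 := hmem (x₀ + (ε / 2) • v) (by rw [L_add, h0', smul_dotProduct, hv]; simp)
      (hball (by simp [abs_of_pos hε]; linarith))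
    rw [L_add, hQ0, smul_dotProduct, zero_add, smul_eq_mul] at h1
    rcases mul_eq_zero.1 h1 with h2 | h2
    · linarith
    · exact h2
  have hη := normal_ne_zero P k
  set η := P.normal k
  have hηη : η ⬝ᵥ η ≠ 0 := fun h => hη (dotProduct_self_eq_zero.1 h)
  -- The scalar c η is the orthogonal projection of the normal of Q onto η. The remainder is
  -- orthogonal to η, hence by `hQ` to the normal of Q, hence to itself.
  let c := (η ⬝ᵥ Q.normal k) / (η ⬝ᵥ η)
  have hc : Q.normal k = c • η := by
    have horth : (Q.normal k - c • η) ⬝ᵥ η = 0 := by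
      rw [sub_dotProduct, smul_dotProduct, smul_eq_mul, div_mul_cancel₀ _ hηη, dotProduct_comm,
        sub_self]
    have h1 := hQ _ horth
    have h2 : (Q.normal k - c • η) ⬝ᵥ (Q.normal k - c • η) = 0 := by
      rw [dotProduct_sub, h1, dotProduct_smul, horth]; simp
    exact sub_eq_zero.1 (dotProduct_self_eq_zero.1 h2)
  have hL : ∀ x, Q.L k x = c * P.L k x := by
    intro x
    have e1 : x = x₀ + (x - x₀) := by abel
    rw [e1, L_add, L_add, hQ0, h0', hc, dotProduct_smul, smul_eq_mul]
    ring
  refine ⟨c, ?_, hc, hL⟩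
  have h1 : 0 < P.L k x₁ := hx₁ k
  have h2 : 0 < Q.L k x₁ := by
    have : x₁ ∈ P.openSet := hx₁
    rw [← h.openSet_eq] at this
    exact this k
  rw [hL] at h2
  exact (pos_iff_pos_of_mul_pos h2).2 h1

/-- Near the interior of the facet `F_k`, a symplectic potential is the sum of the singular term
of `F_k` and a smooth function. -/
lemma LabelledPolytope.IsSymplecticPotential.exists_regular_part {u : (Fin n → ℝ) → ℝ}
    (hu : P.IsSymplecticPotential u) (k : Fin d) :
    ∃ (W : Set (Fin n → ℝ)) (f : (Fin n → ℝ) → ℝ), IsOpen W ∧ ContDiffOn ℝ ∞ f W ∧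
      (∀ x ∈ P.closedSet, (∀ j, j ≠ k → 0 < P.L j x) → x ∈ W) ∧
      ∀ x ∈ P.closedSet, u x = 1 / 2 * (P.L k x * Real.log (P.L k x)) + f x := by
  obtain ⟨U, f, hU, hPU, hf, huf⟩ := hu.boundary
  refine ⟨U ∩ ⋂ j, {x | j ≠ k → 0 < P.L j x},
    -- The logarithmic terms of the other facets are smooth where L_j > 0, so they join the regular
    -- part.
    fun x => ∑ j ∈ Finset.univ.erase k, 1 / 2 * (P.L j x * Real.log (P.L j x)) + f x,
    ?_, ?_, ?_, ?_⟩
  · refine hU.inter (isOpen_iInter_of_finite fun j => ?_)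
    by_cases hj : j = k
    · simp [hj]
    · simp only [ne_eq, hj, not_false_eq_true, forall_const]
      exact isOpen_lt continuous_const (continuous_L j)
  · refine ContDiffOn.add (ContDiffOn.sum fun j hj => ?_) (hf.mono Set.inter_subset_left)
    intro x hx
    have := Set.mem_iInter.1 hx.2 j (Finset.ne_of_mem_erase hj)
    exact (contDiffAt_mul_log j this).contDiffWithinAt
  · exact fun x hx h => ⟨hPU hx, Set.mem_iInter.2 h⟩
  · intro x hx
    beta_reduce
    rw [← huf x hx, guillemin, Finset.mul_sum, ← Finset.add_sum_erase _ _ (Finset.mem_univ k)]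
    ring

lemma faceInterior_empty : P.faceInterior ∅ = P.openSet := by
  ext x
  constructor
  · rintro ⟨h1, h2⟩ k
    refine lt_of_le_of_ne (h1 k) fun h => ?_
    have : k ∈ P.active x := mem_active.2 h.symm
    rw [h2] at this
    simp at this
  · exact fun h => ⟨closedSet_of_openSet h, active_eq_empty h⟩

lemma LabelledPolytope.IsSymplecticPotential.contDiffOn {u : (Fin n → ℝ) → ℝ}
    (hu : P.IsSymplecticPotential u) : ContDiffOn ℝ ∞ u P.openSet := by
  have := hu.smooth_face ∅
  rwa [faceInterior_empty] at this

lemma LabelledPolytope.IsSymplecticPotential.contDiffAt {u : (Fin n → ℝ) → ℝ}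
    (hu : P.IsSymplecticPotential u) {x : Fin n → ℝ} (hx : x ∈ P.openSet) : ContDiffAt ℝ ∞ u x :=
  hu.contDiffOn.contDiffAt (isOpen_openSet.mem_nhds hx)

lemma LabelledPolytope.IsSymplecticPotential.posDef {u : (Fin n → ℝ) → ℝ}
    (hu : P.IsSymplecticPotential u) {x : Fin n → ℝ} (hx : x ∈ P.openSet) {v : Fin n → ℝ}
    (hv : v ≠ 0) : 0 < v ⬝ᵥ hess u x *ᵥ v := by
  rw [← iteratedDeriv_two_line (hu.contDiffAt hx)]
  exact hu.convex_face ∅ x (by rwa [faceInterior_empty]) v hv (by simp)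

/-- On the interior of a facet, the regular part of a symplectic potential is strictly convex in the
directions of the facet. -/
lemma LabelledPolytope.IsSymplecticPotential.posDef_facet {u f : (Fin n → ℝ) → ℝ}
    (hu : P.IsSymplecticPotential u) {k : Fin d}
    (huf : ∀ x ∈ P.closedSet, u x = 1 / 2 * (P.L k x * Real.log (P.L k x)) + f x)
    {x : Fin n → ℝ} (hx : x ∈ P.facetInterior k) (hf : ContDiffAt ℝ ∞ f x) {v : Fin n → ℝ}
    (hv : v ≠ 0) (hvk : v ⬝ᵥ P.normal k = 0) : 0 < v ⬝ᵥ hess f x *ᵥ v := by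
  have hact : P.active x = {k} := by
    ext j
    rw [mem_active, Finset.mem_singleton]
    refine ⟨fun h => ?_, fun h => h ▸ hx.1⟩
    by_contra hj
    exact (hx.2 j hj).ne' h
  have hcl : x ∈ P.closedSet := by
    intro j
    by_cases hj : j = k
    · rw [hj, hx.1]
    · exact (hx.2 j hj).le
  have h1 := hu.convex_face {k} x ⟨hcl, hact⟩ v hv (by simpa using hvk)
  rw [← iteratedDeriv_two_line hf]
  have hk : ∀ t : ℝ, P.L k (x + t • v) = 0 := fun t => by
    rw [L_add, hx.1, smul_dotProduct, hvk]; simp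
  have hev : (fun t : ℝ => u (x + t • v)) =ᶠ[𝓝 0] fun t => f (x + t • v) := by
    have : ∀ᶠ t : ℝ in 𝓝 0, ∀ j, 0 ≤ P.L j (x + t • v) := by
      rw [Filter.eventually_all]
      intro j
      by_cases hj : j = k
      · exact Filter.Eventually.of_forall fun t => by rw [hj, hk]
      · have hc : Continuous fun t : ℝ => P.L j (x + t • v) := (continuous_L j).comp (by fun_prop)
        have : ∀ᶠ t : ℝ in 𝓝 0, 0 < P.L j (x + t • v) :=
          hc.continuousAt.eventually (lt_mem_nhds (by simpa using hx.2 j hj))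
        exact this.mono fun t ht => ht.le
    filter_upwards [this] with t ht
    -- On the facet the singular term is 0 · log 0, which is 0.
    rw [huf _ ht, hk]; simp
  rwa [← hev.iteratedDeriv_eq]

end Potential

/-! ### Smooth dependence of determinants and inverse matrices -/

section MatrixInverse

variable {E : Type*} [NormedAddCommGroup E] [NormedSpace ℝ E] {n : ℕ}

lemma contDiffOn_det {A : E → Matrix (Fin n) (Fin n) ℝ} {T : Set E}
    (hA : ∀ i j, ContDiffOn ℝ ∞ (fun x => A x i j) T) : ContDiffOn ℝ ∞ (fun x => (A x).det) T := by
  simp only [Matrix.det_apply']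
  exact ContDiffOn.sum fun σ _ => contDiffOn_const.mul (contDiffOn_prod fun i _ => hA _ _)

/-- Cramer's rule: each entry is the quotient of a minor, again a determinant of smooth entries, by
the nonvanishing determinant. -/
lemma contDiffOn_matrix_inv {A : E → Matrix (Fin n) (Fin n) ℝ} {T : Set E}
    (hA : ∀ i j, ContDiffOn ℝ ∞ (fun x => A x i j) T) (h : ∀ x ∈ T, (A x).det ≠ 0) (i j : Fin n) :
    ContDiffOn ℝ ∞ (fun x => (A x)⁻¹ i j) T := by
  simp only [Matrix.inv_def, Matrix.smul_apply, smul_eq_mul, Ring.inverse_eq_inv',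
    Matrix.adjugate_apply]
  refine ((contDiffOn_det hA).inv h).mul (contDiffOn_det fun k l => ?_)
  simp only [Matrix.updateRow_apply]
  by_cases hk : k = j
  · simp only [hk, if_true]; exact contDiffOn_const
  · simp only [hk, if_false]; exact hA k l

lemma contDiffOn_matrix_mul {A B : E → Matrix (Fin n) (Fin n) ℝ} {T : Set E}
    (hA : ∀ i j, ContDiffOn ℝ ∞ (fun x => A x i j) T)
    (hB : ∀ i j, ContDiffOn ℝ ∞ (fun x => B x i j) T) (i j : Fin n) :
    ContDiffOn ℝ ∞ (fun x => (A x * B x) i j) T := by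
  simp only [Matrix.mul_apply]
  exact ContDiffOn.sum fun k _ => (hA i k).mul (hB k j)

end MatrixInverse

/-! ### The metric in terms of ½ d|z_j|² and |z_j|² d(arg z_j) -/

section Polar

variable {n d : ℕ} {P : LabelledPolytope n d} {Λ : Submodule ℤ (Fin n → ℝ)} {hP : P.IsDelzant Λ}
  {p : Fin n → ℝ} (hp : P.IsVertex p)

/-- The one-forms `½ d|z_j|²` in the coordinates at a vertex. -/
def polarRe (m : ToricManifold P Λ hP) (v : TangentSpace 𝓘(ℝ, Fin n → ℂ) m) (j : Fin n) : ℝ :=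
  (starRingEnd ℂ (chartFun hP hp m j) * diff n (chartFun hP hp) m v j).re

/-- The one-forms `|z_j|² d(arg z_j)` in the coordinates at a vertex. -/
def polarIm (m : ToricManifold P Λ hP) (v : TangentSpace 𝓘(ℝ, Fin n → ℂ) m) (j : Fin n) : ℝ :=
  (starRingEnd ℂ (chartFun hP hp m j) * diff n (chartFun hP hp) m v j).im

lemma contMDiffOn_chartFun_apply (j : Fin n) : ContMDiffOn 𝓘(ℝ, Fin n → ℂ) 𝓘(ℝ, ℂ) ∞
    (fun m => chartFun hP hp m j) (chartSource hP p) :=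
  (contDiff_apply ℝ ℂ j).contMDiff.comp_contMDiffOn (contMDiffOn_chartFun hp)

lemma diff_chartFun_apply {m : ToricManifold P Λ hP} (hm : m ∈ chartSource hP p)
    (v : TangentSpace 𝓘(ℝ, Fin n → ℂ) m) (j : Fin n) :
    diff n (fun m => chartFun hP hp m j) m v = diff n (chartFun hP hp) m v j := by
  have h1 := (contMDiffAt_chartFun hp hm).mdifferentiableAt (by simp)
  let T : (Fin n → ℂ) →L[ℝ] ℂ := ContinuousLinearMap.proj j
  have h := mfderiv_comp m T.differentiableAt.mdifferentiableAt h1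
  rw [mfderiv_eq_fderiv, T.fderiv] at h
  exact DFunLike.congr_fun h v

/-- Tensor fields with smooth coefficients in terms of the forms `½ d|z_j|²` and
`|z_j|² d(arg z_j)` are smooth. -/
lemma smoothOn_of_polar {U : Set (ToricManifold P Λ hP)} (hU : IsOpen U)
    (hUp : U ⊆ chartSource hP p) {T : Set (Fin n → ℝ)} (hT : ∀ m ∈ U, moment m ∈ T)
    {A C : (Fin n → ℝ) → Matrix (Fin n) (Fin n) ℝ}
    (hA : ∀ j l, ContDiffOn ℝ ∞ (fun x => A x j l) T)
    (hC : ∀ j l, ContDiffOn ℝ ∞ (fun x => C x j l) T) {g : Tensor2 n (ToricManifold P Λ hP)}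
    (hg : ∀ m ∈ U, ∀ v w, g m v w =
      polarRe hp m v ⬝ᵥ A (moment m) *ᵥ polarRe hp m w +
      polarIm hp m v ⬝ᵥ C (moment m) *ᵥ polarIm hp m w) : SmoothOn g U := by
  let re : ToricManifold P Λ hP → Fin n → ((Fin n → ℂ) →L[ℝ] ℝ) := fun m j =>
    (Complex.reCLM.comp (ContinuousLinearMap.mul ℝ ℂ (starRingEnd ℂ (chartFun hP hp m j)))).comp
      (ContinuousLinearMap.proj (R := ℝ) (φ := fun _ : Fin n => ℂ) j)
  let im : ToricManifold P Λ hP → Fin n → ((Fin n → ℂ) →L[ℝ] ℝ) := fun m j =>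
    (Complex.imCLM.comp (ContinuousLinearMap.mul ℝ ℂ (starRingEnd ℂ (chartFun hP hp m j)))).comp
      (ContinuousLinearMap.proj (R := ℝ) (φ := fun _ : Fin n => ℂ) j)
  let β : ToricManifold P Λ hP → (Fin n → ℂ) →L[ℝ] (Fin n → ℂ) →L[ℝ] ℝ := fun m =>
    ∑ j, ∑ l, (A (moment m) j l • (re m j).smulRight (re m l) +
      C (moment m) j l • (im m j).smulRight (im m l))
  have hβ : ∀ m ζ ζ', β m ζ ζ' = ∑ j, ∑ l,
      (A (moment m) j l * ((starRingEnd ℂ (chartFun hP hp m j) * ζ j).re *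
        (starRingEnd ℂ (chartFun hP hp m l) * ζ' l).re) +
      C (moment m) j l * ((starRingEnd ℂ (chartFun hP hp m j) * ζ j).im *
        (starRingEnd ℂ (chartFun hP hp m l) * ζ' l).im)) := by
    intro m ζ ζ'
    simp only [β, sum_apply, add_apply, smul_apply, ContinuousLinearMap.smulRight_apply,
      smul_eq_mul]
    rfl
  refine smoothOn_of_pullback hU ((contMDiffOn_chartFun hp).mono hUp) (β := β) ?_ ?_
  · intro m₀ hm₀
    have hn := hU.mem_nhds hm₀
    refine ContMDiffAt.contMDiffWithinAt ?_
    refine contMDiffAt_of_clm_apply fun ζ => contMDiffAt_of_clm_apply fun ζ' => ?_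
    simp only [hβ]
    have hz : ∀ (ζ : Fin n → ℂ) j, ContMDiffAt 𝓘(ℝ, Fin n → ℂ) 𝓘(ℝ, ℂ) ∞
        (fun m => starRingEnd ℂ (chartFun hP hp m j) * ζ j) m₀ := by
      intro ζ j
      have h1 := (contMDiffOn_chartFun_apply (hP := hP) hp j).contMDiffAt
        ((isOpen_chartSource hp).mem_nhds (hUp hm₀))
      exact ((((ContinuousLinearMap.mul ℝ ℂ).flip (ζ j)).comp
        (Complex.conjCLE : ℂ →L[ℝ] ℂ)).contMDiff).contMDiffAt.comp m₀ h1
    have hre : ∀ (ζ : Fin n → ℂ) j, ContMDiffAt 𝓘(ℝ, Fin n → ℂ) 𝓘(ℝ, ℝ) ∞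
        (fun m => (starRingEnd ℂ (chartFun hP hp m j) * ζ j).re) m₀ := fun ζ j =>
      Complex.reCLM.contMDiff.contMDiffAt.comp m₀ (hz ζ j)
    have him : ∀ (ζ : Fin n → ℂ) j, ContMDiffAt 𝓘(ℝ, Fin n → ℂ) 𝓘(ℝ, ℝ) ∞
        (fun m => (starRingEnd ℂ (chartFun hP hp m j) * ζ j).im) m₀ := fun ζ j =>
      Complex.imCLM.contMDiff.contMDiffAt.comp m₀ (hz ζ j)
    have hmat : ∀ {A : (Fin n → ℝ) → Matrix (Fin n) (Fin n) ℝ},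
        (∀ j l, ContDiffOn ℝ ∞ (fun x => A x j l) T) → ∀ j l,
        ContMDiffAt 𝓘(ℝ, Fin n → ℂ) 𝓘(ℝ, ℝ) ∞
          (fun m : ToricManifold P Λ hP => A (moment m) j l) m₀ := by
      intro A hA j l
      exact (ContMDiffOn.comp (hA j l).contMDiffOn contMDiff_moment.contMDiffOn hT).contMDiffAt hn
    exact contMDiffAt_finsetSum fun j _ => contMDiffAt_finsetSum fun l _ =>
      ((hmat hA j l).mul ((hre ζ j).mul (hre ζ' l))).add
        ((hmat hC j l).mul ((him ζ j).mul (him ζ' l)))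
  · intro m hm v w
    rw [hg m hm, hβ]
    simp only [dotProduct, Matrix.mulVec, Finset.mul_sum, ← Finset.sum_add_distrib]
    refine Finset.sum_congr rfl fun j _ => Finset.sum_congr rfl fun l _ => ?_
    simp only [polarRe, polarIm]
    ring

lemma coframe_fst {m : ToricManifold P Λ hP} (hm : moment m ∈ P.openSet)
    (v : TangentSpace 𝓘(ℝ, Fin n → ℂ) m) :
    (coframe hP m v).1 = (vertexMat hp)⁻¹ *ᵥ polarRe hp m v := by
  rw [coframe_eq hp hm]; rfl

lemma coframe_snd {m : ToricManifold P Λ hP} (hm : moment m ∈ P.openSet)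
    (v : TangentSpace 𝓘(ℝ, Fin n → ℂ) m) :
    (coframe hP m v).2 =
      (fun j => polarIm hp m v j / (2 * P.L (vertexIdx hp j) (moment m))) ᵥ* vertexMat hp := by
  rw [coframe_eq hp hm, polarCoframe]
  simp only [L_moment_eq hp (mem_chartSource_of_openSet hm)]
  congr 1
  ext j
  rw [polarIm]
  congr 1
  ring

/-- The Hessian in the coordinates `L_k` at a vertex. -/
def vertexHess (u : (Fin n → ℝ) → ℝ) (x : Fin n → ℝ) : Matrix (Fin n) (Fin n) ℝ :=
  ((vertexMat hp)⁻¹)ᵀ * hess u x * (vertexMat hp)⁻¹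

lemma dotProduct_vertexHess_mulVec (u : (Fin n → ℝ) → ℝ) (x a b : Fin n → ℝ) :
    a ⬝ᵥ vertexHess hp u x *ᵥ b =
      ((vertexMat hp)⁻¹ *ᵥ a) ⬝ᵥ hess u x *ᵥ ((vertexMat hp)⁻¹ *ᵥ b) := by
  rw [vertexHess, ← Matrix.mulVec_mulVec, ← Matrix.mulVec_mulVec, Matrix.dotProduct_mulVec,
    Matrix.vecMul_transpose]

lemma vertexHess_inv (u : (Fin n → ℝ) → ℝ) (x : Fin n → ℝ) :
    (vertexHess hp u x)⁻¹ = vertexMat hp * (hess u x)⁻¹ * (vertexMat hp)ᵀ := by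
  rw [vertexHess, Matrix.mul_inv_rev, Matrix.mul_inv_rev, ← Matrix.transpose_nonsing_inv,
    Matrix.nonsing_inv_nonsing_inv _ (isUnit_det_vertexMat hp), Matrix.mul_assoc]

/-- The change of basis that takes the normals at the vertex to the standard basis acts on the
Hessian by congruence and on its inverse by the inverse congruence. Only the divisors 2 L_j = |z_j|²
of the angular forms, and possible poles of the Hessian, remain singular. -/
lemma metric_eq_polar (u : (Fin n → ℝ) → ℝ) {m : ToricManifold P Λ hP} (hm : moment m ∈ P.openSet)
    (v w : TangentSpace 𝓘(ℝ, Fin n → ℂ) m) :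
    metric hP u m v w = polarRe hp m v ⬝ᵥ vertexHess hp u (moment m) *ᵥ polarRe hp m w +
      (fun j => polarIm hp m v j / (2 * P.L (vertexIdx hp j) (moment m))) ⬝ᵥ
        (vertexHess hp u (moment m))⁻¹ *ᵥ
      (fun j => polarIm hp m w j / (2 * P.L (vertexIdx hp j) (moment m))) := by
  rw [metric_apply, coframe_fst hp hm, coframe_fst hp hm, coframe_snd hp hm, coframe_snd hp hm,
    dotProduct_vertexHess_mulVec, vertexHess_inv]
  congr 1
  rw [← Matrix.mulVec_mulVec, ← Matrix.mulVec_mulVec, Matrix.mulVec_transpose,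
    ← Matrix.dotProduct_mulVec]

lemma contDiffOn_vertexHess {f : (Fin n → ℝ) → ℝ} {W : Set (Fin n → ℝ)} (hW : IsOpen W)
    (hf : ContDiffOn ℝ ∞ f W) (i j : Fin n) :
    ContDiffOn ℝ ∞ (fun x => vertexHess hp f x i j) W := by
  have hc : ∀ (B : Matrix (Fin n) (Fin n) ℝ) i j, ContDiffOn ℝ ∞ (fun _ => B i j) W :=
    fun _ _ _ => contDiffOn_const
  have h1 := contDiffOn_matrix_mul (hc ((vertexMat hp)⁻¹)ᵀ) (contDiffOn_hess hW hf)
  exact contDiffOn_matrix_mul h1 (hc (vertexMat hp)⁻¹) i j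

lemma det_ne_zero_of_pos {A : Matrix (Fin n) (Fin n) ℝ} (h : ∀ v, v ≠ 0 → 0 < v ⬝ᵥ A *ᵥ v) :
    A.det ≠ 0 := by
  intro h0
  obtain ⟨v, hv, hv0⟩ := Matrix.exists_mulVec_eq_zero_iff.2 h0
  have := h v hv
  rw [hv0] at this
  simp at this

/-- With w = A⁻¹ v the form becomes w · A w. -/
lemma inv_pos_of_pos {A : Matrix (Fin n) (Fin n) ℝ} (h : ∀ v, v ≠ 0 → 0 < v ⬝ᵥ A *ᵥ v)
    {v : Fin n → ℝ} (hv : v ≠ 0) : 0 < v ⬝ᵥ A⁻¹ *ᵥ v := by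
  have hd : IsUnit A.det := isUnit_iff_ne_zero.2 (det_ne_zero_of_pos h)
  have e : A *ᵥ (A⁻¹ *ᵥ v) = v := by
    rw [Matrix.mulVec_mulVec, Matrix.mul_nonsing_inv _ hd, Matrix.one_mulVec]
  have h1 : A⁻¹ *ᵥ v ≠ 0 := by
    intro h0
    rw [h0, Matrix.mulVec_zero] at e
    exact hv e.symm
  have := h _ h1
  rwa [e, dotProduct_comm] at this

end Polar

/-! ### Smoothness and positivity of the metric over the open polytope -/

section Kahler

variable {n d : ℕ} {P : LabelledPolytope n d} {Λ : Submodule ℤ (Fin n → ℝ)} {hP : P.IsDelzant Λ}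
  {p : Fin n → ℝ} (hp : P.IsVertex p) {u : (Fin n → ℝ) → ℝ}

lemma mul_dotProduct_mulVec_mul (M : Matrix (Fin n) (Fin n) ℝ) (s a b : Fin n → ℝ) :
    (fun j => a j * s j) ⬝ᵥ M *ᵥ (fun j => b j * s j) =
      a ⬝ᵥ (Matrix.of fun j l => M j l * s j * s l) *ᵥ b := by
  simp only [dotProduct, Matrix.mulVec, Finset.mul_sum, Matrix.of_apply]
  refine Finset.sum_congr rfl fun j _ => Finset.sum_congr rfl fun l _ => ?_
  ring

lemma vertexHess_pos (hpos : ∀ x ∈ P.openSet, ∀ v, v ≠ 0 → 0 < v ⬝ᵥ hess u x *ᵥ v)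
    {x : Fin n → ℝ} (hx : x ∈ P.openSet) {v : Fin n → ℝ} (hv : v ≠ 0) :
    0 < v ⬝ᵥ vertexHess hp u x *ᵥ v := by
  rw [dotProduct_vertexHess_mulVec]
  refine hpos x hx _ fun h => hv ?_
  have := congrArg (fun y => vertexMat hp *ᵥ y) h
  simpa [Matrix.mulVec_mulVec, vertexMat_mul_inv] using this

/-- Over the open polytope every 1/(2 L_j) is smooth and can be absorbed into the coefficients of
the angular forms. A single vertex chart covers the whole free locus. -/
lemma smoothOn_metric (hu : ContDiffOn ℝ ∞ u P.openSet)
    (hpos : ∀ x ∈ P.openSet, ∀ v, v ≠ 0 → 0 < v ⬝ᵥ hess u x *ᵥ v) :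
    SmoothOn (metric hP u) (freeLocus hP) := by
  obtain ⟨p, hp⟩ := exists_isVertex P
  have hmem : ∀ m ∈ freeLocus hP, moment m ∈ P.openSet := fun m hm => by
    rwa [freeLocus_eq] at hm
  have hs : ∀ j, ContDiffOn ℝ ∞ (fun x => (2 * P.L (vertexIdx hp j) x)⁻¹) P.openSet := fun j =>
    (contDiffOn_const.mul (contDiff_L _).contDiffOn).inv fun x hx =>
      mul_ne_zero two_ne_zero (hx _).ne'
  have hG := contDiffOn_vertexHess hp isOpen_openSet hu
  have hH := contDiffOn_matrix_inv hG fun x hx =>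
    det_ne_zero_of_pos fun v hv => vertexHess_pos hp hpos hx hv
  refine smoothOn_of_polar hp (T := P.openSet) (A := vertexHess hp u)
    (C := fun x => Matrix.of fun j l => (vertexHess hp u x)⁻¹ j l *
      (2 * P.L (vertexIdx hp j) x)⁻¹ * (2 * P.L (vertexIdx hp l) x)⁻¹) isOpen_freeLocus
    (fun m hm => mem_chartSource_of_openSet (hmem m hm)) hmem hG
    (fun j l => ((hH j l).mul (hs j)).mul (hs l)) ?_
  intro m hm v w
  rw [metric_eq_polar hp u (hmem m hm)]
  simp only [div_eq_mul_inv]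
  rw [mul_dotProduct_mulVec_mul]

lemma isMetricOn_metric (hu : ContDiffOn ℝ ∞ u P.openSet)
    (hpos : ∀ x ∈ P.openSet, ∀ v, v ≠ 0 → 0 < v ⬝ᵥ hess u x *ᵥ v) :
    IsMetricOn (metric hP u) (freeLocus hP) where
  smooth := smoothOn_metric hu hpos
  symm := by
    intro m hm v w
    rw [freeLocus_eq] at hm
    have hsymm := hess_isSymm (hu.contDiffAt (isOpen_openSet.mem_nhds hm))
    have h : ∀ {A : Matrix (Fin n) (Fin n) ℝ}, A.IsSymm → ∀ a b : Fin n → ℝ,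
        a ⬝ᵥ A *ᵥ b = b ⬝ᵥ A *ᵥ a := by
      intro A hA a b
      rw [Matrix.dotProduct_mulVec, ← Matrix.mulVec_transpose, hA.eq, dotProduct_comm]
    have hinv : ((hess u (moment m))⁻¹).IsSymm := by
      rw [Matrix.IsSymm, Matrix.transpose_nonsing_inv, hsymm.eq]
    rw [metric_apply, metric_apply, h hsymm, h hinv]
  pos := by
    intro m hm v hv
    rw [freeLocus_eq] at hm
    rw [metric_apply]
    have h1 := hpos _ hm
    have h2 : ∀ w : Fin n → ℝ, w ≠ 0 → 0 < w ⬝ᵥ (hess u (moment m))⁻¹ *ᵥ w :=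
      fun w hw => inv_pos_of_pos h1 hw
    have hne : coframe hP m v ≠ 0 := by
      intro h
      exact hv ((coframe_bijective hm).1 (h.trans (map_zero (coframe hP m)).symm))
    by_cases ha : (coframe hP m v).1 = 0
    · have hb : (coframe hP m v).2 ≠ 0 := fun hb => hne (Prod.ext ha hb)
      have := h2 _ hb
      rw [ha]
      simpa using this
    · have e1 := h1 _ ha
      by_cases hb : (coframe hP m v).2 = 0
      · rw [hb]; simpa using e1
      · exact add_pos e1 (h2 _ hb)

/-! ### The complex structure -/

/-- The complex structure in action-angle coordinates. -/
def actionAngleJ (G : Matrix (Fin n) (Fin n) ℝ) :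
    (Fin n → ℝ) × (Fin n → ℝ) →L[ℝ] (Fin n → ℝ) × (Fin n → ℝ) :=
  ContinuousLinearMap.prod
    (-((LinearMap.toContinuousLinearMap (Matrix.mulVecLin G⁻¹)).comp
      (ContinuousLinearMap.snd ℝ (Fin n → ℝ) (Fin n → ℝ))))
    ((LinearMap.toContinuousLinearMap (Matrix.mulVecLin G)).comp
      (ContinuousLinearMap.fst ℝ (Fin n → ℝ) (Fin n → ℝ)))

lemma actionAngleJ_apply (G : Matrix (Fin n) (Fin n) ℝ) (a : (Fin n → ℝ) × (Fin n → ℝ)) :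
    actionAngleJ G a = (-(G⁻¹ *ᵥ a.2), G *ᵥ a.1) := rfl

variable (hP u) in
/-- The almost complex structure of the metric of a potential. -/
def complexStructure (m : ToricManifold P Λ hP) :
    TangentSpace 𝓘(ℝ, Fin n → ℂ) m →L[ℝ] TangentSpace 𝓘(ℝ, Fin n → ℂ) m :=
  (ContinuousLinearMap.inverse (M := TangentSpace 𝓘(ℝ, Fin n → ℂ) m)
    (M₂ := (Fin n → ℝ) × (Fin n → ℝ)) (coframe hP m)).comp
    ((actionAngleJ (hess u (moment m))).comp (coframe hP m))

lemma coframe_complexStructure {m : ToricManifold P Λ hP} (hm : moment m ∈ P.openSet)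
    (v : TangentSpace 𝓘(ℝ, Fin n → ℂ) m) :
    coframe hP m (complexStructure hP u m v) =
      actionAngleJ (hess u (moment m)) (coframe hP m v) := by
  obtain ⟨w, hw⟩ := (coframe_bijective hm).2 (actionAngleJ (hess u (moment m)) (coframe hP m v))
  have h := (inverse_apply_of_injective (E := Fin n → ℂ) (F := (Fin n → ℝ) × (Fin n → ℝ))
    (by simp [Module.finrank_pi_fintype]; ring) (coframe_bijective hm).1).2 w
  have h2 : complexStructure hP u m v = w := by
    refine Eq.trans ?_ h
    exact congrArg _ hw.symm
  rw [h2, hw]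

lemma hasFDerivAt_chartMoment (z : Fin n → ℂ) (ζ : Fin n → ℂ) :
    fderiv ℝ (chartMoment hp) z ζ =
      (vertexMat hp)⁻¹ *ᵥ (fun j => (starRingEnd ℂ (z j) * ζ j).re) := by
  have h1 : HasFDerivAt (fun z : Fin n → ℂ => fun i => 1 / 2 * ‖z i‖ ^ 2)
      (ContinuousLinearMap.pi fun i => (1 / 2 : ℝ) • ((2 • innerSL ℝ (z i)).comp
        (ContinuousLinearMap.proj (R := ℝ) (φ := fun _ : Fin n => ℂ) i))) z := by
    refine hasFDerivAt_pi.2 fun i => ?_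
    have h : HasFDerivAt (fun z : Fin n → ℂ => ‖z i‖ ^ 2) ((2 • innerSL ℝ (z i)).comp
        (ContinuousLinearMap.proj (R := ℝ) (φ := fun _ : Fin n => ℂ) i)) z :=
      (hasStrictFDerivAt_norm_sq (z i)).hasFDerivAt.comp (f := fun z : Fin n → ℂ => z i) z
        (hasFDerivAt_apply i z)
    exact h.const_mul (1 / 2)
  have h2 := ((LinearMap.toContinuousLinearMap
    (Matrix.mulVecLin (vertexMat hp)⁻¹)).hasFDerivAt.comp z h1).const_add p
  have h3 : fderiv ℝ (chartMoment hp) z = _ := h2.fderiv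
  rw [h3]
  simp only [ContinuousLinearMap.comp_apply, LinearMap.coe_toContinuousLinearMap',
    Matrix.mulVecLin_apply]
  congr 1
  ext j
  simp [Complex.inner]
  ring

/-- The real part of the logarithm of a holomorphic coordinate, up to `log |z_j|`. -/
def logRadius (u : (Fin n → ℝ) → ℝ) (j : Fin n) (x : Fin n → ℝ) : ℝ :=
  fderiv ℝ u x ((vertexMat hp)⁻¹ *ᵥ Pi.single j 1) -
    1 / 2 * Real.log (2 * P.L (vertexIdx hp j) x)

lemma contDiffOn_logRadius (hu : ContDiffOn ℝ ∞ u P.openSet) (j : Fin n) :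
    ContDiffOn ℝ ∞ (logRadius hp u j) P.openSet := by
  refine (contDiffOn_fderiv_apply isOpen_openSet hu _).sub (contDiffOn_const.mul ?_)
  exact (contDiffOn_const.mul (contDiff_L _).contDiffOn).log fun x hx =>
    mul_ne_zero two_ne_zero (hx _).ne'

lemma fderiv_logRadius (hu : ContDiffOn ℝ ∞ u P.openSet) (j : Fin n) {x : Fin n → ℝ}
    (hx : x ∈ P.openSet) (v : Fin n → ℝ) :
    fderiv ℝ (logRadius hp u j) x v = ((hess u x *ᵥ v) ᵥ* (vertexMat hp)⁻¹) j -
      (v ⬝ᵥ P.normal (vertexIdx hp j)) / (2 * P.L (vertexIdx hp j) x) := by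
  have hux := hu.contDiffAt (isOpen_openSet.mem_nhds hx)
  have hx0 := hx (vertexIdx hp j)
  have h1 : DifferentiableAt ℝ (fderiv ℝ u) x :=
    (hux.fderiv_right (m := 1) (by norm_cast)).differentiableAt (by norm_num)
  set b := (vertexMat hp)⁻¹ *ᵥ Pi.single j 1 with hb
  have h2 : HasFDerivAt (fun y => fderiv ℝ u y b)
      ((ContinuousLinearMap.apply ℝ ℝ b).comp (fderiv ℝ (fderiv ℝ u) x)) x :=
    (ContinuousLinearMap.apply ℝ ℝ b).hasFDerivAt.comp x h1.hasFDerivAt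
  let ℓ : (Fin n → ℝ) →L[ℝ] ℝ := LinearMap.toContinuousLinearMap
    { toFun := fun v => v ⬝ᵥ P.normal (vertexIdx hp j)
      map_add' := fun _ _ => add_dotProduct _ _ _
      map_smul' := fun _ _ => smul_dotProduct _ _ _ }
  have h3 : HasFDerivAt (P.L (vertexIdx hp j)) ℓ x := ℓ.hasFDerivAt.add_const _
  have h4 := h2.sub (((h3.const_mul 2).log (by positivity)).const_mul (1 / 2))
  have h5 : fderiv ℝ (logRadius hp u j) x = _ := h4.fderiv
  have hℓ : ℓ v = v ⬝ᵥ P.normal (vertexIdx hp j) := rfl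
  rw [h5]
  simp only [sub_apply, smul_apply, ContinuousLinearMap.comp_apply, ContinuousLinearMap.apply_apply,
    smul_eq_mul, hℓ]
  rw [← dotProduct_hess_mulVec hux]
  congr 1
  · have hs := hess_isSymm hux
    rw [Matrix.dotProduct_mulVec, ← Matrix.mulVec_transpose, hs.eq, hb, Matrix.dotProduct_mulVec]
    simp
  · field_simp

/-- The holomorphic coordinates `exp(∂u/∂L_j + √-1 θ_j)` on the free locus. -/
def holomorphicCoord (u : (Fin n → ℝ) → ℝ) (m : ToricManifold P Λ hP) (j : Fin n) : ℂ :=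
  chartFun hP hp m j * Complex.exp ((logRadius hp u j (moment m) : ℝ) : ℂ)

lemma contMDiffOn_holomorphicCoord (hu : ContDiffOn ℝ ∞ u P.openSet) (j : Fin n) :
    ContMDiffOn 𝓘(ℝ, Fin n → ℂ) 𝓘(ℝ, ℂ) ∞
      (fun m : ToricManifold P Λ hP => holomorphicCoord hp u m j) {m | moment m ∈ P.openSet} := by
  have h1 : ContMDiffOn 𝓘(ℝ, Fin n → ℂ) 𝓘(ℝ, ℝ) ∞
      (fun m : ToricManifold P Λ hP => logRadius hp u j (moment m)) {m | moment m ∈ P.openSet} :=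
    (contDiffOn_logRadius hp hu j).contMDiffOn.comp contMDiff_moment.contMDiffOn fun m hm => hm
  have h2 : ContDiff ℝ ∞ (fun r : ℝ => Complex.exp (r : ℂ)) :=
    Complex.ofRealCLM.contDiff.cexp
  have h3 := h2.contMDiff.comp_contMDiffOn h1
  have h4 := (contMDiffOn_chartFun_apply (hP := hP) hp j).mono
    (fun m (hm : moment m ∈ P.openSet) => mem_chartSource_of_openSet hm)
  exact contDiff_mul.contMDiff.comp_contMDiffOn (h4.prodMk_space h3)

/-- This is a logarithmic differential. The factor z_j contributes dL_j/(2 L_j) + √-1 dθ_j, and the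
term -½ log(2 L_j) in `logRadius` cancels the real part, leaving d(∂u/∂L_j) + √-1 dθ_j. -/
lemma diff_holomorphicCoord (hu : ContDiffOn ℝ ∞ u P.openSet) {m : ToricManifold P Λ hP}
    (hm : moment m ∈ P.openSet) (v : TangentSpace 𝓘(ℝ, Fin n → ℂ) m) (j : Fin n) :
    diff n (holomorphicCoord hp u) m v j = holomorphicCoord hp u m j *
      (((((hess u (moment m) *ᵥ (coframe hP m v).1) ᵥ* (vertexMat hp)⁻¹) j : ℝ) : ℂ) +
        ((((coframe hP m v).2 ᵥ* (vertexMat hp)⁻¹) j : ℝ) : ℂ) * Complex.I) := by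
  have hms := mem_chartSource_of_openSet (p := p) hm
  set z := chartFun hP hp m with hz
  set ζ := diff n (chartFun hP hp) m v with hζ
  have hcm : chartMoment hp z = moment m := chartMoment_chartFun hp hms
  let Φ : (Fin n → ℂ) → Fin n → ℂ := fun z j =>
    z j * Complex.exp ((logRadius hp u j (chartMoment hp z) : ℝ) : ℂ)
  have hev : holomorphicCoord hp u =ᶠ[𝓝 m] Φ ∘ chartFun hP hp := by
    filter_upwards [(isOpen_chartSource hp).mem_nhds hms] with m' hm'
    ext j
    simp only [holomorphicCoord, Φ, Function.comp_apply, chartMoment_chartFun hp hm']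
  have hρ : ∀ j, HasFDerivAt (logRadius hp u j) (fderiv ℝ (logRadius hp u j) (moment m))
      (chartMoment hp z) := by
    intro j
    rw [hcm]
    exact (((contDiffOn_logRadius hp hu j).contDiffAt
      (isOpen_openSet.mem_nhds hm)).differentiableAt (by simp)).hasFDerivAt
  have hΦ : ∀ j, HasFDerivAt (fun z => Φ z j) _ z := fun j =>
    HasFDerivAt.mul (hasFDerivAt_apply j z) (Complex.ofRealCLM.hasFDerivAt.comp z
      ((hρ j).comp z ((contDiff_chartMoment hp).differentiable (by simp) z).hasFDerivAt)).cexp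
  have hΦd : HasFDerivAt Φ _ z := hasFDerivAt_pi.2 hΦ
  have h := mfderiv_comp (g := Φ) (f := chartFun hP hp) m hΦd.differentiableAt.mdifferentiableAt
    ((contMDiffAt_chartFun hp hms).mdifferentiableAt (by simp))
  rw [← hev.mfderiv_eq, mfderiv_eq_fderiv] at h
  have h1 : diff n (holomorphicCoord hp u) m v = fderiv ℝ Φ z ζ := DFunLike.congr_fun h v
  rw [h1, hΦd.fderiv]
  have hdx : fderiv ℝ (chartMoment hp) z ζ = (coframe hP m v).1 := by
    rw [hasFDerivAt_chartMoment, coframe_fst hp hm]; rfl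
  simp only [ContinuousLinearMap.pi_apply, add_apply, smul_apply, ContinuousLinearMap.comp_apply,
    ContinuousLinearMap.proj_apply, Function.comp_apply, hdx, Complex.ofRealCLM_apply, smul_eq_mul,
    fderiv_logRadius hp hu j hm, hcm]
  have hzj : z j ≠ 0 := chartFun_ne_zero hp hms (hm _)
  have hzc : starRingEnd ℂ (z j) ≠ 0 := by simpa using hzj
  have hLz : ((2 * P.L (vertexIdx hp j) (moment m) : ℝ) : ℂ) = starRingEnd ℂ (z j) * z j := by
    rw [L_moment_eq hp hms, ← Complex.normSq_eq_conj_mul_self, Complex.normSq_eq_norm_sq]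
    congr 1
    ring
  have hre : (coframe hP m v).1 ⬝ᵥ P.normal (vertexIdx hp j) = polarRe hp m v j := by
    rw [coframe_fst hp hm, dotProduct_comm, Matrix.dotProduct_mulVec, normal_vecMul_inv]
    simp
  have him : ((coframe hP m v).2 ᵥ* (vertexMat hp)⁻¹) j =
      polarIm hp m v j / (2 * P.L (vertexIdx hp j) (moment m)) := by
    rw [coframe_snd hp hm, Matrix.vecMul_vecMul, vertexMat_mul_inv, Matrix.vecMul_one]
  have hsum : ((polarRe hp m v j : ℝ) : ℂ) + ((polarIm hp m v j : ℝ) : ℂ) * Complex.I =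
      starRingEnd ℂ (z j) * ζ j := Complex.re_add_im _
  have hhol : holomorphicCoord hp u m j =
      z j * Complex.exp ((logRadius hp u j (moment m) : ℝ) : ℂ) := rfl
  rw [hre, him, hhol, Complex.ofReal_sub, Complex.ofReal_div, Complex.ofReal_div, hLz]
  field_simp
  linear_combination -hsum

lemma holomorphicCoord_ne_zero (u : (Fin n → ℝ) → ℝ) {m : ToricManifold P Λ hP}
    (hm : moment m ∈ P.openSet) (j : Fin n) : holomorphicCoord hp u m j ≠ 0 :=
  mul_ne_zero (chartFun_ne_zero hp (mem_chartSource_of_openSet hm) (hm _)) (Complex.exp_ne_zero _)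

lemma isKahlerOn_metric (hu : ContDiffOn ℝ ∞ u P.openSet)
    (hpos : ∀ x ∈ P.openSet, ∀ v, v ≠ 0 → 0 < v ⬝ᵥ hess u x *ᵥ v) :
    IsKahlerOn (metric hP u) (symplecticForm hP) (freeLocus hP) where
  metric := isMetricOn_metric hu hpos
  smooth_form := smoothOn_symplecticForm
  alternating := by
    intro m _ v
    rw [symplecticForm_apply]
    exact Finset.sum_eq_zero fun j _ => by ring
  closed := isClosedFormOn_symplecticForm
  complex := by
    obtain ⟨p, hp⟩ := exists_isVertex P
    have hmem : ∀ m ∈ freeLocus hP, moment m ∈ P.openSet := fun m hm => by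
      rwa [freeLocus_eq] at hm
    have hdet : ∀ m ∈ freeLocus hP, IsUnit (hess u (moment m)).det := fun m hm =>
      isUnit_iff_ne_zero.2 (det_ne_zero_of_pos (hpos _ (hmem m hm)))
    have hGH : ∀ m ∈ freeLocus hP, ∀ a,
        hess u (moment m) *ᵥ ((hess u (moment m))⁻¹ *ᵥ a) = a := fun m hm a => by
      rw [Matrix.mulVec_mulVec, Matrix.mul_nonsing_inv _ (hdet m hm), Matrix.one_mulVec]
    have hHG : ∀ m ∈ freeLocus hP, ∀ a,
        (hess u (moment m))⁻¹ *ᵥ (hess u (moment m) *ᵥ a) = a := fun m hm a => by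
      rw [Matrix.mulVec_mulVec, Matrix.nonsing_inv_mul _ (hdet m hm), Matrix.one_mulVec]
    refine ⟨complexStructure hP u, ?_, ?_, ?_⟩
    · intro m hm v
      apply (coframe_bijective (hmem m hm)).1
      rw [coframe_complexStructure (hmem m hm), coframe_complexStructure (hmem m hm), map_neg]
      simp only [actionAngleJ_apply, Matrix.mulVec_neg, hGH m hm, hHG m hm]
      rfl
    · intro m hm v w
      rw [symplecticForm_eq_coframe (hmem m hm), metric_apply,
        coframe_complexStructure (hmem m hm)]
      have hs := hess_isSymm (hu.contDiffAt (isOpen_openSet.mem_nhds (hmem m hm)))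
      have hsi : ((hess u (moment m))⁻¹).IsSymm := by
        rw [Matrix.IsSymm, Matrix.transpose_nonsing_inv, hs.eq]
      simp only [actionAngleJ_apply, neg_dotProduct]
      rw [Matrix.dotProduct_mulVec, ← Matrix.mulVec_transpose, hs.eq, hGH m hm,
        Matrix.dotProduct_mulVec, ← Matrix.mulVec_transpose, hsi.eq, hHG m hm]
      ring
    -- The same coordinates serve at all points. Since J sends G dx to -dθ and dθ to G dx, the form
    -- G dx + √-1 dθ is multiplied by √-1. Invertibility of G gives the injectivity of the
    -- differential.
    · intro m₀ hm₀
      refine ⟨freeLocus hP, holomorphicCoord hp u, isOpen_freeLocus, hm₀, subset_rfl, ?_, ?_⟩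
      · rw [freeLocus_eq]
        exact contMDiffOn_pi_space.2 fun j => contMDiffOn_holomorphicCoord hp hu j
      · intro m hm
        have hm' := hmem m hm
        refine ⟨?_, ?_⟩
        · have hinj : Function.Injective (diff n (holomorphicCoord hp u) m) := by
            intro v w hvw
            have h1 : ∀ j, (((hess u (moment m) *ᵥ (coframe hP m v).1) ᵥ* (vertexMat hp)⁻¹) j =
                ((hess u (moment m) *ᵥ (coframe hP m w).1) ᵥ* (vertexMat hp)⁻¹) j) ∧
                (((coframe hP m v).2 ᵥ* (vertexMat hp)⁻¹) j =
                ((coframe hP m w).2 ᵥ* (vertexMat hp)⁻¹) j) := by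
              intro j
              have h2 := congrFun hvw j
              rw [diff_holomorphicCoord hp hu hm', diff_holomorphicCoord hp hu hm'] at h2
              have h3 := mul_left_cancel₀ (holomorphicCoord_ne_zero hp u hm' j) h2
              have h4 := congrArg Complex.re h3
              have h5 := congrArg Complex.im h3
              simp at h4 h5
              exact ⟨h4, h5⟩
            have hV : Function.Injective fun a : Fin n → ℝ => a ᵥ* (vertexMat hp)⁻¹ := by
              intro a b hab
              have := congrArg (fun y => y ᵥ* vertexMat hp) hab
              simpa [Matrix.vecMul_vecMul, vertexMat_inv_mul] using this
            have h2 := hV (funext fun j => (h1 j).1)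
            have h3 := hV (funext fun j => (h1 j).2)
            have h4 := congrArg (fun y => (hess u (moment m))⁻¹ *ᵥ y) h2
            simp only [hHG m hm] at h4
            exact (coframe_bijective hm').1 (Prod.ext h4 h3)
          exact ⟨hinj, (inverse_apply_of_injective (E := Fin n → ℂ) (F := Fin n → ℂ) rfl hinj).1⟩
        · intro v
          ext j
          rw [Pi.smul_apply, diff_holomorphicCoord hp hu hm', diff_holomorphicCoord hp hu hm',
            coframe_complexStructure hm']
          simp only [actionAngleJ_apply, Matrix.mulVec_neg, hGH m hm, Matrix.neg_vecMul,
            Pi.neg_apply, Complex.ofReal_neg, smul_eq_mul]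
          linear_combination (-holomorphicCoord hp u m j *
            ((((coframe hP m v).2 ᵥ* (vertexMat hp)⁻¹) j : ℝ) : ℂ)) * Complex.I_mul_I

end Kahler

/-! ### Inverses of matrices with one singular entry -/

section SingularEntry

variable {n : ℕ} (i : Fin n) (t : ℝ) (K : Matrix (Fin n) (Fin n) ℝ)

/-- The matrix `K + t⁻¹ e_i e_iᵀ`, with row `i` multiplied by `t`; it is regular at `t = 0`. -/
def regularized : Matrix (Fin n) (Fin n) ℝ := K.updateRow i (Pi.single i 1 + t • K i)

/-- The regular part of the inverse of `K + t⁻¹ e_i e_iᵀ`, with row `i` and column `i` divided by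
`t`. -/
def regularInverse : Matrix (Fin n) (Fin n) ℝ :=
  ((regularized i t K)⁻¹).updateRow i (-(K * (regularized i t K)⁻¹) i)

variable {i t K}

lemma regularized_eq (ht : t ≠ 0) :
    regularized i t K =
      Matrix.diagonal (Function.update 1 i t) * (Matrix.single i i t⁻¹ + K) := by
  ext j l
  rw [Matrix.diagonal_mul, regularized, Matrix.updateRow_apply, Matrix.add_apply]
  by_cases hj : j = i
  · subst hj
    by_cases hl : l = j
    · subst hl; simp; field_simp
    · simp [hl, Ne.symm hl]
  · simp [hj, Ne.symm hj]

lemma det_regularized_ne_zero (ht : t ≠ 0) (h : (Matrix.single i i t⁻¹ + K).det ≠ 0) :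
    (regularized i t K).det ≠ 0 := by
  rw [regularized_eq ht, Matrix.det_mul, Matrix.det_diagonal]
  refine mul_ne_zero (Finset.prod_ne_zero_iff.2 fun j _ => ?_) h
  by_cases hj : j = i
  · subst hj; simpa using ht
  · simp [hj]

/-- With D = diag(1, …, t, …, 1) the regularized matrix is D G, so G⁻¹ = S D for its inverse S. The
columns already carry the factor t; the same factor in row i comes from `hrow`. -/
lemma inv_eq_regularInverse (ht : t ≠ 0) (h : (Matrix.single i i t⁻¹ + K).det ≠ 0) :
    (Matrix.single i i t⁻¹ + K)⁻¹ = Matrix.single i i t +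
      Matrix.of fun j l => regularInverse i t K j l * (Function.update 1 i t : Fin n → ℝ) j *
        (Function.update 1 i t : Fin n → ℝ) l := by
  set G := Matrix.single i i t⁻¹ + K
  set S := (regularized i t K)⁻¹ with hS
  have hR := det_regularized_ne_zero ht h
  have hRS : regularized i t K * S = 1 := Matrix.mul_nonsing_inv _ (isUnit_iff_ne_zero.2 hR)
  have hSR : S * regularized i t K = 1 := Matrix.nonsing_inv_mul _ (isUnit_iff_ne_zero.2 hR)
  have hinv : G⁻¹ = S * Matrix.diagonal (Function.update 1 i t) := by
    refine Matrix.inv_eq_left_inv ?_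
    rw [Matrix.mul_assoc, ← regularized_eq ht, hSR]
  -- Row i of the regularized matrix is e_i + t K_i, so row i of its product with S reads S_i + t (K
  -- S)_i = e_i. The part e_i produces the entry t of the inverse, and the rest is divisible by t.
  have hrow : ∀ l, S i l = (1 : Matrix (Fin n) (Fin n) ℝ) i l - t * (K * S) i l := by
    intro l
    have := congrFun (congrFun hRS i) l
    rw [Matrix.mul_apply] at this
    simp only [regularized, Matrix.updateRow_self, Pi.add_apply, Pi.smul_apply, smul_eq_mul,
      add_mul,
      Finset.sum_add_distrib] at this
    rw [← this, Matrix.mul_apply, Finset.mul_sum]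
    simp [Pi.single_apply, mul_assoc]
  rw [hinv]
  ext j l
  rw [Matrix.mul_diagonal, Matrix.add_apply, Matrix.of_apply, regularInverse, ← hS,
    Matrix.updateRow_apply]
  by_cases hj : j = i
  · subst hj
    rw [hrow l]
    by_cases hl : l = j
    · subst hl; simp; ring
    · simp [hl, Ne.symm hl]; ring
  · simp [hj, Ne.symm hj]

lemma regularized_zero_mulVec (ξ : Fin n → ℝ) :
    regularized i 0 K *ᵥ ξ = Function.update (K *ᵥ ξ) i (ξ i) := by
  ext j
  by_cases hj : j = i
  · subst hj
    simp [Matrix.mulVec, regularized]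
  · simp [Matrix.mulVec, regularized, hj]

/-- At t = 0 row i is e_i. A kernel vector ξ therefore has ξ_i = 0 and (K ξ)_j = 0 for j ≠ i, so ξ ·
K ξ = 0. -/
lemma det_regularized_zero_ne_zero (h : ∀ ξ : Fin n → ℝ, ξ ≠ 0 → ξ i = 0 → 0 < ξ ⬝ᵥ K *ᵥ ξ) :
    (regularized i 0 K).det ≠ 0 := by
  intro h0
  obtain ⟨ξ, hξ, hξ0⟩ := Matrix.exists_mulVec_eq_zero_iff.2 h0
  rw [regularized_zero_mulVec] at hξ0
  have hi : ξ i = 0 := by simpa using congrFun hξ0 i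
  have h1 : ξ ⬝ᵥ K *ᵥ ξ = 0 := by
    refine Finset.sum_eq_zero fun j _ => ?_
    by_cases hj : j = i
    · rw [hj, hi, zero_mul]
    · have := congrFun hξ0 j
      rw [Function.update_of_ne hj] at this
      rw [this]; simp
  exact (h ξ hξ hi).ne' h1

/-- If ψ is the image of ξ under the regularized matrix at t = 0, then ψ_i = 0 means ξ_i = 0 and
makes the replaced row irrelevant, and the form at ψ equals ξ · K ξ. This gives positivity in the
angular directions along the divisor. -/
lemma regularInverse_zero_pos (h : ∀ ξ : Fin n → ℝ, ξ ≠ 0 → ξ i = 0 → 0 < ξ ⬝ᵥ K *ᵥ ξ)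
    {ψ : Fin n → ℝ} (hψ : ψ ≠ 0) (hi : ψ i = 0) : 0 < ψ ⬝ᵥ regularInverse i 0 K *ᵥ ψ := by
  set ξ := (regularized i 0 K)⁻¹ *ᵥ ψ with hξ
  have e : regularized i 0 K *ᵥ ξ = ψ := by
    rw [hξ, Matrix.mulVec_mulVec, Matrix.mul_nonsing_inv _
      (isUnit_iff_ne_zero.2 (det_regularized_zero_ne_zero h)), Matrix.one_mulVec]
  have hξ0 : ξ ≠ 0 := by
    intro h0
    rw [h0, Matrix.mulVec_zero] at e
    exact hψ e.symm
  rw [regularized_zero_mulVec] at e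
  have hξi : ξ i = 0 := by
    have := congrFun e i
    rwa [Function.update_self, hi] at this
  have h1 : ψ ⬝ᵥ regularInverse i 0 K *ᵥ ψ = ξ ⬝ᵥ K *ᵥ ξ := by
    refine Finset.sum_congr rfl fun j _ => ?_
    by_cases hj : j = i
    · rw [hj, hi, hξi, zero_mul, zero_mul]
    · have h2 := congrFun e j
      rw [Function.update_of_ne hj] at h2
      have h3 : (regularInverse i 0 K *ᵥ ψ) j = ξ j := by
        simp [Matrix.mulVec, regularInverse, hj, hξ]
      rw [h3, h2, mul_comm]
  rw [h1]
  exact h ξ hξ0 hξi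

lemma contDiffOn_regularInverse {E : Type*} [NormedAddCommGroup E] [NormedSpace ℝ E] {T : Set E}
    {t : E → ℝ} {K : E → Matrix (Fin n) (Fin n) ℝ} (ht : ContDiffOn ℝ ∞ t T)
    (hK : ∀ j l, ContDiffOn ℝ ∞ (fun x => K x j l) T)
    (hdet : ∀ x ∈ T, (regularized i (t x) (K x)).det ≠ 0) (j l : Fin n) :
    ContDiffOn ℝ ∞ (fun x => regularInverse i (t x) (K x) j l) T := by
  have hR : ∀ j l, ContDiffOn ℝ ∞ (fun x => regularized i (t x) (K x) j l) T := by
    intro j l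
    by_cases hj : j = i
    · simp only [regularized, Matrix.updateRow_apply, hj, if_true, Pi.add_apply, Pi.smul_apply]
      exact contDiffOn_const.add (ht.mul (hK i l))
    · simp only [regularized, Matrix.updateRow_apply, hj, if_false]
      exact hK j l
  have hS := contDiffOn_matrix_inv hR hdet
  by_cases hj : j = i
  · simp only [regularInverse, Matrix.updateRow_apply, hj, if_true]
    exact (contDiffOn_matrix_mul hK hS i l).neg
  · simp only [regularInverse, Matrix.updateRow_apply, hj, if_false]
    exact hS j l

end SingularEntry

/-! ### The normal form of the metric along a facet -/

section Cone

variable {n d : ℕ} {P : LabelledPolytope n d} {Λ : Submodule ℤ (Fin n → ℝ)} {hP : P.IsDelzant Λ}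
  {p : Fin n → ℝ} (hp : P.IsVertex p) {u : (Fin n → ℝ) → ℝ}

/-- The tensor field with coefficients `A` and `C` in terms of the forms `½ d|z_j|²` and
`|z_j|² d(arg z_j)`. -/
def polarTensor (A C : (Fin n → ℝ) → Matrix (Fin n) (Fin n) ℝ) :
    Tensor2 n (ToricManifold P Λ hP) := fun m =>
  let form : Fin n → (TangentSpace 𝓘(ℝ, Fin n → ℂ) m →L[ℝ] ℂ) := fun j =>
    (ContinuousLinearMap.mul ℝ ℂ (starRingEnd ℂ (chartFun hP hp m j))).comp
      ((ContinuousLinearMap.proj (R := ℝ) (φ := fun _ : Fin n => ℂ) j).comp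
        (diff n (chartFun hP hp) m))
  ∑ j, ∑ l, (A (moment m) j l •
      (Complex.reCLM.comp (form j)).smulRight (Complex.reCLM.comp (form l)) +
    C (moment m) j l • (Complex.imCLM.comp (form j)).smulRight (Complex.imCLM.comp (form l)))

lemma polarTensor_apply (A C : (Fin n → ℝ) → Matrix (Fin n) (Fin n) ℝ)
    (m : ToricManifold P Λ hP) (v w : TangentSpace 𝓘(ℝ, Fin n → ℂ) m) :
    polarTensor hp A C m v w = polarRe hp m v ⬝ᵥ A (moment m) *ᵥ polarRe hp m w +
      polarIm hp m v ⬝ᵥ C (moment m) *ᵥ polarIm hp m w := by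
  simp only [polarTensor, sum_apply, add_apply, smul_apply, ContinuousLinearMap.smulRight_apply,
    smul_eq_mul, dotProduct, Matrix.mulVec, Finset.mul_sum, ← Finset.sum_add_distrib]
  refine Finset.sum_congr rfl fun j _ => Finset.sum_congr rfl fun l _ => ?_
  simp only [polarRe, polarIm, ContinuousLinearMap.comp_apply, Complex.reCLM_apply,
    Complex.imCLM_apply, ContinuousLinearMap.proj_apply, ContinuousLinearMap.mul_apply']
  ring

lemma freeLocus_union_divisor (k : Fin d) :
    freeLocus hP ∪ divisor hP k = {m | ∀ j, j ≠ k → 0 < P.L j (moment m)} := by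
  ext m
  rw [freeLocus_eq]
  constructor
  · rintro (h | h) j hj
    · exact h j
    · exact h.2 j hj
  · intro h
    rcases (moment_mem m k).eq_or_lt with h0 | h0
    · exact Or.inr ⟨h0.symm, h⟩
    · refine Or.inl fun j => ?_
      by_cases hj : j = k
      · rw [hj]; exact h0
      · exact h j hj

lemma isOpen_freeLocus_union_divisor (k : Fin d) : IsOpen (freeLocus hP ∪ divisor hP k) := by
  rw [freeLocus_union_divisor]
  have : {m : ToricManifold P Λ hP | ∀ j, j ≠ k → 0 < P.L j (moment m)} =
      ⋂ j, {m | j ≠ k → 0 < P.L j (moment m)} := by ext; simp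
  rw [this]
  refine isOpen_iInter_of_finite fun j => ?_
  by_cases hj : j = k
  · simp [hj]
  · simp only [ne_eq, hj, not_false_eq_true, forall_const]
    exact isOpen_lt continuous_const ((continuous_L j).comp continuous_moment)

lemma freeLocus_union_divisor_subset {i : Fin n} {k : Fin d} (hik : vertexIdx hp i = k) :
    freeLocus hP ∪ divisor hP k ⊆ chartSource hP p := by
  intro m hm j hj
  by_cases hjk : j = k
  · rw [hjk, mem_active_vertex hp]; exact ⟨i, hik⟩
  · rw [freeLocus_union_divisor] at hm
    exact absurd (mem_active.1 hj) (hm j hjk).ne'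

/-- The change of basis at the vertex takes the i-th normal to e_i, so the rank-one singular part is
concentrated in a single diagonal entry. -/
lemma vertexHess_vecMulVec {f : (Fin n → ℝ) → ℝ} {i : Fin n} {x : Fin n → ℝ} {s : ℝ}
    (h : hess u x = s • Matrix.vecMulVec (P.normal (vertexIdx hp i)) (P.normal (vertexIdx hp i)) +
      hess f x) : vertexHess hp u x = Matrix.single i i s + vertexHess hp f x := by
  rw [vertexHess, h, Matrix.mul_add, Matrix.add_mul, vertexHess]
  congr 1
  rw [Matrix.mul_smul, Matrix.smul_mul, Matrix.mul_vecMulVec, Matrix.vecMulVec_mul,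
    Matrix.mulVec_transpose, normal_vecMul_inv]
  ext j l
  simp only [Matrix.smul_apply, Matrix.vecMulVec_apply, Matrix.single_apply, Pi.single_apply,
    smul_eq_mul]
  by_cases hj : j = i <;> by_cases hl : l = i <;> simp [hj, hl, Ne.symm]

lemma diff_chartFun_eq_zero_of_polar {m : ToricManifold P Λ hP} {v : TangentSpace 𝓘(ℝ, Fin n → ℂ) m}
    {j : Fin n} (hj : chartFun hP hp m j ≠ 0) (hre : polarRe hp m v j = 0)
    (him : polarIm hp m v j = 0) : diff n (chartFun hP hp) m v j = 0 := by
  have h : starRingEnd ℂ (chartFun hP hp m j) * diff n (chartFun hP hp) m v j = 0 :=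
    Complex.ext hre him
  rcases mul_eq_zero.1 h with h | h
  · exact absurd (by simpa using h) hj
  · exact h

/-- The tensor `B` is smooth across the preimage of the interior of the facet `F_k`, and `g - B` is
the metric of a cone of total angle `2πa` in the coordinate `z_i` at the vertex. -/
structure IsConeForm (i : Fin n) (k : Fin d) (a : ℝ) (g B : Tensor2 n (ToricManifold P Λ hP)) :
    Prop where
  smooth : SmoothOn B (freeLocus hP ∪ divisor hP k)
  symm : ∀ m ∈ freeLocus hP ∪ divisor hP k, ∀ v w, B m v w = B m w v
  eq : ∀ m ∈ freeLocus hP, ∀ v w, g m v w = a⁻¹ * flatCone a (chartFun hP hp m i)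
    (diff n (chartFun hP hp) m v i) (diff n (chartFun hP hp) m w i) + B m v w
  along : ∀ m ∈ divisor hP k,
    (∀ v, diff n (chartFun hP hp) m v i = 0 → v ≠ 0 → 0 < B m v v) ∧
    ∀ v, ∃ y, diff n (chartFun hP hp) m y i = 0 ∧ ∀ w, B m (v - y) w = 0

/-- The normal form of the metric near the preimage of the interior of a facet. -/
theorem exists_cone_form {i : Fin n} {k : Fin d} (hik : vertexIdx hp i = k) {a : ℝ} (ha : 0 < a)
    {f : (Fin n → ℝ) → ℝ} {W : Set (Fin n → ℝ)} (hW : IsOpen W) (hf : ContDiffOn ℝ ∞ f W)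
    (hmemW : ∀ x ∈ P.closedSet, (∀ j, j ≠ k → 0 < P.L j x) → x ∈ W)
    (hess_eq : ∀ x ∈ P.openSet, hess u x =
      (2 * a * P.L k x)⁻¹ • Matrix.vecMulVec (P.normal k) (P.normal k) + hess f x)
    (hpos : ∀ x ∈ P.openSet, ∀ v, v ≠ 0 → 0 < v ⬝ᵥ hess u x *ᵥ v)
    (hposf : ∀ x ∈ P.facetInterior k, ∀ v, v ≠ 0 → v ⬝ᵥ P.normal k = 0 → 0 < v ⬝ᵥ hess f x *ᵥ v) :
    ∃ B : Tensor2 n (ToricManifold P Λ hP), IsConeForm hp i k a (metric hP u) B := by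
  subst hik
  set k := vertexIdx hp i with hk
  let T : Set (Fin n → ℝ) := {x | x ∈ P.closedSet ∧ ∀ j, j ≠ k → 0 < P.L j x}
  have hTW : T ⊆ W := fun x hx => hmemW x hx.1 hx.2
  let K := vertexHess hp f
  -- The reciprocal of the singular entry. It extends smoothly by 0 to the facet, and equals a
  -- |z_i|² on M.
  let t : (Fin n → ℝ) → ℝ := fun x => 2 * a * P.L k x
  have hK : ∀ j l, ContDiffOn ℝ ∞ (fun x => K x j l) T := fun j l =>
    (contDiffOn_vertexHess hp hW hf j l).mono hTW
  have ht : ContDiffOn ℝ ∞ t T := contDiffOn_const.mul (contDiff_L k).contDiffOn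
  have hT : ∀ x ∈ T, x ∈ P.openSet ∨ x ∈ P.facetInterior k := by
    intro x hx
    rcases (hx.1 k).eq_or_lt with h0 | h0
    · exact Or.inr ⟨h0.symm, hx.2⟩
    · refine Or.inl fun j => ?_
      by_cases hj : j = k
      · rw [hj]; exact h0
      · exact hx.2 j hj
  have hKsymm : ∀ x ∈ T, (K x).IsSymm := by
    intro x hx
    have := hess_isSymm (hf.contDiffAt (hW.mem_nhds (hTW hx)))
    simp only [Matrix.IsSymm, K, vertexHess, Matrix.transpose_mul, Matrix.transpose_transpose,
      this.eq, Matrix.mul_assoc]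
  have hKpos : ∀ x ∈ P.facetInterior k, ∀ ξ : Fin n → ℝ, ξ ≠ 0 → ξ i = 0 → 0 < ξ ⬝ᵥ K x *ᵥ ξ := by
    intro x hx ξ hξ hξi
    simp only [K]
    rw [dotProduct_vertexHess_mulVec]
    refine hposf x hx _ (fun h => hξ ?_) ?_
    · have := congrArg (fun y => vertexMat hp *ᵥ y) h
      simpa [Matrix.mulVec_mulVec, vertexMat_mul_inv] using this
    · rw [dotProduct_comm, Matrix.dotProduct_mulVec, normal_vecMul_inv]
      simpa using hξi
  have hG : ∀ x ∈ P.openSet, vertexHess hp u x = Matrix.single i i (t x)⁻¹ + K x := fun x hx =>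
    vertexHess_vecMulVec hp (hess_eq x hx)
  have htpos : ∀ x ∈ P.openSet, t x ≠ 0 := fun x hx => by
    have := hx k
    simp only [t]; positivity
  have hGdet : ∀ x ∈ P.openSet, (Matrix.single i i (t x)⁻¹ + K x).det ≠ 0 := fun x hx => by
    rw [← hG x hx]
    exact det_ne_zero_of_pos fun v hv => vertexHess_pos hp hpos hx hv
  have hdet : ∀ x ∈ T, (regularized i (t x) (K x)).det ≠ 0 := by
    intro x hx
    rcases hT x hx with h | h
    · exact det_regularized_ne_zero (htpos x h) (hGdet x h)
    · have : t x = 0 := by simp only [t, h.1, mul_zero]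
      rw [this]
      exact det_regularized_zero_ne_zero (hKpos x h)
  have hS := contDiffOn_regularInverse ht hK hdet
  -- The factors of the angular forms in the regular part: 1/(2 L_j) for j ≠ i, smooth because L_j >
  -- 0 on T, and for j = i the quotient t/(2 L_k) = a.
  let s : (Fin n → ℝ) → Fin n → ℝ := fun x => Function.update
    (fun j => (2 * P.L (vertexIdx hp j) x)⁻¹) i a
  have hsC : ∀ j, ContDiffOn ℝ ∞ (fun x => s x j) T := by
    intro j
    by_cases hj : j = i
    · simp only [s, hj, Function.update_self]; exact contDiffOn_const
    · simp only [s, Function.update_of_ne hj]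
      refine (contDiffOn_const.mul (contDiff_L _).contDiffOn).inv fun x hx => ?_
      exact mul_ne_zero two_ne_zero (hx.2 _ fun h => hj ((vertexIdx hp).injective h)).ne'
  -- The regular inverse is not visibly symmetric on the facet. Symmetrizing makes B symmetric
  -- everywhere, and over the open polytope nothing is lost because the full inverse is symmetric
  -- there.
  let C₀ : (Fin n → ℝ) → Matrix (Fin n) (Fin n) ℝ := fun x =>
    (1 / 2 : ℝ) • (regularInverse i (t x) (K x) + (regularInverse i (t x) (K x))ᵀ)
  let C : (Fin n → ℝ) → Matrix (Fin n) (Fin n) ℝ := fun x =>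
    Matrix.of fun j l => C₀ x j l * s x j * s x l
  have hC₀symm : ∀ x j l, C₀ x j l = C₀ x l j := fun x j l => by
    simp only [C₀, Matrix.smul_apply, Matrix.add_apply, Matrix.transpose_apply, add_comm]
  have hC : ∀ j l, ContDiffOn ℝ ∞ (fun x => C x j l) T := fun j l =>
    ((contDiffOn_const.mul ((hS j l).add (hS l j))).mul (hsC j)).mul (hsC l)
  have hmemT : ∀ m ∈ freeLocus hP ∪ divisor hP k, moment m ∈ T := by
    intro m hm
    rw [freeLocus_union_divisor] at hm
    exact ⟨moment_mem m, hm⟩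
  have hsource := freeLocus_union_divisor_subset (hP := hP) hp hk.symm
  have hopen : IsOpen (freeLocus hP ∪ divisor hP k) := isOpen_freeLocus_union_divisor k
  have hB : ∀ (m : ToricManifold P Λ hP) (v w : TangentSpace 𝓘(ℝ, Fin n → ℂ) m),
      polarTensor hp K C m v w = polarRe hp m v ⬝ᵥ K (moment m) *ᵥ polarRe hp m w +
      (fun j => polarIm hp m v j * s (moment m) j) ⬝ᵥ C₀ (moment m) *ᵥ
        (fun j => polarIm hp m w j * s (moment m) j) := by
    intro m v w
    rw [polarTensor_apply, mul_dotProduct_mulVec_mul]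
  have hsymmform : ∀ {A : Matrix (Fin n) (Fin n) ℝ}, A.IsSymm → ∀ a b : Fin n → ℝ,
      a ⬝ᵥ A *ᵥ b = b ⬝ᵥ A *ᵥ a := by
    intro A hA a b
    rw [Matrix.dotProduct_mulVec, ← Matrix.mulVec_transpose, hA.eq, dotProduct_comm]
  refine ⟨polarTensor hp K C, ?_, ?_, ?_, ?_⟩
  · exact smoothOn_of_polar hp hopen hsource hmemT hK hC fun m _ v w =>
      polarTensor_apply hp K C m v w
  · intro m hm v w
    rw [hB, hB, hsymmform (hKsymm _ (hmemT m hm))]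
    congr 1
    exact hsymmform (Matrix.IsSymm.ext fun j l => hC₀symm _ l j) _ _
  · intro m hm v w
    have hm' : moment m ∈ P.openSet := by rwa [freeLocus_eq] at hm
    have hms := hsource (Or.inl hm)
    rw [metric_eq_polar hp u hm', hB, hG _ hm']
    have hinv : (Matrix.single i i (t (moment m))⁻¹ + K (moment m))⁻¹ =
        Matrix.single i i (t (moment m)) + Matrix.of fun j l => C₀ (moment m) j l *
          (Function.update 1 i (t (moment m)) : Fin n → ℝ) j *
          (Function.update 1 i (t (moment m)) : Fin n → ℝ) l := by
      have h1 := inv_eq_regularInverse (htpos _ hm') (hGdet _ hm')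
      have h2 : ((Matrix.single i i (t (moment m))⁻¹ + K (moment m))⁻¹).IsSymm := by
        rw [Matrix.IsSymm, Matrix.transpose_nonsing_inv, Matrix.transpose_add,
          (hKsymm _ (hmemT m (Or.inl hm))).eq, Matrix.transpose_single]
      ext j l
      have h3 := h2.apply j l
      have h4 := congrFun (congrFun h1 j) l
      have h5 := congrFun (congrFun h1 l) j
      have h6 : Matrix.single i i (t (moment m)) l j = Matrix.single i i (t (moment m)) j l := by
        simp only [Matrix.single_apply, and_comm]
      simp only [Matrix.add_apply, Matrix.of_apply, h6] at h4 h5 ⊢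
      simp only [C₀, Matrix.smul_apply, Matrix.add_apply, Matrix.transpose_apply, smul_eq_mul]
      rw [h5, h4] at h3
      rw [h4]
      linarith
    have hsingle : ∀ (r : ℝ) (a b : Fin n → ℝ), a ⬝ᵥ Matrix.single i i r *ᵥ b = a i * r * b i := by
      intro r a b
      simp [dotProduct, Matrix.mulVec, Matrix.single_apply, ite_and, mul_assoc]
    have hs : ∀ v : TangentSpace 𝓘(ℝ, Fin n → ℂ) m,
        (fun j => polarIm hp m v j / (2 * P.L (vertexIdx hp j) (moment m)) *
          (Function.update 1 i (t (moment m)) : Fin n → ℝ) j) =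
        fun j => polarIm hp m v j * s (moment m) j := by
      intro v
      ext j
      have hLj := (hm' (vertexIdx hp j)).ne'
      by_cases hj : j = i
      · subst hj
        simp only [s, t, Function.update_self, hk]
        field_simp
      · simp only [s, Function.update_of_ne hj, Pi.one_apply, mul_one, div_eq_mul_inv]
    have hL := L_moment_eq hp hms i
    have hLpos := hm' k
    rw [hinv, Matrix.add_mulVec, Matrix.add_mulVec, dotProduct_add, dotProduct_add, hsingle,
      hsingle, ← mul_dotProduct_mulVec_mul, hs, hs]
    have hnorm : ‖chartFun hP hp m i‖ ^ 2 = 2 * P.L k (moment m) := by linarith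
    -- The two singular entries combine: with |z_i|² = 2 L_k they are Re·Re/(a |z_i|²) and a
    -- Im·Im/|z_i|², which is a⁻¹ times the flat cone.
    have hflat : polarRe hp m v i * (t (moment m))⁻¹ * polarRe hp m w i +
        polarIm hp m v i / (2 * P.L (vertexIdx hp i) (moment m)) * t (moment m) *
          (polarIm hp m w i / (2 * P.L (vertexIdx hp i) (moment m))) =
        a⁻¹ * flatCone a (chartFun hP hp m i)
          (diff n (chartFun hP hp) m v i) (diff n (chartFun hP hp) m w i) := by
      simp only [flatCone, hnorm, t, ← hk]
      simp only [polarRe, polarIm]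
      field_simp
    rw [← hflat]
    ring
  · intro m hm
    have hmT := hmemT m (Or.inr hm)
    have hms := hsource (Or.inr hm)
    have hL0 : P.L k (moment m) = 0 := hm.1
    have ht0 : t (moment m) = 0 := by simp only [t, hL0, mul_zero]
    have hz0 : chartFun hP hp m i = 0 := by
      have := L_moment_eq hp hms i
      rw [hL0] at this
      simpa using this.symm
    have hz : ∀ j, j ≠ i → chartFun hP hp m j ≠ 0 := fun j hj =>
      chartFun_ne_zero hp hms (hm.2 _ fun h => hj ((vertexIdx hp).injective h))
    have hs0 : ∀ j, s (moment m) j ≠ 0 := by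
      intro j
      by_cases hj : j = i
      · simp only [s, hj, Function.update_self]; exact ha.ne'
      · simp only [s, Function.update_of_ne hj]
        exact inv_ne_zero (mul_ne_zero two_ne_zero
          (hm.2 _ fun h => hj ((vertexIdx hp).injective h)).ne')
    have hC₀pos : ∀ ψ : Fin n → ℝ, ψ ≠ 0 → ψ i = 0 → 0 < ψ ⬝ᵥ C₀ (moment m) *ᵥ ψ := by
      intro ψ hψ hψi
      have h1 := regularInverse_zero_pos (hKpos _ hm) hψ hψi
      rw [← ht0] at h1
      have h2 : ψ ⬝ᵥ (regularInverse i (t (moment m)) (K (moment m)))ᵀ *ᵥ ψ =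
          ψ ⬝ᵥ regularInverse i (t (moment m)) (K (moment m)) *ᵥ ψ := by
        rw [Matrix.mulVec_transpose, Matrix.dotProduct_mulVec, dotProduct_comm]
      simp only [C₀]
      rw [Matrix.smul_mulVec, Matrix.add_mulVec, dotProduct_smul, dotProduct_add, h2, smul_eq_mul]
      linarith
    refine ⟨fun v hv hv0 => ?_, fun v => ?_⟩
    -- On the kernel of dz_i the i-th components of both vectors vanish, and there both K and C₀ are
    -- positive. The two vectors cannot both be zero: for j ≠ i they determine dz_j since z_j ≠ 0.
    · rw [hB]
      have hrei : polarRe hp m v i = 0 := by simp [polarRe, hv]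
      have himi : (fun j => polarIm hp m v j * s (moment m) j) i = 0 := by simp [polarIm, hv]
      by_cases h1 : polarRe hp m v = 0
      · have h2 : (fun j => polarIm hp m v j * s (moment m) j) ≠ 0 := by
          intro h2
          refine hv0 ((diff_chartFun_bijective hp hms).1 ?_)
          rw [map_zero]
          ext j
          by_cases hj : j = i
          · rw [hj, hv]; rfl
          · refine diff_chartFun_eq_zero_of_polar hp (hz j hj) (congrFun h1 j) ?_
            exact (mul_eq_zero.1 (congrFun h2 j)).resolve_right (hs0 j)
        rw [h1]
        simpa using hC₀pos _ h2 himi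
      · have e1 := hKpos _ hm _ h1 hrei
        by_cases h2 : (fun j => polarIm hp m v j * s (moment m) j) = 0
        · rw [h2]; simpa using e1
        · exact add_pos e1 (hC₀pos _ h2 himi)
    -- The vector v' is v with its z_i-component removed. The difference has only that component,
    -- and conj(z_i) = 0 on the divisor, so all forms conj(z_j) dz_j annihilate it and it lies in
    -- the radical of B.
    · obtain ⟨v', hv'⟩ := (diff_chartFun_bijective hp hms).2
        (Function.update (diff n (chartFun hP hp) m v) i 0)
      refine ⟨v', by rw [hv']; simp, fun v'' => ?_⟩
      have hdiff : ∀ j, starRingEnd ℂ (chartFun hP hp m j) *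
          diff n (chartFun hP hp) m (v - v') j = 0 := by
        intro j
        rw [map_sub, hv']
        by_cases hj : j = i
        · rw [hj, hz0]; simp
        · simp [Function.update_of_ne hj]
      have h1 : polarRe hp m (v - v') = 0 := by ext j; simp only [polarRe, hdiff]; rfl
      have h2 : polarIm hp m (v - v') = 0 := by ext j; simp only [polarIm, hdiff]; rfl
      rw [polarTensor_apply, h1, h2]
      simp

end Cone

/-! ### Sums and differences of smooth tensor fields -/

section TensorOperations

variable {n : ℕ} {M : Type*} [TopologicalSpace M] [ChartedSpace (Fin n → ℂ) M]
  [IsManifold 𝓘(ℝ, Fin n → ℂ) ∞ M] {g g' : Tensor2 n M} {U : Set M}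

lemma SmoothOn.add (hU : IsOpen U) (hg : SmoothOn g U) (hg' : SmoothOn g' U) :
    SmoothOn (fun m => g m + g' m) U := fun _ hm =>
  ContMDiffAt.contMDiffWithinAt <| tensor_contMDiffAt_iff.2 fun v w =>
    (tensor_contMDiffAt_iff.1 (ContMDiffOn.contMDiffAt hg (hU.mem_nhds hm)) v w).add
      (tensor_contMDiffAt_iff.1 (ContMDiffOn.contMDiffAt hg' (hU.mem_nhds hm)) v w)

lemma SmoothOn.sub (hU : IsOpen U) (hg : SmoothOn g U) (hg' : SmoothOn g' U) :
    SmoothOn (fun m => g m - g' m) U := fun _ hm =>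
  ContMDiffAt.contMDiffWithinAt <| tensor_contMDiffAt_iff.2 fun v w =>
    (tensor_contMDiffAt_iff.1 (ContMDiffOn.contMDiffAt hg (hU.mem_nhds hm)) v w).sub
      (tensor_contMDiffAt_iff.1 (ContMDiffOn.contMDiffAt hg' (hU.mem_nhds hm)) v w)

end TensorOperations

/-! ### The flat cone metric near its tip -/

section FlatCone

lemma flatCone_one {z : ℂ} (hz : z ≠ 0) (ζ ζ' : ℂ) :
    flatCone 1 z ζ ζ' = ζ.re * ζ'.re + ζ.im * ζ'.im := by
  have h : z.re ^ 2 + z.im ^ 2 ≠ 0 := by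
    have := Complex.normSq_pos.2 hz
    rw [Complex.normSq_apply] at this
    nlinarith
  rw [flatCone, ← Complex.normSq_eq_norm_sq, Complex.normSq_apply, ← sq, ← sq, div_eq_iff h]
  simp only [Complex.mul_re, Complex.mul_im, Complex.conj_re, Complex.conj_im]
  ring

/-- Homogeneity of degree 0 in the base point: along a line through the tip the value depends only
on the direction of the line. The proof that the metric does not extend rests on this. -/
lemma flatCone_ofReal_mul (a : ℝ) {s : ℝ} (hs : s ≠ 0) (c ζ ζ' : ℂ) :
    flatCone a (s * c) ζ ζ' = flatCone a c ζ ζ' := by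
  simp only [flatCone, map_mul, Complex.conj_ofReal, mul_assoc, Complex.re_ofReal_mul,
    Complex.im_ofReal_mul, norm_mul, Complex.norm_real, mul_pow, Real.norm_eq_abs, sq_abs]
  rw [← mul_div_mul_left _ (‖c‖ ^ 2) (pow_ne_zero 2 hs)]
  ring

lemma continuous_flatCone (a : ℝ) (c : ℂ) : Continuous fun ζ : ℂ => flatCone a c ζ ζ := by
  unfold flatCone
  fun_prop

end FlatCone

/-! ### Relabelled polytopes and the cone form of their potentials -/

section Potentials

variable {n d : ℕ} {P Q : LabelledPolytope n d}

lemma LabelledPolytope.SamePolytope.closedSet_eq (h : P.SamePolytope Q) :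
    Q.closedSet = P.closedSet := by
  ext x
  refine forall_congr' fun j => ?_
  obtain ⟨c, hc, -, hL⟩ := h.exists_scale j
  rw [hL, mul_nonneg_iff_of_pos_left hc]

lemma LabelledPolytope.SamePolytope.L_pos_iff (h : P.SamePolytope Q) {j : Fin d}
    {x : Fin n → ℝ} : 0 < Q.L j x ↔ 0 < P.L j x := by
  obtain ⟨c, hc, -, hL⟩ := h.exists_scale j
  rw [hL, mul_pos_iff_of_pos_left hc]

lemma LabelledPolytope.SamePolytope.exists_ratio (h : P.SamePolytope Q) (k : Fin d) :
    ∃ a : ℝ, 0 < a ∧ (∀ b : ℝ, b • Q.normal k = P.normal k ↔ b = a) ∧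
      ∀ x, Q.L k x = a⁻¹ * P.L k x := by
  obtain ⟨c, hc, hn, hL⟩ := h.exists_scale k
  refine ⟨c⁻¹, inv_pos.2 hc, fun b => ?_, fun x => by rw [inv_inv, hL]⟩
  rw [hn, smul_smul]
  constructor
  · intro hb
    have h1 : (b * c - 1) • P.normal k = 0 := by rw [sub_smul, hb, one_smul, sub_self]
    have h2 := (smul_eq_zero.1 h1).resolve_right (normal_ne_zero P k)
    exact eq_inv_of_mul_eq_one_left (sub_eq_zero.1 h2)
  · rintro rfl
    rw [inv_mul_cancel₀ hc.ne', one_smul]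

variable {Λ : Submodule ℤ (Fin n → ℝ)} {hP : P.IsDelzant Λ} {p : Fin n → ℝ} (hp : P.IsVertex p)

/-- The metric of a symplectic potential near the preimage of the interior of a facet. -/
lemma LabelledPolytope.IsSymplecticPotential.exists_isConeForm (hPQ : P.SamePolytope Q)
    {u : (Fin n → ℝ) → ℝ} (hu : Q.IsSymplecticPotential u) {i : Fin n} {k : Fin d}
    (hik : vertexIdx hp i = k) {a : ℝ} (hak : a • Q.normal k = P.normal k) :
    ∃ B, IsConeForm (hP := hP) hp i k a (metric hP u) B := by
  obtain ⟨a', ha, huniq, hL⟩ := hPQ.exists_ratio k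
  obtain rfl : a = a' := (huniq a).1 hak
  have hn : Q.normal k = a⁻¹ • P.normal k := by rw [← hak, inv_smul_smul₀ ha.ne']
  obtain ⟨W, f, hW, hf, hmem, huf⟩ := hu.exists_regular_part k
  have hmemW : ∀ x ∈ P.closedSet, (∀ j, j ≠ k → 0 < P.L j x) → x ∈ W := fun x hx h =>
    hmem x (by rwa [hPQ.closedSet_eq]) fun j hj => hPQ.L_pos_iff.2 (h j hj)
  refine exists_cone_form hp hik ha hW hf hmemW ?_ ?_ ?_
  · intro x hx
    have hx' : x ∈ Q.openSet := by rwa [hPQ.openSet_eq]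
    have hLk := hx k
    have hev : u =ᶠ[𝓝 x] fun y => 1 / 2 * (Q.L k y * Real.log (Q.L k y)) + f y := by
      filter_upwards [isOpen_openSet.mem_nhds hx'] with y hy
      exact huf y (closedSet_of_openSet hy)
    rw [hess_congr hev, hess_add (contDiffAt_mul_log k (hx' k)) (hf.contDiffAt
      (hW.mem_nhds (hmemW x (closedSet_of_openSet hx) fun j _ => hx j))), hess_mul_log k (hx' k),
      hL, hn, Matrix.smul_vecMulVec, Matrix.vecMulVec_smul, smul_smul, smul_smul]
    -- The singular coefficient is 1/(2 a⁻¹ L_k) · a⁻¹ · a⁻¹ = 1/(2 a L_k): the normal enters twice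
    -- and the defining function once.
    congr 2
    field_simp
  · intro x hx v hv
    exact hu.posDef (by rwa [hPQ.openSet_eq]) hv
  · intro x hx v hv hvk
    have hx' : x ∈ Q.facetInterior k :=
      ⟨by rw [hL, hx.1, mul_zero], fun j hj => hPQ.L_pos_iff.2 (hx.2 j hj)⟩
    have hxc : x ∈ P.closedSet := fun j => by
      by_cases hj : j = k
      · rw [hj, hx.1]
      · exact (hx.2 j hj).le
    refine hu.posDef_facet huf hx' (hf.contDiffAt (hW.mem_nhds (hmemW x hxc hx.2))) hv ?_
    rw [hn, dotProduct_smul, hvk, smul_zero]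

end Potentials

/-! ### Consequences of the cone form along a divisor -/

section ConeForm

variable {n d : ℕ} {P : LabelledPolytope n d} {Λ : Submodule ℤ (Fin n → ℝ)} {hP : P.IsDelzant Λ}
  {p : Fin n → ℝ} {hp : P.IsVertex p} {i : Fin n} {k : Fin d} {a : ℝ}
  {g B : Tensor2 n (ToricManifold P Λ hP)}

lemma chartFun_eq_zero_iff (hik : vertexIdx hp i = k) {m : ToricManifold P Λ hP}
    (hm : m ∈ freeLocus hP ∪ divisor hP k) : chartFun hP hp m i = 0 ↔ m ∈ divisor hP k := by
  have hL := L_moment_eq hp (freeLocus_union_divisor_subset hp hik hm) i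
  rw [freeLocus_union_divisor] at hm
  rw [hik] at hL
  constructor
  · intro h
    exact ⟨by rw [hL, h]; simp, hm⟩
  · intro h
    rw [h.1] at hL
    simpa using hL.symm

lemma IsConeForm.hasAngleAlong (h : IsConeForm hp i k a g B) (hik : vertexIdx hp i = k)
    (ha : 0 < a) : HasAngleAlong g (freeLocus hP) (divisor hP k) (2 * Real.pi * a) := by
  intro q hq
  have hsub := freeLocus_union_divisor_subset (hP := hP) hp hik
  refine ⟨freeLocus hP ∪ divisor hP k, fun m => chartFun hP hp m i, a⁻¹, B,
    isOpen_freeLocus_union_divisor k, Or.inr hq, subset_rfl, inv_pos.2 ha,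
    (contMDiffOn_chartFun_apply hp i).mono hsub, ?_, fun m hm => chartFun_eq_zero_iff hik hm,
    h.smooth, h.symm, ?_, ?_⟩
  · intro m hm c
    obtain ⟨v, hv⟩ := (diff_chartFun_bijective hp (hsub hm)).2 (Pi.single i c)
    exact ⟨v, by rw [diff_chartFun_apply hp (hsub hm), hv, Pi.single_eq_same]⟩
  · intro m hm hmD v v'
    rw [diff_chartFun_apply hp (hsub hm), diff_chartFun_apply hp (hsub hm),
      mul_div_cancel_left₀ a (by positivity)]
    exact h.eq m (hm.resolve_right hmD) v v'
  · intro m hm hmD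
    simp only [diff_chartFun_apply hp (hsub hm)]
    exact h.along m hmD

variable (hp i) in
/-- The tensor field `dx² + dy²` for the coordinate `z_i = x + √-1 y` at a vertex. -/
def flatTensor : Tensor2 n (ToricManifold P Λ hP) := fun m =>
  let form : TangentSpace 𝓘(ℝ, Fin n → ℂ) m →L[ℝ] ℂ :=
    (ContinuousLinearMap.proj (R := ℝ) (φ := fun _ : Fin n => ℂ) i).comp
      (diff n (chartFun hP hp) m)
  (Complex.reCLM.comp form).smulRight (Complex.reCLM.comp form) +
    (Complex.imCLM.comp form).smulRight (Complex.imCLM.comp form)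

lemma flatTensor_apply (m : ToricManifold P Λ hP) (v w : TangentSpace 𝓘(ℝ, Fin n → ℂ) m) :
    flatTensor hp i m v w =
      (diff n (chartFun hP hp) m v i).re * (diff n (chartFun hP hp) m w i).re +
      (diff n (chartFun hP hp) m v i).im * (diff n (chartFun hP hp) m w i).im := by
  simp only [flatTensor, add_apply, smul_apply, ContinuousLinearMap.smulRight_apply, smul_eq_mul]
  rfl

lemma smoothOn_flatTensor : SmoothOn (flatTensor (hP := hP) hp i) (chartSource hP p) := by
  let coord : (Fin n → ℂ) →L[ℝ] ℂ :=
    ContinuousLinearMap.proj (R := ℝ) (φ := fun _ : Fin n => ℂ) i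
  refine smoothOn_of_pullback (isOpen_chartSource hp) (contMDiffOn_chartFun hp)
    (β := fun _ => (Complex.reCLM.comp coord).smulRight (Complex.reCLM.comp coord) +
      (Complex.imCLM.comp coord).smulRight (Complex.imCLM.comp coord)) contMDiffOn_const ?_
  intro m _ v w
  rw [flatTensor_apply]
  rfl

/-- For a = 1 the cone term is the flat metric of the coordinate z_i, smooth across z_i = 0. On the
divisor it is positive transversally, while B is positive on the kernel of dz_i and nonnegative
everywhere. -/
lemma IsConeForm.isSmoothAlong (h : IsConeForm hp i k 1 g B) (hik : vertexIdx hp i = k)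
    (hg : IsMetricOn g (freeLocus hP)) : IsSmoothAlong g (freeLocus hP) (divisor hP k) := by
  have hsub := freeLocus_union_divisor_subset (hP := hP) hp hik
  have heq : ∀ m ∈ freeLocus hP, flatTensor hp i m + B m = g m := by
    intro m hm
    have hz : chartFun hP hp m i ≠ 0 := by
      rw [freeLocus_eq] at hm
      exact chartFun_ne_zero hp (mem_chartSource_of_openSet hm) (hm _)
    ext v w
    rw [h.eq m hm, flatCone_one hz, inv_one, one_mul]
    exact congrArg (· + B m v w) (flatTensor_apply m v w)
  refine ⟨fun m => flatTensor hp i m + B m, ⟨?_, ?_, ?_⟩, heq⟩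
  · exact SmoothOn.add (isOpen_freeLocus_union_divisor k) (smoothOn_flatTensor.mono hsub) h.smooth
  · intro m hm v w
    have h1 := h.symm m hm v w
    change flatTensor hp i m v w + B m v w = flatTensor hp i m w v + B m w v
    rw [flatTensor_apply, flatTensor_apply, h1]
    ring
  · rintro m (hm | hm) v hv
    · rw [heq m hm]
      exact hg.pos m hm v hv
    · change 0 < flatTensor hp i m v v + B m v v
      obtain ⟨v', hv', hrad⟩ := (h.along m hm).2 v
      -- As v - v' is in the radical of B, the value at v equals the value at a vector tangent to
      -- the divisor.
      have hBv : B m v v = B m v' v' := by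
        have e1 := hrad v
        have e2 := hrad v'
        rw [map_sub, sub_apply] at e1 e2
        have e3 := h.symm m (Or.inr hm) v v'
        linarith
      rw [flatTensor_apply]
      set ζ := diff n (chartFun hP hp) m v i with hζ
      by_cases h0 : ζ = 0
      · rw [h0]
        simpa using (h.along m hm).1 v h0 hv
      · have h1 : 0 < ζ.re * ζ.re + ζ.im * ζ.im := by
          rw [← Complex.normSq_apply]; exact Complex.normSq_pos.2 h0
        have h2 : 0 ≤ B m v v := by
          rw [hBv]
          by_cases hv0 : v' = 0
          · rw [hv0]; simp
          · exact ((h.along m hm).1 v' hv' hv0).le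
        linarith

/-- A metric with cone angle `2πa`, `a ≠ 1`, does not extend smoothly across any point. -/
lemma IsConeForm.not_extends (h : IsConeForm hp i k a g B) (hik : vertexIdx hp i = k)
    (ha : 0 < a) (ha1 : a ≠ 1) {q : ToricManifold P Λ hP} (hq : q ∈ divisor hP k) :
    ¬ ∃ (U : Set (ToricManifold P Λ hP)) (B' : Tensor2 n (ToricManifold P Λ hP)), IsOpen U ∧
      q ∈ U ∧ SmoothOn B' U ∧ ∀ m ∈ U ∩ freeLocus hP, B' m = g m := by
  rintro ⟨U, B', hU, hqU, hB', hext⟩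
  have hsub := freeLocus_union_divisor_subset (hP := hP) hp hik
  have hqs := hsub (Or.inr hq)
  have hz0 : chartFun hP hp q i = 0 := (chartFun_eq_zero_iff hik (Or.inr hq)).2 hq
  -- A vector with dz_i = 1 and all other components 0, extended near q by the frame. On it the
  -- difference B' - B is the cone term at nearby free points, and it is continuous at q.
  obtain ⟨v, hv⟩ := (diff_chartFun_bijective hp hqs).2 (Pi.single i 1)
  let F : ToricManifold P Λ hP → ℝ := fun m =>
    B' m (frame n q m v) (frame n q m v) - B m (frame n q m v) (frame n q m v)
  have hF : ContinuousAt F q := (hB'.continuousAt_frame hU hqU v v).sub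
    (h.smooth.continuousAt_frame (isOpen_freeLocus_union_divisor k) (Or.inr hq) v v)
  let ζ : ToricManifold P Λ hP → ℂ := fun m => diff n (chartFun hP hp) m (frame n q m v) i
  have hζ : ContinuousAt ζ q := (continuous_apply i).continuousAt.comp
    (contMDiffAt_diff_frame (contMDiffAt_chartFun hp hqs) v).continuousAt
  have hζq : ζ q = 1 := by
    simp only [ζ, frame_self]
    exact (congrFun hv i).trans (Pi.single_eq_same i _)
  let e := chartHomeo hP hp
  -- The point q is approached along z_i = s c with s real and the other coordinates fixed. The cone
  -- term does not depend on s ≠ 0 except through dz_i, which tends to 1.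
  have hlim : ∀ c : ℂ, c ≠ 0 → F q = a⁻¹ * flatCone a c 1 1 := by
    intro c hc
    let γ : ℝ → ToricManifold P Λ hP := fun s =>
      e.symm (Function.update (chartFun hP hp q) i ((s : ℂ) * c))
    have hpath : Continuous fun s : ℝ => Function.update (chartFun hP hp q) i ((s : ℂ) * c) :=
      continuous_const.update i (by fun_prop)
    have hpath0 : Function.update (chartFun hP hp q) i (((0 : ℝ) : ℂ) * c) = e q := by
      have : ((0 : ℝ) : ℂ) * c = chartFun hP hp q i := by rw [hz0]; simp
      rw [this, Function.update_eq_self]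
      rfl
    have hγ0 : γ 0 = q := by
      simp only [γ, hpath0]
      exact e.left_inv hqs
    have hγ : ContinuousAt γ 0 := by
      refine ContinuousAt.comp (g := e.symm) ?_ hpath.continuousAt
      rw [hpath0]
      exact e.continuousAt_symm (e.map_source hqs)
    have htarget : ∀ᶠ s : ℝ in 𝓝 0,
        Function.update (chartFun hP hp q) i ((s : ℂ) * c) ∈ e.target :=
      hpath.continuousAt.eventually (e.open_target.mem_nhds (by
        beta_reduce
        rw [hpath0]; exact e.map_source hqs))
    have hmem : ∀ᶠ s in 𝓝 0, γ s ∈ U ∩ (freeLocus hP ∪ divisor hP k) :=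
      hγ.eventually (by
        rw [hγ0]
        exact (hU.inter (isOpen_freeLocus_union_divisor k)).mem_nhds ⟨hqU, Or.inr hq⟩)
    have hev : ∀ᶠ s in 𝓝[≠] (0 : ℝ), a⁻¹ * flatCone a c (ζ (γ s)) (ζ (γ s)) = F (γ s) := by
      filter_upwards [nhdsWithin_le_nhds htarget, nhdsWithin_le_nhds hmem,
        self_mem_nhdsWithin] with s hs1 hs2 hs
      have hcoord : chartFun hP hp (γ s) i = (s : ℂ) * c := by
        have : chartFun hP hp (γ s) = _ := e.right_inv hs1
        rw [this, Function.update_self]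
      have hfree : γ s ∈ freeLocus hP := hs2.2.resolve_right fun hD => by
        rw [← chartFun_eq_zero_iff hik hs2.2, hcoord] at hD
        exact mul_ne_zero (Complex.ofReal_ne_zero.2 hs) hc hD
      simp only [F]
      rw [hext _ ⟨hs2.1, hfree⟩, h.eq _ hfree, hcoord, flatCone_ofReal_mul a hs]
      ring
    have h1 : Filter.Tendsto (fun s => F (γ s)) (𝓝[≠] 0) (𝓝 (F q)) := by
      rw [← hγ0] at hF ⊢
      exact (hF.comp hγ).tendsto.mono_left nhdsWithin_le_nhds
    have h2 : Filter.Tendsto (fun s => a⁻¹ * flatCone a c (ζ (γ s)) (ζ (γ s))) (𝓝[≠] 0)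
        (𝓝 (a⁻¹ * flatCone a c 1 1)) := by
      have h3 : Filter.Tendsto (fun s => ζ (γ s)) (𝓝[≠] 0) (𝓝 1) := by
        rw [← hζq]
        rw [← hγ0] at hζ ⊢
        exact (hζ.comp hγ).tendsto.mono_left nhdsWithin_le_nhds
      exact (((continuous_flatCone a c).tendsto 1).comp h3).const_mul _
    exact tendsto_nhds_unique (h1.congr' (hev.mono fun _ hs => hs.symm)) h2
  -- The direction c = 1 is radial for the vector 1 and gives a⁻¹. The direction c = √-1 makes it
  -- angular and gives a⁻¹ a² = a. Equality forces a² = 1.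
  have e1 := (hlim 1 one_ne_zero).symm.trans (hlim Complex.I Complex.I_ne_zero)
  have e2 : a = 1 ∨ a = -1 := by simpa [flatCone, ha.ne'] using e1
  exact e2.elim ha1 fun h => by linarith

lemma IsConeForm.exists_sub {g' B' : Tensor2 n (ToricManifold P Λ hP)}
    (h : IsConeForm hp i k a g B) (h' : IsConeForm hp i k a g' B') :
    ∃ A : Tensor2 n (ToricManifold P Λ hP), SmoothOn A (freeLocus hP ∪ divisor hP k) ∧
      ∀ m ∈ freeLocus hP, A m = g m - g' m := by
  refine ⟨fun m => B m - B' m,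
    SmoothOn.sub (isOpen_freeLocus_union_divisor k) h.smooth h'.smooth, fun m hm => ?_⟩
  ext v w
  change B m v w - B' m v w = g m v w - g' m v w
  rw [h.eq m hm, h'.eq m hm]
  ring

end ConeForm

end Toric

end

theorem mainTheorem10 {n d : ℕ} (P : Toric.LabelledPolytope n d) (Λ : Submodule ℤ (Fin n → ℝ))
    (hP : P.IsDelzant Λ) (Q : Toric.LabelledPolytope n d) (hPQ : P.SamePolytope Q)
    (u : (Fin n → ℝ) → ℝ) (hu : Q.IsSymplecticPotential u) :
    -- the locus where the torus acts freely is open and dense, and lies over the open polytope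
    (IsOpen (Toric.freeLocus hP) ∧ Dense (Toric.freeLocus hP) ∧
      Toric.freeLocus hP = {m | m.moment ∈ P.openSet}) ∧
    -- in action-angle coordinates the symplectic form is `dx ∧ dθ`, and `g_u` is `G dx² + H dθ²`
    (∀ x ∈ P.openSet, ∀ (θ : Fin n → ℝ) (a b : (Fin n → ℝ) × (Fin n → ℝ)),
      Toric.symplecticForm hP (.pt hP (x, θ))
          (Toric.dpt hP x θ a) (Toric.dpt hP x θ b) =
        a.1 ⬝ᵥ b.2 - a.2 ⬝ᵥ b.1 ∧
      Toric.metric hP u (.pt hP (x, θ))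
          (Toric.dpt hP x θ a) (Toric.dpt hP x θ b) =
        a.1 ⬝ᵥ Toric.hess u x *ᵥ b.1 + a.2 ⬝ᵥ (Toric.hess u x)⁻¹ *ᵥ b.2) ∧
    -- `g_u` is a `T`-invariant Kähler metric on the free locus, compatible with the symplectic form
    Toric.IsInvariantOn hP (Toric.metric hP u) (Toric.freeLocus hP) ∧
    Toric.IsKahlerOn (Toric.metric hP u) (Toric.symplecticForm hP) (Toric.freeLocus hP) ∧
    -- the behaviour of `g_u` along the preimage of the interior of each facet
    ∀ k : Fin d, ∃ a : ℝ, 0 < a ∧ (∀ b : ℝ, b • Q.normal k = P.normal k ↔ b = a) ∧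
      (a < 1 → Toric.IsConicalAlong (Toric.metric hP u) (Toric.freeLocus hP) (Toric.divisor hP k)
        (2 * Real.pi * a)) ∧
      (a = 1 → Toric.IsSmoothAlong (Toric.metric hP u) (Toric.freeLocus hP) (Toric.divisor hP k)) ∧
      (1 < a → Toric.IsLargeAngleAlong (Toric.metric hP u) (Toric.freeLocus hP) (Toric.divisor hP k)
        (2 * Real.pi * a)) ∧
      -- for `a ≠ 1` the metric is singular at each point
      (a ≠ 1 → ∀ q ∈ Toric.divisor hP k, ¬ ∃ (U : Set (P.ToricManifold Λ hP))
        (B : Toric.Tensor2 n (P.ToricManifold Λ hP)), IsOpen U ∧ q ∈ U ∧ Toric.SmoothOn B U ∧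
        ∀ m ∈ U ∩ Toric.freeLocus hP, B m = Toric.metric hP u m) ∧
      -- up to tensors that are smooth across the preimage, the metric depends only on `a`
      (∀ Q' : Toric.LabelledPolytope n d, P.SamePolytope Q' → a • Q'.normal k = P.normal k →
        ∀ u' : (Fin n → ℝ) → ℝ, Q'.IsSymplecticPotential u' →
          ∃ B : Toric.Tensor2 n (P.ToricManifold Λ hP),
            Toric.SmoothOn B (Toric.freeLocus hP ∪ Toric.divisor hP k) ∧
            ∀ m ∈ Toric.freeLocus hP, B m = Toric.metric hP u m - Toric.metric hP u' m) := by
  have hpos : ∀ x ∈ P.openSet, ∀ v, v ≠ 0 → 0 < v ⬝ᵥ Toric.hess u x *ᵥ v := fun x hx v hv =>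
    hu.posDef (by rwa [hPQ.openSet_eq]) hv
  have hK : Toric.IsKahlerOn (Toric.metric hP u) (Toric.symplecticForm hP) (Toric.freeLocus hP) :=
    Toric.isKahlerOn_metric (hPQ.openSet_eq ▸ hu.contDiffOn) hpos
  refine ⟨⟨Toric.isOpen_freeLocus, Toric.dense_freeLocus, Toric.freeLocus_eq⟩, ?_,
    Toric.metric_invariant u, hK, fun k => ?_⟩
  · intro x hx θ a b
    have hm : Toric.LabelledPolytope.ToricManifold.moment
        (Toric.LabelledPolytope.ToricManifold.pt hP (x, θ)) = x :=
      Toric.LabelledPolytope.ToricManifold.moment_pt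
        (Toric.LabelledPolytope.closedSet_of_openSet hx)
    rw [Toric.symplecticForm_eq_coframe (by rwa [hm]), Toric.metric_apply,
      Toric.coframe_dpt hx, Toric.coframe_dpt hx, hm]
    exact ⟨rfl, rfl⟩
  · obtain ⟨a, ha, huniq, -⟩ := hPQ.exists_ratio k
    -- One vertex of F_k suffices: its chart contains the free locus together with the whole of D_k.
    obtain ⟨y, hy0, hy⟩ := P.facet' k
    have hyc : y ∈ P.closedSet := fun j => by
      by_cases hj : j = k
      · rw [hj]; exact hy0.ge
      · exact (hy j hj).le
    obtain ⟨p, hp, hsub⟩ := Toric.LabelledPolytope.exists_vertex hyc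
    obtain ⟨i, hik⟩ := (Toric.LabelledPolytope.mem_active_vertex hp).1
      (hsub (Toric.LabelledPolytope.mem_active.2 hy0))
    obtain ⟨B, hB⟩ := hu.exists_isConeForm (hP := hP) hp hPQ hik ((huniq a).2 rfl)
    have hpi := Real.pi_pos
    refine ⟨a, ha, huniq, fun h1 => ⟨by positivity, by nlinarith, hB.hasAngleAlong hik ha⟩, ?_,
      fun h1 => ⟨by nlinarith, hB.hasAngleAlong hik ha⟩,
      fun h1 q hq => hB.not_extends hik ha h1 hq, ?_⟩
    · rintro rfl
      exact hB.isSmoothAlong hik hK.metric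
    · intro Q' hPQ' hak u' hu'
      -- The same vertex, index and a are used for both potentials, so their cone terms are
      -- identical and cancel in the difference.
      obtain ⟨B', hB'⟩ := hu'.exists_isConeForm (hP := hP) hp hPQ' hik hak
      exact hB.exists_sub hB'
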